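/- Consider the class of evolution equations \[ u_t=F(t,x,u,u_x,u_{xx},u_{xxx})\,u_{xxxx}+G(t,x,u,u_x,u_{xx},u_{xxx}),\qquad (1) \] where $F,G$ are smooth real functions on an open set $\Omega\subseteq\mathbb R^6$ and $F$ vanishes nowhere on $\Omega$. Let $M\subseteq\mathbb R^3$ be the projection of $\Omega$ to the space of $(t,x,u)$. A smooth vector field $V=\tau(t,x,u)\partial_t+\xi(t,x,u)\partial_x+\eta(t,x,u)\partial_u$ on $M$ is a symmetry of (1) if it satisfies Lie's infinitesimal invariance criterion: its fourth prolongation annihilates $u_t-Fu_{xxxx}-G$ at all jets over $\Omega$ with $u_t=Fu_{xxxx}+G$. A two-dimensional symmetry algebra of (1) is a two-dimensional real Lie algebra of symmetries whose restriction to every nonempty open subset of $M$ is still two-dimensional. Equivalence is understood locally, under the invertible smooth transformations $\bar t=T(t)$, $\bar x=X(t,x,u)$, $\bar u=U(t,x,u)$ with $\dot T\ne0$ and $\frac{D(X,U)}{D(x,u)}\neq0$, which act on vector fields by push-forward and on equations by change of variables. Up to equivalence there are exactly three Abelian ($[V_1,V_2]=0$) and four non-Abelian ($[V_1,V_2]=V_2$)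 two-dimensional symmetry algebras $\langle V_1,V_2\rangle$ admitted by the class (1). These algebras and the corresponding invariant equations are as follows, where in each row $f$ and $g$ are arbitrary smooth functions ($f\ne0$) of the four listed arguments $\omega$: \[ \begin{array}{llll} \text{Algebra} & F & G & \omega\\ \hline A^1_{2.1}=\langle\partial_t,\partial_x\rangle & f(\omega) & g(\omega) & (u,u_x,u_{xx},u_{xxx})\\ A^2_{2.1}=\langle\partial_x,\partial_u\rangle & f(\omega) & g(\omega) & (t,u_x,u_{xx},u_{xxx})\\ A^3_{2.1}=\langle\partial_u,x\partial_u\rangle & f(\omega) & g(\omega) & (t,x,u_{xx},u_{xxx})\\ A^1_{2.2}=\langle -t\partial_t-x\partial_x,\partial_t\rangle & x^3f(\omega) & x^{-1}g(\omega) & (u,xu_x,x^2u_{xx},x^3u_{xxx})\\ A^2_{2.2}=\langle -t\partial_t-x\partial_x,\partial_x\rangle & t^3f(\omega) & t^{-1}g(\omega) & (u,tu_x,t^2u_{xx},t^3u_{xxx})\\ A^3_{2.2}=\langle -x\partial_x-u\partial_u,\partial_x\rangle & u^4f(\omega) & u\,g(\omega) & (t,u_x,uu_{xx},u^2u_{xxx})\\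 A^4_{2.2}=\langle -x\partial_x,\partial_x\rangle & u_x^{-4}f(\omega) & g(\omega) & (t,u,u_x^{-2}u_{xx},u_x^{-3}u_{xxx}) \end{array} \] The last four rows are considered where $x\ne0$, $t\neq0$, $u\ne0$, $u_x\neq0$, respectively; call these points regular (for the first three rows every point is regular). In detail: 1. Each of the seven algebras is a two-dimensional Lie algebra with the stated commutation relation, and is admitted by some equation of the class. 2. The seven algebras are pairwise inequivalent: no equivalence transformation defined on a nonempty open set $W\subseteq\mathbb R^3$ carries the restriction to $W$ of one of them to the restriction of another one. 3. Let an equation (1) on $\Omega$ admit a two-dimensional symmetry algebra $L$. Then every nonempty open subset of $\Omega$ contains a nonempty open subset $\Omega_1$, and there is an equivalence transformation defined on the projection of $\Omega_1$ to the space of $(t,x,u)$, which carries $L$ to one of the seven algebras (one of the first three if and only if $L$ is Abelian), and carries the equation (1) on $\Omega_1$ to an equation of the class, on the open image of $\Omega_1$, that has the form given in the row of this algebra, the image consisting of regular points. 4. For each of the seven algebras, an equation (1) on $\Omega$ admits the algebra if and only if, on every product of six open intervals that is contained in $\Omega$ and consists of regular points, $F$ and $G$ have the form given in the row of the algebra,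 with smooth $f,g$ (depending on the product set). -/

import Mathlib

open scoped ContDiff

namespace EvolutionSymmetry

/-- The space of the variables `(t, x, u)`. -/
abbrev Base := Fin 3 → ℝ

/-- The space of the arguments `(t, x, u, u_x, u_xx, u_xxx)` of `F` and `G`. -/
abbrev Jet3 := Fin 6 → ℝ

/-- Jet coordinates, in the order
`(t, x, u, u_x, u_xx, u_xxx, u_xxxx, u_t, u_tx, u_txx, u_txxx)`.
These are all the derivatives that occur in the fourth prolongation of a vector field applied to
`u_t - F u_xxxx - G`. -/
abbrev Jet := Fin 11 → ℝ

/-- The point `(t, x, u)` under a jet. -/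
def base (j : Jet) : Base := ![j 0, j 1, j 2]

/-- The part `(t, x, u, u_x, u_xx, u_xxx)` of a jet. -/
def jet3 (j : Jet) : Jet3 := ![j 0, j 1, j 2, j 3, j 4, j 5]

/-- The point `(t, x, u)` under a point of `Jet3`. -/
def base3 (z : Jet3) : Base := ![z 0, z 1, z 2]

/-- The equation `u_t = F u_xxxx + G` belongs to the class: `F` and `G` are smooth on the open set
`Ω`, and `F` does not vanish there. -/
structure IsEquation (F G : Jet3 → ℝ) (Ω : Set Jet3) : Prop where
  isOpen : IsOpen Ω
  smooth_F : ContDiffOn ℝ ∞ F Ω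
  smooth_G : ContDiffOn ℝ ∞ G Ω
  ne_zero : ∀ z ∈ Ω, F z ≠ 0

/-- The total derivative `D_x`, for functions that do not depend on `u_xxxx` and `u_txxx`
(it is applied only to such functions). -/
noncomputable def Dx (f : Jet → ℝ) (j : Jet) : ℝ :=
  fderiv ℝ f j ![0, 1, j 3, j 4, j 5, j 6, 0, j 8, j 9, j 10, 0]

/-- The total derivative `D_t` of a function of `(t, x, u)`: `f_t + u_t f_u`. -/
noncomputable def Dt (f : Base → ℝ) (j : Jet) : ℝ :=
  fderiv ℝ f (base j) ![1, 0, j 7]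

/-! A vector field `τ ∂_t + ξ ∂_x + η ∂_u` is a map `V : Base → Base` with `V b = (τ, ξ, η)`.
The coefficients `η^t, η^x, η^xx, η^xxx, η^xxxx` of its prolongation follow. -/

noncomputable def etaT (V : Base → Base) (j : Jet) : ℝ :=
  Dt (fun b => V b 2) j - j 7 * Dt (fun b => V b 0) j - j 3 * Dt (fun b => V b 1) j

noncomputable def eta1 (V : Base → Base) (j : Jet) : ℝ :=
  Dx (fun i => V (base i) 2) j
    - j 7 * Dx (fun i => V (base i) 0) j - j 3 * Dx (fun i => V (base i) 1) j

noncomputable def eta2 (V : Base → Base) (j : Jet) : ℝ :=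
  Dx (eta1 V) j
    - j 8 * Dx (fun i => V (base i) 0) j - j 4 * Dx (fun i => V (base i) 1) j

noncomputable def eta3 (V : Base → Base) (j : Jet) : ℝ :=
  Dx (eta2 V) j
    - j 9 * Dx (fun i => V (base i) 0) j - j 5 * Dx (fun i => V (base i) 1) j

noncomputable def eta4 (V : Base → Base) (j : Jet) : ℝ :=
  Dx (eta3 V) j
    - j 10 * Dx (fun i => V (base i) 0) j - j 6 * Dx (fun i => V (base i) 1) j

/-- The prolongation of `V` in the directions `(t, x, u, u_x, u_xx, u_xxx)`. -/
noncomputable def prolong3 (V : Base → Base) (j : Jet) : Jet3 :=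
  ![V (base j) 0, V (base j) 1, V (base j) 2, eta1 V j, eta2 V j, eta3 V j]

/-- Lie's infinitesimal invariance criterion: the prolongation of `V` annihilates
`u_t - F u_xxxx - G` at every jet over `Ω` that satisfies `u_t = F u_xxxx + G`. -/
def IsSymmetry (F G : Jet3 → ℝ) (Ω : Set Jet3) (V : Base → Base) : Prop :=
  ∀ j : Jet, jet3 j ∈ Ω → j 7 = F (jet3 j) * j 6 + G (jet3 j) →
    etaT V j - fderiv ℝ F (jet3 j) (prolong3 V j) * j 6 - F (jet3 j) * eta4 V j
      - fderiv ℝ G (jet3 j) (prolong3 V j) = 0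

/-- `V 0, V 1` is a basis of a two-dimensional Lie algebra of smooth vector fields on the open set
`M`. The restriction of the algebra to every nonempty open subset is again two-dimensional. -/
structure IsTwoDimLieAlgebra (M : Set Base) (V : Fin 2 → Base → Base) : Prop where
  isOpen : IsOpen M
  smooth : ∀ k, ContDiffOn ℝ ∞ (V k) M
  indep : ∀ W ⊆ M, IsOpen W → W.Nonempty →
    ∀ c : Fin 2 → ℝ, (∀ b ∈ W, ∑ k, c k • V k b = 0) → c = 0
  closed : ∃ c : Fin 2 → ℝ, ∀ b ∈ M,
    VectorField.lieBracket ℝ (V 0) (V 1) b = ∑ k, c k • V k b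

/-- The algebra with basis `V` is Abelian. -/
def IsAbelianOn (M : Set Base) (V : Fin 2 → Base → Base) : Prop :=
  ∀ b ∈ M, VectorField.lieBracket ℝ (V 0) (V 1) b = 0

/-- `φ = (T, X, U)` is an equivalence transformation `t' = T(t), x' = X(t,x,u), u' = U(t,x,u)`,
defined and invertible on the open set `W`. As `T` depends on `t` only, the Jacobian determinant is
`T'(t) · D(X,U)/D(x,u)`. -/
structure IsEquivalence (φ : Base → Base) (W : Set Base) : Prop where
  isOpen : IsOpen W
  smooth : ContDiffOn ℝ ∞ φ W
  injOn : Set.InjOn φ W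
  det_ne_zero : ∀ b ∈ W, (fderiv ℝ φ b).det ≠ 0
  time : ∃ T : ℝ → ℝ, ∀ b ∈ W, φ b 0 = T (b 0)

/-- The push-forward by `φ` of the algebra with basis `V`, restricted to `W`, is the algebra with
basis `V'`, restricted to `φ(W)`. -/
def CarriesAlgebra (φ : Base → Base) (W : Set Base) (V V' : Fin 2 → Base → Base) : Prop :=
  ∃ A : Matrix (Fin 2) (Fin 2) ℝ, A.det ≠ 0 ∧
    ∀ b ∈ W, ∀ k, fderiv ℝ φ b (V k b) = ∑ l, A k l • V' l (φ b)

/-! The derivatives `u'_t', u'_x', …, u'_x'x'x'x'` of the transformed function,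
as functions of the original jet. -/

/-- The factor `D_x X`. -/
noncomputable def DxX (φ : Base → Base) (j : Jet) : ℝ := Dx (fun i => φ (base i) 1) j

noncomputable def newU1 (φ : Base → Base) (j : Jet) : ℝ :=
  Dx (fun i => φ (base i) 2) j / DxX φ j

noncomputable def newU2 (φ : Base → Base) (j : Jet) : ℝ := Dx (newU1 φ) j / DxX φ j

noncomputable def newU3 (φ : Base → Base) (j : Jet) : ℝ := Dx (newU2 φ) j / DxX φ j

noncomputable def newU4 (φ : Base → Base) (j : Jet) : ℝ := Dx (newU3 φ) j / DxX φ j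

noncomputable def newUt (φ : Base → Base) (j : Jet) : ℝ :=
  (Dt (fun b => φ b 2) j - newU1 φ j * Dt (fun b => φ b 1) j) / Dt (fun b => φ b 0) j

noncomputable def newJet3 (φ : Base → Base) (j : Jet) : Jet3 :=
  ![φ (base j) 0, φ (base j) 1, φ (base j) 2, newU1 φ j, newU2 φ j, newU3 φ j]

/-- The change of variables `φ` turns the equation `u_t = F u_xxxx + G` on `Ω` into
`u_t = F' u_xxxx + G'` on `Ω'`. -/
structure CarriesEquation (φ : Base → Base) (F G : Jet3 → ℝ) (Ω : Set Jet3)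
    (F' G' : Jet3 → ℝ) (Ω' : Set Jet3) : Prop where
  regular : ∀ j, jet3 j ∈ Ω → DxX φ j ≠ 0
  image : newJet3 φ '' (jet3 ⁻¹' Ω) = Ω'
  equation : ∀ j, jet3 j ∈ Ω →
    (j 7 = F (jet3 j) * j 6 + G (jet3 j) ↔
      newUt φ j = F' (newJet3 φ j) * newU4 φ j + G' (newJet3 φ j))

/-- The canonical algebras: three Abelian ones and four non-Abelian ones.
`![τ, ξ, η]` stands for `τ ∂_t + ξ ∂_x + η ∂_u`, and `b = (t, x, u)`. -/
def canonical : Fin 3 ⊕ Fin 4 → Fin 2 → Base → Base :=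
  Sum.elim
    ![![fun _ => ![1, 0, 0], fun _ => ![0, 1, 0]],
      ![fun _ => ![0, 1, 0], fun _ => ![0, 0, 1]],
      ![fun _ => ![0, 0, 1], fun b => ![0, 0, b 1]]]
    ![![fun b => ![-b 0, -b 1, 0], fun _ => ![1, 0, 0]],
      ![fun b => ![-b 0, -b 1, 0], fun _ => ![0, 1, 0]],
      ![fun b => ![0, -b 1, -b 2], fun _ => ![0, 1, 0]],
      ![fun b => ![0, -b 1, 0], fun _ => ![0, 1, 0]]]

/-! The table of invariant equations: `F = coeffF i · f(invariants i)`,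
`G = coeffG i · g(invariants i)`, at the points of `regular i`. The coordinates are
`z = (t, x, u, u_x, u_xx, u_xxx)`. -/

/-- The set where the expressions in the table make sense. -/
def regular : Fin 3 ⊕ Fin 4 → Set Jet3 :=
  Sum.elim (fun _ => Set.univ)
    ![{z | z 1 ≠ 0}, {z | z 0 ≠ 0}, {z | z 2 ≠ 0}, {z | z 3 ≠ 0}]

noncomputable def coeffF : Fin 3 ⊕ Fin 4 → Jet3 → ℝ :=
  Sum.elim (fun _ _ => 1)
    ![fun z => z 1 ^ 3, fun z => z 0 ^ 3, fun z => z 2 ^ 4, fun z => (z 3 ^ 4)⁻¹]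

noncomputable def coeffG : Fin 3 ⊕ Fin 4 → Jet3 → ℝ :=
  Sum.elim (fun _ _ => 1)
    ![fun z => (z 1)⁻¹, fun z => (z 0)⁻¹, fun z => z 2, fun _ => 1]

noncomputable def invariants : Fin 3 ⊕ Fin 4 → Jet3 → (Fin 4 → ℝ) :=
  Sum.elim
    ![fun z => ![z 2, z 3, z 4, z 5],
      fun z => ![z 0, z 3, z 4, z 5],
      fun z => ![z 0, z 1, z 4, z 5]]
    ![fun z => ![z 2, z 1 * z 3, z 1 ^ 2 * z 4, z 1 ^ 3 * z 5],
      fun z => ![z 2, z 0 * z 3, z 0 ^ 2 * z 4, z 0 ^ 3 * z 5],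
      fun z => ![z 0, z 3, z 2 * z 4, z 2 ^ 2 * z 5],
      fun z => ![z 0, z 2, z 4 / z 3 ^ 2, z 5 / z 3 ^ 3]]

/-- On `B`, `F` and `G` have the form given in row `i` of the table, with smooth `f` and `g`. -/
def HasTableForm (i : Fin 3 ⊕ Fin 4) (F G : Jet3 → ℝ) (B : Set Jet3) : Prop :=
  B ⊆ regular i ∧
  ∃ f g : (Fin 4 → ℝ) → ℝ,
    ContDiffOn ℝ ∞ f (invariants i '' B) ∧ ContDiffOn ℝ ∞ g (invariants i '' B) ∧
    ∀ z ∈ B, F z = coeffF i z * f (invariants i z) ∧ G z = coeffG i z * g (invariants i z)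

/-- A product of open intervals, which may be unbounded. -/
def IsOpenBox (B : Set Jet3) : Prop :=
  ∃ I : Fin 6 → Set ℝ, (∀ k, IsOpen (I k) ∧ (I k).OrdConnected) ∧ B = Set.univ.pi I

end EvolutionSymmetry

open EvolutionSymmetry

open scoped ContDiff

/-! Two rigidity facts about a symmetry `τ ∂_t + ξ ∂_x + η ∂_u` make the list finite. First,
`u_txxx` enters the invariance criterion only through the term `-4 F D_x τ u_txxx` of `F η^xxxx`;
since it is a free coordinate and `F ≠ 0`, one gets `τ_x + u_x τ_u = 0`, and varying `u_x` shows
that `τ` depends on `t` alone (`IsSymmetry.isTimeOnly`). Second, if `h` depends on `t` only, then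
the prolongation of `h V` differs from `h` times that of `V` by `h' (η - u_t τ - u_x ξ) ∂_{u_t}`.
Hence two symmetries can be proportional with a time-dependent factor only where the factor has zero
derivative or the field vanishes (`IsSymmetry.fderiv_factor`). This excludes algebras such as `⟨∂_x,
t ∂_x⟩`, and gives `NotProportional` for every two-dimensional symmetry algebra.

The rest of the classification concerns pairs of vector fields `X, Y` with `[X, Y] = 0` or `[X, Y] =
Y`. One field is straightened to `∂_t` if its time component does not vanish, and otherwise to
`∂_x`. The commutation relation then fixes the dependence of the other field on the straightened
variable, and what remains is a straightening independent of that variable or a quadrature in `u`.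
The cases are distinguished by which time components vanish and, when all of them do, by whether the
two fields are independent at some point or proportional everywhere. In each case `NotProportional`
supplies a point where the coefficient to be divided by or straightened is nonzero. Only an
equivalence near some point is claimed, so neighbourhoods may be shrunk at will.

An equivalence transformation acts on jets by `jetMap`, and prolongation commutes with this action
(`IsEquivalence.fderiv_jetMap_prolongation`). The transformed derivatives `u'_t'` and `u'_x'x'x'x'`
are affine in `u_t` and `u_xxxx` with nonzero slopes, so the image of an equation is again an
equation of the class, and its defect is the old one times a nowhere zero factor. Symmetries
therefore go to symmetries (`IsEquivalence.exists_carriesEquation`).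

The rows of the table come from integrating the criterion for the canonical fields. These are
affine, and for them the criterion splits into two first-order linear equations, one for `F` and one
for `G`. Dividing by the coefficient of the row makes these functions invariant. On a box of regular
points any two points of a fibre of the four invariants are joined inside the box by a translation
and a second translation or scaling, so an invariant function factors through the invariants,
smoothly because these have smooth sections.

For inequivalence, four properties are preserved by the transformations: being Abelian, having no
time components, having generic rank one, and having a derived algebra without time component. They
separate the seven algebras. -/

namespace EvolutionSymmetry
open Set Filter Topology

/-! ### Smoothness of superposition operators on spaces of continuous maps -/

section Nemytskii
universe u
variable {K : Type} [TopologicalSpace K] [CompactSpace K]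

/-- Evaluation of a continuous family of linear maps along a continuous map. -/
noncomputable def applyFamily (K : Type) [TopologicalSpace K] [CompactSpace K] (E F : Type u)
    [NormedAddCommGroup E] [NormedSpace ℝ E] [NormedAddCommGroup F] [NormedSpace ℝ F] :
    C(K, E →L[ℝ] F) →L[ℝ] C(K, E) →L[ℝ] C(K, F) :=
  LinearMap.mkContinuous₂
    (LinearMap.mk₂ ℝ (fun (A : C(K, E →L[ℝ] F)) (h : C(K, E)) => (⟨fun k => A k (h k), by fun_prop⟩ : C(K, F)))
      (by intros; ext; simp) (by intros; ext; simp) (by intros; ext; simp) (by intros; ext; simp))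
    1 (by
      intro A h
      rw [one_mul]
      refine (ContinuousMap.norm_le _ (by positivity)).2 fun k => ?_
      exact ((A k).le_opNorm (h k)).trans
        (mul_le_mul (A.norm_coe_le_norm k) (h.norm_coe_le_norm k) (norm_nonneg _) (by positivity)))

/-- The superposition operator `γ ↦ f ∘ γ`. -/
def superposition (K : Type) [TopologicalSpace K] {E F : Type*} [TopologicalSpace E]
    [TopologicalSpace F] (f : C(E, F)) (γ : C(K, E)) : C(K, F) := f.comp γ

/-- The mean value inequality bounds the remainder at each point of `K` by the oscillation of `f'`
on a small ball. Uniform continuity of `f'` makes the bound independent of the point, which is what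
the supremum norm requires. -/
lemma hasFDerivAt_superposition {E F : Type u}
    [NormedAddCommGroup E] [NormedSpace ℝ E] [NormedAddCommGroup F] [NormedSpace ℝ F]
    (f : C(E, F)) (f' : C(E, E →L[ℝ] F)) (hd : ∀ x, HasFDerivAt f (f' x) x)
    (hu : UniformContinuous f') (γ : C(K, E)) :
    HasFDerivAt (superposition K f) (applyFamily K E F (superposition K f' γ)) γ := by
  rw [hasFDerivAt_iff_isLittleO_nhds_zero, Asymptotics.isLittleO_iff]
  intro ε hε
  obtain ⟨δ, hδ, hδ'⟩ := Metric.uniformContinuous_iff.1 hu ε hε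
  filter_upwards [Metric.ball_mem_nhds (0 : C(K, E)) hδ] with h hh
  rw [mem_ball_zero_iff] at hh
  refine (ContinuousMap.norm_le _ (by positivity)).2 fun k => ?_
  have hk : ‖h k‖ < δ := (h.norm_coe_le_norm k).trans_lt hh
  have := (convex_ball (γ k) δ).norm_image_sub_le_of_norm_hasFDerivWithin_le'
    (f := f) (f' := f') (φ := f' (γ k)) (C := ε) (x := γ k) (y := γ k + h k)
    (fun x _ => (hd x).hasFDerivWithinAt)
    (fun x hx => by
      rw [← dist_eq_norm]; exact (hδ' hx).le)
    (Metric.mem_ball_self hδ) (by simpa using hk)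
  simp only [add_sub_cancel_left] at this
  refine le_trans ?_ (this.trans (mul_le_mul_of_nonneg_left (h.norm_coe_le_norm k) hε.le))
  exact le_of_eq rfl

/-- The derivative of a superposition operator is the superposition operator of `f'` followed by the
bounded linear map `applyFamily`. As `f'` is again smooth with compact support, the order of
smoothness can be raised by induction; the target space changes in each step and has to stay
general. -/
lemma contDiff_superposition_nat {E : Type u} [NormedAddCommGroup E] [NormedSpace ℝ E] (n : ℕ) :
    ∀ {F : Type u} [NormedAddCommGroup F] [NormedSpace ℝ F] (f : C(E, F)),
      ContDiff ℝ ∞ f → HasCompactSupport f → ContDiff ℝ n (superposition K f) := by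
  have key : ∀ {F : Type u} [NormedAddCommGroup F] [NormedSpace ℝ F] (f : C(E, F)),
      ContDiff ℝ ∞ f → HasCompactSupport f → ∃ f' : C(E, E →L[ℝ] F),
        ContDiff ℝ ∞ f' ∧ HasCompactSupport f' ∧ ∀ γ : C(K, E),
        HasFDerivAt (superposition K f) (applyFamily K E F (superposition K f' γ)) γ := by
    intro F _ _ f hf hc
    have h1 : ContDiff ℝ ∞ (fderiv ℝ f) := (contDiff_infty_iff_fderiv.1 hf).2
    have h2 : HasCompactSupport (fderiv ℝ f) := hc.fderiv (𝕜 := ℝ)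
    exact ⟨⟨fderiv ℝ f, h1.continuous⟩, h1, h2, hasFDerivAt_superposition f _
      (fun x => (hf.differentiable (by simp) x).hasFDerivAt)
      (h2.uniformContinuous_of_continuous h1.continuous)⟩
  induction n with
  | zero =>
    intro F _ _ f hf hc
    obtain ⟨f', -, -, h⟩ := key f hf hc
    exact contDiff_zero.2 (continuous_iff_continuousAt.2 fun γ => (h γ).continuousAt)
  | succ n ih =>
    intro F _ _ f hf hc
    obtain ⟨f', h1, h2, h⟩ := key f hf hc
    rw [Nat.cast_succ, contDiff_succ_iff_hasFDerivAt]
    have hA : ContDiff ℝ n (applyFamily K E F) :=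
      ContinuousLinearMap.contDiff (𝕜 := ℝ) (E := C(K, E →L[ℝ] F))
        (F := C(K, E) →L[ℝ] C(K, F)) (applyFamily K E F)
    exact ⟨fun γ => applyFamily K E F (superposition K f' γ), hA.comp (ih f' h1 h2), h⟩

lemma contDiff_superposition {E F : Type u} [NormedAddCommGroup E] [NormedSpace ℝ E]
    [NormedAddCommGroup F] [NormedSpace ℝ F] (f : C(E, F)) (hf : ContDiff ℝ ∞ f)
    (hc : HasCompactSupport f) : ContDiff ℝ ∞ (superposition K f) :=
  contDiff_infty.2 fun n => contDiff_superposition_nat n f hf hc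

end Nemytskii

/-! ### Smooth local flows by the implicit function theorem on paths -/

section Flow
open unitInterval
variable {E : Type} [NormedAddCommGroup E] [NormedSpace ℝ E]

/-- The primitive `r ↦ ∫₀ʳ γ` of a path. -/
noncomputable def pathPrimitive (E : Type) [NormedAddCommGroup E] [NormedSpace ℝ E]
    [CompleteSpace E] : C(I, E) →L[ℝ] C(I, E) :=
  LinearMap.mkContinuous
    { toFun := fun γ => ⟨fun r => ∫ ρ in (0 : ℝ)..r, IccExtend zero_le_one γ ρ, by
        have : Continuous (IccExtend (zero_le_one (α := ℝ)) γ) := γ.continuous.Icc_extend'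
        exact (intervalIntegral.continuous_primitive
          (fun a b => this.intervalIntegrable a b) 0).comp continuous_subtype_val⟩
      map_add' := fun γ δ => by
        ext r
        have h1 : Continuous (IccExtend (zero_le_one (α := ℝ)) γ) := γ.continuous.Icc_extend'
        have h2 : Continuous (IccExtend (zero_le_one (α := ℝ)) δ) := δ.continuous.Icc_extend'
        exact intervalIntegral.integral_add (h1.intervalIntegrable _ _) (h2.intervalIntegrable _ _)
      map_smul' := fun c γ => by
        ext r
        exact intervalIntegral.integral_smul c _ }
    1 (by
      intro γ
      rw [one_mul]
      refine (ContinuousMap.norm_le _ (norm_nonneg _)).2 fun r => ?_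
      have := intervalIntegral.norm_integral_le_of_norm_le_const (a := 0) (b := (r : ℝ))
        (f := IccExtend (zero_le_one (α := ℝ)) γ) (C := ‖γ‖) (fun x _ => γ.norm_coe_le_norm _)
      refine this.trans ?_
      have h : |(r : ℝ) - 0| ≤ 1 := by
        rw [sub_zero, abs_of_nonneg r.2.1]; exact r.2.2
      nlinarith [norm_nonneg γ])

lemma pathPrimitive_apply [CompleteSpace E] (γ : C(I, E)) (r : I) :
    pathPrimitive E γ r = ∫ ρ in (0 : ℝ)..r, IccExtend zero_le_one γ ρ := rfl

/-- Rescaling of the unit interval. -/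
def scaleI (r : I) : C(I, I) := ⟨fun q => r * q, by fun_prop⟩

/-- This shows that an initial piece of a trajectory, stretched to the unit interval, is the
rescaled trajectory for a shorter time. -/
lemma pathPrimitive_comp_scaleI [CompleteSpace E] (γ : C(I, E)) (r q : I) :
    pathPrimitive E γ (r * q) = (r : ℝ) • pathPrimitive E (γ.comp (scaleI r)) q := by
  simp only [pathPrimitive_apply]
  have : ∫ ρ in (0 : ℝ)..q, IccExtend zero_le_one (γ.comp (scaleI r)) ρ
      = ∫ ρ in (0 : ℝ)..q, IccExtend zero_le_one γ (r * ρ) := by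
    refine intervalIntegral.integral_congr fun ρ hρ => ?_
    rw [uIcc_of_le q.2.1] at hρ
    have h1 : ρ ∈ Icc (0 : ℝ) 1 := ⟨hρ.1, hρ.2.trans q.2.2⟩
    have h2 : (r : ℝ) * ρ ∈ Icc (0 : ℝ) 1 := unitInterval.mul_mem r.2 h1
    rw [IccExtend_of_mem _ _ h1, IccExtend_of_mem _ _ h2]
    rfl
  rw [this, intervalIntegral.smul_integral_comp_mul_left]
  simp

/-- A compactly supported smooth vector field has a smooth local flow. -/
lemma exists_smooth_flow_of_compactSupport [CompleteSpace E] (f : C(E, E)) (hf : ContDiff ℝ ∞ f)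
    (hc : HasCompactSupport f) (p₀ : E) :
    ∃ Θ : ℝ × E → E, ∃ ε > 0,
      ContDiffOn ℝ ∞ Θ (Metric.ball 0 ε ×ˢ Metric.ball p₀ ε) ∧ ∀ p ∈ Metric.ball p₀ ε, ∀ s ∈ Metric.ball (0 : ℝ) ε,
        Θ (s, p) = p + ∫ r in (0 : ℝ)..s, f (Θ (r, p)) := by
  let N := superposition I f
  have hN : ContDiff ℝ ∞ N := contDiff_superposition f hf hc
  let J := pathPrimitive E
  let c : E →L[ℝ] C(I, E) := ContinuousLinearMap.const ℝ I
  -- The trajectory from `p` during time `s`, reparametrised by the unit interval, is a zero of `Ψ`: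
  -- `γ = p + s ∫ f ∘ γ`. At `s = 0` the partial derivative in `γ` is the identity, so the implicit
  -- function theorem applies.
  let Ψ : (ℝ × E) × C(I, E) → C(I, E) := fun v => v.2 - c v.1.2 - v.1.1 • J (N v.2)
  have hΨ : ContDiff ℝ ∞ Ψ := by
    refine ContDiff.sub (ContDiff.sub contDiff_snd ?_) ?_
    · exact c.contDiff.comp (contDiff_snd.comp contDiff_fst)
    · exact (contDiff_fst.comp contDiff_fst).smul (J.contDiff.comp (hN.comp contDiff_snd))
  let u₀ : (ℝ × E) × C(I, E) := ((0, p₀), c p₀)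
  have hu₀ : Ψ u₀ = 0 := by simp [Ψ, u₀]
  have hΨ2 : ∀ h, fderiv ℝ Ψ u₀ (0, h) = h := by
    intro h
    have h1 : HasFDerivAt Ψ (fderiv ℝ Ψ u₀) u₀ := (hΨ.differentiable (by simp) u₀).hasFDerivAt
    have h2 : HasFDerivAt (fun γ : C(I, E) => (((0 : ℝ), p₀), γ))
      (ContinuousLinearMap.inr ℝ (ℝ × E) C(I, E)) (c p₀) := hasFDerivAt_prodMk_right _ _
    have h3 := HasFDerivAt.comp (c p₀) (f := fun γ : C(I, E) => (((0 : ℝ), p₀), γ)) h1 h2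
    have h4 : HasFDerivAt (Ψ ∘ fun γ : C(I, E) => (((0 : ℝ), p₀), γ))
        (ContinuousLinearMap.id ℝ C(I, E)) (c p₀) := by
      have : (Ψ ∘ fun γ : C(I, E) => (((0 : ℝ), p₀), γ)) = fun γ => γ - c p₀ := by
        ext γ : 1; simp [Ψ]
      rw [this]
      exact (hasFDerivAt_id _).sub_const _
    have := congrArg (fun L => L h) (h3.unique h4)
    simpa using this
  have if₂ : (fderiv ℝ Ψ u₀ ∘L ContinuousLinearMap.inr ℝ (ℝ × E) C(I, E)).IsInvertible := by
    refine ⟨ContinuousLinearEquiv.refl ℝ _, ?_⟩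
    ext h : 1
    simp [hΨ2]
  have cdf : ContDiffAt ℝ ∞ Ψ u₀ := hΨ.contDiffAt
  let g := cdf.implicitFunction (by simp) if₂
  have hg : ContDiffAt ℝ ∞ g (0, p₀) := cdf.contDiffAt_implicitFunction (by simp) if₂
  have hg0 : g (0, p₀) = c p₀ := cdf.implicitFunction_apply_self (by simp) if₂
  obtain ⟨ε₁, hε₁, H₁⟩ := Metric.eventually_nhds_iff.1
    (cdf.eventually_apply_eq_iff_implicitFunction (by simp) if₂)
  -- Smoothness of infinite order at one point need not extend to a neighbourhood. The implicit
  -- function theorem is therefore applied again at each nearby point, and the implicit function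
  -- found there agrees with `g` by uniqueness.
  have hsm : ∀ᶠ x in 𝓝 ((0 : ℝ), p₀), ContDiffAt ℝ ∞ g x := by
    have e1 : ∀ᶠ x in 𝓝 ((0 : ℝ), p₀), ContDiffAt ℝ 1 g x :=
      (hg.of_le (by exact_mod_cast le_top)).eventually (by simp)
    have e2 : ∀ᶠ x in 𝓝 ((0 : ℝ), p₀),
        (fderiv ℝ Ψ (x, g x) ∘L ContinuousLinearMap.inr ℝ (ℝ × E) C(I, E)).IsInvertible := by
      have hc1 : ContinuousAt (fun x => fderiv ℝ Ψ (x, g x) ∘L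
          ContinuousLinearMap.inr ℝ (ℝ × E) C(I, E)) ((0 : ℝ), p₀) := by
        have : ContinuousAt (fun x => fderiv ℝ Ψ (x, g x)) ((0 : ℝ), p₀) :=
          (hΨ.continuous_fderiv (by simp)).continuousAt.comp
            (continuousAt_id.prodMk hg.continuousAt)
        exact this.clm_comp continuousAt_const
      obtain ⟨M, hM⟩ := if₂
      refine hc1.eventually (p := fun L => L.IsInvertible) ?_
      have e : (fun x => fderiv ℝ Ψ (x, g x) ∘L
          ContinuousLinearMap.inr ℝ (ℝ × E) C(I, E)) ((0 : ℝ), p₀) = (M : _ →L[ℝ] _) := by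
        simp only [hM, hg0, u₀]
      rw [e]
      filter_upwards [ContinuousLinearEquiv.nhds M] with L hL using hL
    filter_upwards [e1, e2,
      (cdf.eventually_apply_implicitFunction (by simp) if₂).eventually_nhds] with x h1 h2 h3
    have cdf' : ContDiffAt ℝ ∞ Ψ (x, g x) := hΨ.contDiffAt
    refine (cdf'.contDiffAt_implicitFunction (by simp) h2).congr_of_eventuallyEq ?_
    have h4 := (continuousAt_id.prodMk h1.continuousAt).eventually
      (cdf'.eventually_apply_eq_iff_implicitFunction (by simp) h2)
    filter_upwards [h3, h4] with y h5 h6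
    exact (h6.1 (h5.trans h3.self_of_nhds.symm)).symm
  have hev : ∀ᶠ x in 𝓝 ((0 : ℝ), p₀),
      Ψ (x, g x) = Ψ u₀ ∧ dist (g x) (c p₀) < ε₁ ∧ ContDiffAt ℝ ∞ g x := by
    refine (cdf.eventually_apply_implicitFunction (by simp) if₂).and (.and ?_ hsm)
    have := hg.continuousAt.tendsto
    rw [hg0] at this
    exact this (Metric.ball_mem_nhds _ hε₁)
  obtain ⟨ε₂, hε₂, H₂⟩ := Metric.eventually_nhds_iff.1 hev
  have hev1 : ContDiff ℝ ∞ (fun γ : C(I, E) => γ 1) :=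
    (ContinuousMap.evalCLM ℝ (1 : I) : C(I, E) →L[ℝ] E).contDiff
  -- The flow at time `s` is the endpoint of the rescaled trajectory.
  refine ⟨fun x => g x 1, min ε₁ ε₂, lt_min hε₁ hε₂, fun x hx => ?_, fun p hp s hs => ?_⟩
  · refine (hev1.contDiffAt.comp x (H₂ ?_).2.2).contDiffWithinAt
    exact max_lt (lt_of_lt_of_le hx.1 (min_le_right _ _)) (lt_of_lt_of_le hx.2 (min_le_right _ _))
  have hp1 : dist p p₀ < ε₁ := lt_of_lt_of_le hp (min_le_left _ _)
  have hs1 : |s| < ε₁ := by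
    have := lt_of_lt_of_le hs (min_le_left ε₁ ε₂); rwa [Real.dist_0_eq_abs] at this
  have hsp : dist (s, p) ((0 : ℝ), p₀) < ε₂ :=
    max_lt (lt_of_lt_of_le hs (min_le_right _ _)) (lt_of_lt_of_le hp (min_le_right _ _))
  obtain ⟨h1, h2, -⟩ := H₂ hsp
  set γ := g (s, p) with hγ
  rw [hu₀] at h1
  have hγr : ∀ r : I, γ r = p + s • J (N γ) r := by
    intro r
    have := congrArg (fun δ : C(I, E) => δ r) h1
    simp only [Ψ, ContinuousMap.sub_apply, ContinuousMap.smul_apply, ContinuousMap.zero_apply]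
      at this
    have hc : c p r = p := rfl
    rw [hc, sub_sub, sub_eq_zero] at this
    exact this
  -- By local uniqueness, the trajectory for time `r s` is the rescaled initial piece of `γ`. Thus
  -- endpoints for shorter times are the intermediate values of `γ`, and the equation for `γ`
  -- becomes the integral equation of the flow.
  have hscale : ∀ r : I, g (r * s, p) 1 = γ r := by
    intro r
    have hd : dist (((r : ℝ) * s, p), γ.comp (scaleI r)) u₀ < ε₁ := by
      refine max_lt (max_lt ?_ hp1) ?_
      · rw [Real.dist_0_eq_abs, abs_mul, abs_of_nonneg r.2.1]
        exact lt_of_le_of_lt (mul_le_of_le_one_left (abs_nonneg _) r.2.2) hs1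
      · refine (ContinuousMap.dist_lt_iff hε₁).2 fun q => ?_
        exact lt_of_le_of_lt (ContinuousMap.dist_apply_le_dist (f := γ) (g := c p₀) (r * q)) h2
    have h3 := (H₁ hd).1 (by
      rw [hu₀]
      ext q
      simp only [Ψ, ContinuousMap.sub_apply, ContinuousMap.smul_apply, ContinuousMap.zero_apply]
      have hN' : N (γ.comp (scaleI r)) = (N γ).comp (scaleI r) := rfl
      have hc : c p q = p := rfl
      have hq : γ.comp (scaleI r) q = γ (r * q) := rfl
      rw [hc, hN', hq, hγr, pathPrimitive_comp_scaleI, mul_smul, smul_comm (r : ℝ) s]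
      simp [J])
    change g (r * s, p) = _ at h3
    rw [h3]
    change γ (r * 1) = γ r
    rw [mul_one]
  have hΘ : g (s, p) 1 = p + s • ∫ ρ in (0 : ℝ)..1, f (g (ρ * s, p) 1) := by
    rw [← hγ, hγr 1]
    congr 2
    rw [pathPrimitive_apply]
    refine intervalIntegral.integral_congr fun ρ hρ => ?_
    simp only [Icc.coe_one, uIcc_of_le (zero_le_one (α := ℝ))] at hρ
    have := hscale ⟨ρ, hρ⟩
    rw [IccExtend_of_mem _ _ hρ]
    simp only at this
    rw [this]
    rfl
  refine hΘ.trans ?_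
  rw [intervalIntegral.smul_integral_comp_mul_right (fun r => f (g (r, p) 1)) s]
  simp

end Flow

/-! ### Inverse functions and cut-offs -/

section LocalInverse
variable {E : Type} [NormedAddCommGroup E] [NormedSpace ℝ E] 

lemma _root_.ContDiffOn.fderiv_infty {F : Type*} [NormedAddCommGroup F] [NormedSpace ℝ F]
    {f : E → F} {U : Set E} (hf : ContDiffOn ℝ ∞ f U) (hU : IsOpen U) :
    ContDiffOn ℝ ∞ (fderiv ℝ f) U := hf.fderiv_of_isOpen hU (by simp)

lemma _root_.ContDiffOn.differentiableAt_of_isOpen {F : Type*} [NormedAddCommGroup F]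
    [NormedSpace ℝ F] {f : E → F} {U : Set E} (hf : ContDiffOn ℝ ∞ f U) (hU : IsOpen U) {x : E}
    (hx : x ∈ U) : DifferentiableAt ℝ f x :=
  (hf.contDiffAt (hU.mem_nhds hx)).differentiableAt (by simp)

lemma fderiv_inverse_apply {f g : E → E} {W : Set E} (hW : IsOpen W) (hf : ContDiffOn ℝ ∞ f W)
    (hfW : IsOpen (f '' W)) (hg : ContDiffOn ℝ ∞ g (f '' W)) (hgf : ∀ x ∈ W, g (f x) = x)
    {x : E} (hx : x ∈ W) (v : E) : fderiv ℝ g (f x) (fderiv ℝ f x v) = v := by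
  have h1 : HasFDerivAt (g ∘ f) ((fderiv ℝ g (f x)).comp (fderiv ℝ f x)) x :=
    (hg.differentiableAt_of_isOpen hfW (mem_image_of_mem f hx)).hasFDerivAt.comp x
      (hf.differentiableAt_of_isOpen hW hx).hasFDerivAt
  have h2 : HasFDerivAt (g ∘ f) (ContinuousLinearMap.id ℝ E) x :=
    (hasFDerivAt_id x).congr_of_eventuallyEq (by
      filter_upwards [hW.mem_nhds hx] with y hy using hgf y hy)
  exact congrArg (fun L => L v) (h1.unique h2)

variable [FiniteDimensional ℝ E]

/-- A smooth map with invertible derivatives on an open set where it is injective has a smooth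
inverse on its image, which is open. -/
lemma exists_smooth_inverse {f : E → E} {W : Set E} (hW : IsOpen W) (hf : ContDiffOn ℝ ∞ f W)
    (hinj : InjOn f W) (hdet : ∀ x ∈ W, (fderiv ℝ f x).det ≠ 0) :
    IsOpen (f '' W) ∧ ∃ g : E → E, ContDiffOn ℝ ∞ g (f '' W) ∧ ∀ x ∈ W, g (f x) = x := by
  have hc : CompleteSpace E := FiniteDimensional.complete ℝ E
  have key : ∀ x ∈ W, ∃ g : E → E, ContDiffAt ℝ ∞ g (f x) ∧ g (f x) = x ∧
      ∀ᶠ y in 𝓝 (f x), f (g y) = y := by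
    intro x hx
    have hx' := hf.contDiffAt (hW.mem_nhds hx)
    have hd : HasFDerivAt f
        ((fderiv ℝ f x).toContinuousLinearEquivOfDetNeZero (hdet x hx) : E →L[ℝ] E) x := by
      rw [ContinuousLinearMap.coe_toContinuousLinearEquivOfDetNeZero]
      exact (hx'.differentiableAt (by simp)).hasFDerivAt
    refine ⟨hx'.localInverse hd (by simp), hx'.to_localInverse hd (by simp),
      hx'.localInverse_apply_image hd (by simp), ?_⟩
    exact (hx'.hasStrictFDerivAt' hd (by simp)).eventually_right_inverse
  refine ⟨?_, ?_⟩
  · rw [isOpen_iff_mem_nhds]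
    rintro _ ⟨x, hx, rfl⟩
    obtain ⟨g, hg, hgx, hr⟩ := key x hx
    have : ∀ᶠ y in 𝓝 (f x), g y ∈ W :=
      hg.continuousAt.eventually (by rw [hgx]; exact hW.mem_nhds hx)
    filter_upwards [hr, this] with y h1 h2 using ⟨g y, h2, h1⟩
  · classical
    refine ⟨fun y => if h : ∃ x ∈ W, f x = y then h.choose else y, ?_, ?_⟩
    · rintro _ ⟨x, hx, rfl⟩
      obtain ⟨g, hg, hgx, hr⟩ := key x hx
      have : ∀ᶠ y in 𝓝 (f x), g y ∈ W :=
        hg.continuousAt.eventually (by rw [hgx]; exact hW.mem_nhds hx)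
      refine (hg.congr_of_eventuallyEq ?_).contDiffWithinAt
      filter_upwards [hr, this] with y h1 h2
      have h : ∃ x ∈ W, f x = y := ⟨g y, h2, h1⟩
      rw [dif_pos h]
      exact hinj h.choose_spec.1 h2 (h.choose_spec.2.trans h1.symm)
    · intro x hx
      have h : ∃ x' ∈ W, f x' = f x := ⟨x, hx, rfl⟩
      simp only [dif_pos h]
      exact hinj h.choose_spec.1 hx h.choose_spec.2

/-- Inverse function theorem: restriction to a neighbourhood. -/
lemma exists_injOn_nhd {f : E → E} {U : Set E} (hU : IsOpen U) (hf : ContDiffOn ℝ ∞ f U) {p : E}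
    (hp : p ∈ U) (hdet : (fderiv ℝ f p).det ≠ 0) :
    ∃ W ⊆ U, IsOpen W ∧ p ∈ W ∧ InjOn f W ∧ ∀ x ∈ W, (fderiv ℝ f x).det ≠ 0 := by
  have hc : CompleteSpace E := FiniteDimensional.complete ℝ E
  have hx' := hf.contDiffAt (hU.mem_nhds hp)
  have hd : HasFDerivAt f
      ((fderiv ℝ f p).toContinuousLinearEquivOfDetNeZero hdet : E →L[ℝ] E) p := by
    rw [ContinuousLinearMap.coe_toContinuousLinearEquivOfDetNeZero]
    exact (hx'.differentiableAt (by simp)).hasFDerivAt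
  let e := hx'.toOpenPartialHomeomorph f hd (by simp)
  have h1 : ∀ᶠ x in 𝓝 p, (fderiv ℝ f x).det ≠ 0 := by
    have hcont : ContinuousAt (fun x => (fderiv ℝ f x).det) p :=
      ContinuousLinearMap.continuous_det.continuousAt.comp
        (((hf.fderiv_infty hU).continuousOn).continuousAt (hU.mem_nhds hp))
    exact hcont.eventually_ne hdet
  obtain ⟨O, hO, hOo, hpO⟩ := mem_nhds_iff.1 h1
  refine ⟨U ∩ (e.source ∩ O), inter_subset_left, hU.inter (e.open_source.inter hOo),
    ⟨hp, hx'.mem_toOpenPartialHomeomorph_source hd (by simp), hpO⟩, ?_, fun x hx => hO hx.2.2⟩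
  exact e.injOn.mono fun x hx => hx.2.1

/-- Cut-off of a smooth map. -/
lemma exists_cutoff {F : Type*} [NormedAddCommGroup F] [NormedSpace ℝ F] {f : E → F} {U : Set E}
    (hU : IsOpen U) (hf : ContDiffOn ℝ ∞ f U) {p : E} (hp : p ∈ U) :
    ∃ χ : E → ℝ, (∀ᶠ x in 𝓝 p, χ x = 1) ∧ (∀ x ∉ U, χ x = 0) ∧
      ContDiff ℝ ∞ (fun x => χ x • f x) ∧ HasCompactSupport (fun x => χ x • f x) := by
  obtain ⟨r, hr, hrU⟩ := Metric.nhds_basis_closedBall.mem_iff.1 (hU.mem_nhds hp)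
  let b : ContDiffBump p := ⟨r / 2, r, by positivity, by linarith⟩
  have hb : tsupport b ⊆ U := by rw [b.tsupport_eq]; exact hrU
  refine ⟨b, ?_, fun x hx => image_eq_zero_of_notMem_tsupport fun h => hx (hb h), ?_,
    b.hasCompactSupport.smul_right⟩
  · filter_upwards [Metric.closedBall_mem_nhds p (show (0 : ℝ) < r / 2 by positivity)] with x hx
    exact b.one_of_mem_closedBall hx
  · rw [contDiff_iff_contDiffAt]
    intro x
    by_cases hx : x ∈ tsupport b
    · exact b.contDiff.contDiffAt.smul (hf.contDiffAt (hU.mem_nhds (hb hx)))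
    · have : (fun x => b x • f x) =ᶠ[𝓝 x] fun _ => 0 := by
        filter_upwards [(isClosed_tsupport b).isOpen_compl.mem_nhds hx] with y hy
        rw [image_eq_zero_of_notMem_tsupport hy, zero_smul]
      exact contDiffAt_const.congr_of_eventuallyEq this
end LocalInverse

lemma det_ne_zero_of_forall {E : Type} [NormedAddCommGroup E] [NormedSpace ℝ E]
    [FiniteDimensional ℝ E] {A : E →L[ℝ] E} (h : ∀ v, A v = 0 → v = 0) : A.det ≠ 0 := by
  have h1 : Function.Injective (A : E →ₗ[ℝ] E) := (injective_iff_map_eq_zero _).2 h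
  have h2 := LinearEquiv.isUnit_det' (LinearEquiv.ofInjectiveEndo (A : E →ₗ[ℝ] E) h1)
  exact h2.ne_zero

lemma eq_zero_of_det_ne_zero {E : Type} [NormedAddCommGroup E] [NormedSpace ℝ E]
    [FiniteDimensional ℝ E] {A : E →L[ℝ] E} (hA : A.det ≠ 0) {v : E} (hv : A v = 0) : v = 0 := by
  have h := (A.toContinuousLinearEquivOfDetNeZero hA).map_eq_zero_iff (x := v)
  exact h.1 (by simpa using hv)

/-! ### Flow boxes and primitives along a coordinate -/

section FlowBox
variable {n : ℕ}

/-- The derivative of a map along a line. -/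
lemma fderiv_apply_eq_of_hasDerivAt {E F : Type*} [NormedAddCommGroup E] [NormedSpace ℝ E]
    [NormedAddCommGroup F] [NormedSpace ℝ F] {f : E → F} {x v : E} {w : F}
    (hf : DifferentiableAt ℝ f x) (h : HasDerivAt (fun s : ℝ => f (x + s • v)) w 0) :
    fderiv ℝ f x v = w := by
  have h1 : HasDerivAt (fun s : ℝ => x + s • v) v 0 := by
    simpa using ((hasDerivAt_id (0 : ℝ)).smul_const v).const_add x
  have h2 : HasFDerivAt f (fderiv ℝ f x) (x + (0 : ℝ) • v) := by simpa using hf.hasFDerivAt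
  exact (h2.comp_hasDerivAt (0 : ℝ) h1).unique h

/-- The flow box theorem: a smooth vector field whose `k`-th component does not vanish at `p` is
straightened to the `k`-th coordinate field near `p`; coordinates that the field does not move are
kept. -/
lemma exists_flowBox {V : (Fin n → ℝ) → (Fin n → ℝ)} {U : Set (Fin n → ℝ)} (hU : IsOpen U)
    (hV : ContDiffOn ℝ ∞ V U) {p : Fin n → ℝ} (hp : p ∈ U) {k : Fin n} (hk : V p k ≠ 0) :
    ∃ W ⊆ U, IsOpen W ∧ p ∈ W ∧ ∃ φ : (Fin n → ℝ) → (Fin n → ℝ), ContDiffOn ℝ ∞ φ W ∧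
      InjOn φ W ∧ (∀ b ∈ W, (fderiv ℝ φ b).det ≠ 0) ∧
      (∀ b ∈ W, fderiv ℝ φ b (V b) = Pi.single k 1) ∧
      ∀ i ≠ k, (∀ b ∈ U, V b i = 0) → ∀ b ∈ W, φ b i = b i := by
  obtain ⟨χ, hχ1, hχ0, hsm, hcs⟩ := exists_cutoff hU hV hp
  let f : C(Fin n → ℝ, Fin n → ℝ) := ⟨fun x => χ x • V x, hsm.continuous⟩
  obtain ⟨Θ, ε, hε, hΘ, hint⟩ := exists_smooth_flow_of_compactSupport f hsm hcs p
  set D : Set (ℝ × (Fin n → ℝ)) := Metric.ball 0 ε ×ˢ Metric.ball p ε with hD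
  have hDo : IsOpen D := Metric.isOpen_ball.prod Metric.isOpen_ball
  -- A point is split into a flow time, its `k`-th coordinate relative to `p`, and a starting point
  -- on the hyperplane through `p` transversal to the field. Flowing gives `ψ`, and the
  -- straightening map is its inverse.
  let L : (Fin n → ℝ) → ℝ × (Fin n → ℝ) := fun a => (a k - p k, a - (a k - p k) • Pi.single k 1)
  have hL : ContDiff ℝ ∞ L := by fun_prop
  let ψ : (Fin n → ℝ) → (Fin n → ℝ) := fun a => Θ (L a)
  let O := L ⁻¹' D
  have hO : IsOpen O := hDo.preimage hL.continuous
  have hLp : L p = (0, p) := by simp [L]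
  have hpO : p ∈ O := by
    change L p ∈ D
    rw [hLp]; exact ⟨Metric.mem_ball_self hε, Metric.mem_ball_self hε⟩
  have hψ : ContDiffOn ℝ ∞ ψ O := hΘ.comp hL.contDiffOn fun a ha => ha
  have hΘ0 : ∀ q ∈ Metric.ball p ε, Θ (0, q) = q := fun q hq => by
    rw [hint q hq 0 (Metric.mem_ball_self hε)]; simp
  have hψp : ψ p = p := by
    change Θ (L p) = p
    rw [hLp, hΘ0 p (Metric.mem_ball_self hε)]
  have hflow : ∀ q ∈ Metric.ball p ε, ∀ s ∈ Metric.ball (0 : ℝ) ε,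
      HasDerivAt (fun s => Θ (s, q)) (f (Θ (s, q))) s := by
    intro q hq s hs
    have hcont : ContinuousOn (fun r => f (Θ (r, q))) (Metric.ball (0 : ℝ) ε) :=
      f.continuous.comp_continuousOn (hΘ.continuousOn.comp (by fun_prop) fun r hr => ⟨hr, hq⟩)
    have hsub : uIcc 0 s ⊆ Metric.ball (0 : ℝ) ε := by
      exact (convex_ball (0 : ℝ) ε).ordConnected.uIcc_subset (Metric.mem_ball_self hε) hs
    have h1 : HasDerivAt (fun u => q + ∫ r in (0 : ℝ)..u, f (Θ (r, q))) (f (Θ (s, q))) s := by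
      refine (intervalIntegral.integral_hasDerivAt_right
        ((hcont.mono hsub).intervalIntegrable) ?_ ?_).const_add q
      · exact hcont.stronglyMeasurableAtFilter Metric.isOpen_ball s hs
      · exact hcont.continuousAt (Metric.isOpen_ball.mem_nhds hs)
    refine h1.congr_of_eventuallyEq ?_
    filter_upwards [Metric.isOpen_ball.mem_nhds hs] with u hu using hint q hq u hu
  have hdir : ∀ a ∈ O, fderiv ℝ ψ a (Pi.single k 1) = f (ψ a) := by
    intro a ha
    refine fderiv_apply_eq_of_hasDerivAt (hψ.differentiableAt_of_isOpen hO ha) ?_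
    have h1 := hflow (L a).2 ha.2 (L a).1 ha.1
    have h2 : HasDerivAt (fun s : ℝ => (L a).1 + s) 1 0 := by
      simpa using (hasDerivAt_id (0 : ℝ)).const_add (L a).1
    have h3 := HasDerivAt.scomp (h := fun s : ℝ => (L a).1 + s) (0 : ℝ) (by simpa using h1) h2
    rw [one_smul] at h3
    refine h3.congr_of_eventuallyEq (Eventually.of_forall fun s => ?_)
    change Θ (L (a + s • Pi.single k 1)) = Θ ((L a).1 + s, (L a).2)
    congr 1
    ext i
    · simp [L]; ring
    · simp [L]; ring
  have htr : ∀ v : Fin n → ℝ, v k = 0 → fderiv ℝ ψ p v = v := by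
    intro v hv
    refine fderiv_apply_eq_of_hasDerivAt (hψ.differentiableAt_of_isOpen hO hpO) ?_
    have h1 : HasDerivAt (fun s : ℝ => p + s • v) v 0 := by
      simpa using ((hasDerivAt_id (0 : ℝ)).smul_const v).const_add p
    refine h1.congr_of_eventuallyEq ?_
    have : ∀ᶠ s : ℝ in 𝓝 0, p + s • v ∈ Metric.ball p ε := by
      refine h1.continuousAt.eventually (p := fun x => x ∈ Metric.ball p ε) ?_
      simp only [zero_smul, add_zero]
      exact Metric.ball_mem_nhds p hε
    filter_upwards [this] with s hs
    have : L (p + s • v) = (0, p + s • v) := by simp [L, hv]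
    change Θ (L (p + s • v)) = _
    rw [this, hΘ0 _ hs]
  have hfp : f p = V p := by
    change χ p • V p = V p
    rw [hχ1.self_of_nhds, one_smul]
  -- At `p` the derivative of `ψ` is the identity on the hyperplane and sends the `k`-th unit vector
  -- to `V p`, which is transversal because `V p k ≠ 0`.
  have hdet : (fderiv ℝ ψ p).det ≠ 0 := by
    refine det_ne_zero_of_forall fun v hv => ?_
    have h1 : v = (v - v k • Pi.single k 1) + v k • Pi.single k 1 := by simp
    have h2 : fderiv ℝ ψ p v = (v - v k • Pi.single k 1) + v k • V p := by
      conv_lhs => rw [h1]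
      rw [map_add, map_smul, hdir p hpO, hψp, hfp, htr _ (by simp)]
    rw [hv] at h2
    have h3 : v k = 0 := by
      have := congrFun h2 k
      simpa [hk] using this
    rw [h3] at h2
    simpa using h2.symm
  have hev : ∀ᶠ a in 𝓝 p, ψ a ∈ U ∧ χ (ψ a) = 1 := by
    refine (hψ.continuousOn.continuousAt (hO.mem_nhds hpO)).eventually
      (p := fun x => x ∈ U ∧ χ x = 1) ?_
    rw [hψp]
    exact (hU.eventually_mem hp).and hχ1
  obtain ⟨O₁, hO₁, hO₁o, hpO₁⟩ := mem_nhds_iff.1 hev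
  obtain ⟨O₂, hO₂, hO₂o, hpO₂, hinj, hdet₂⟩ := exists_injOn_nhd (hO.inter hO₁o)
    (hψ.mono inter_subset_left) ⟨hpO, hpO₁⟩ hdet
  have hψ₂ := hψ.mono (hO₂.trans inter_subset_left)
  obtain ⟨himg, φ, hφ, hφψ⟩ := exists_smooth_inverse hO₂o hψ₂ hinj hdet₂
  refine ⟨ψ '' O₂, ?_, himg, ⟨p, hpO₂, hψp⟩, φ, hφ, ?_, ?_, ?_, ?_⟩
  · rintro _ ⟨a, ha, rfl⟩; exact (hO₁ (hO₂ ha).2).1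
  · rintro _ ⟨a, ha, rfl⟩ _ ⟨b, hb, rfl⟩ h
    rw [hφψ a ha, hφψ b hb] at h; rw [h]
  · rintro _ ⟨a, ha, rfl⟩
    refine det_ne_zero_of_forall fun v hv => ?_
    obtain ⟨w, hw⟩ := ((fderiv ℝ ψ a).toContinuousLinearEquivOfDetNeZero (hdet₂ a ha)).surjective v
    have hw' : fderiv ℝ ψ a w = v := by simpa using hw
    have := fderiv_inverse_apply hO₂o hψ₂ himg hφ hφψ ha w
    rw [hw', hv] at this
    rw [← hw', ← this, map_zero]
  · rintro _ ⟨a, ha, rfl⟩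
    have h1 := fderiv_inverse_apply hO₂o hψ₂ himg hφ hφψ ha (Pi.single k 1)
    rw [hdir a (hO₂ ha).1] at h1
    have h2 : f (ψ a) = V (ψ a) := by
      change χ (ψ a) • V (ψ a) = V (ψ a)
      rw [(hO₁ (hO₂ ha).2).2, one_smul]
    rwa [h2] at h1
  · rintro i hik hVi _ ⟨a, ha, rfl⟩
    rw [hφψ a ha]
    have haO : L a ∈ D := (hO₂ ha).1
    have h1 : ψ a = (L a).2 + ∫ r in (0 : ℝ)..(L a).1, f (Θ (r, (L a).2)) :=
      hint (L a).2 haO.2 (L a).1 haO.1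
    -- A component that vanishes on `U` still vanishes everywhere after the cut-off, so the integral
    -- equation keeps the corresponding coordinate fixed.
    have hfi : ∀ x, f x i = 0 := by
      intro x
      change χ x * V x i = 0
      by_cases hx : x ∈ U
      · rw [hVi x hx, mul_zero]
      · rw [hχ0 x hx, zero_mul]
    have hcont : ContinuousOn (fun r => f (Θ (r, (L a).2))) (uIcc 0 (L a).1) := by
      refine f.continuous.comp_continuousOn (hΘ.continuousOn.comp (by fun_prop) fun r hr => ?_)
      refine ⟨?_, haO.2⟩
      exact (convex_ball (0 : ℝ) ε).ordConnected.uIcc_subset (Metric.mem_ball_self hε) haO.1 hr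
    have hint' : IntervalIntegrable (fun r => f (Θ (r, (L a).2))) MeasureTheory.volume 0 (L a).1 :=
      hcont.intervalIntegrable
    have h2 := (ContinuousLinearMap.proj (R := ℝ) (φ := fun _ : Fin n => ℝ)
      i).intervalIntegral_comp_comm hint'
    have h3 : (∫ r in (0 : ℝ)..(L a).1, f (Θ (r, (L a).2))) i = 0 := by
      refine Eq.trans h2.symm ?_
      simp [hfi]
    rw [h1, Pi.add_apply, h3]
    simp [L, hik]
/-- A function that does not depend infinitesimally on a direction is constant along segments in
that direction. -/
lemma apply_add_smul_eq {E F : Type*} [NormedAddCommGroup E] [NormedSpace ℝ E]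
    [NormedAddCommGroup F] [NormedSpace ℝ F] {f : E → F} {B : Set E} (hB : Convex ℝ B)
    {v : E} (hd : ∀ x ∈ B, DifferentiableAt ℝ f x) (h : ∀ x ∈ B, fderiv ℝ f x v = 0)
    {x : E} {s : ℝ} (hx : x ∈ B) (hxs : x + s • v ∈ B) : f (x + s • v) = f x := by
  have hmem : ∀ r ∈ Icc (0 : ℝ) 1, x + (r * s) • v ∈ B := by
    intro r hr
    have := hB hx hxs (sub_nonneg.2 hr.2) hr.1 (by ring)
    convert this using 1
    module
  have hder : ∀ r ∈ Icc (0 : ℝ) 1, HasDerivAt (fun r : ℝ => f (x + (r * s) • v)) 0 r := by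
    intro r hr
    have h1 : HasDerivAt (fun r : ℝ => x + (r * s) • v) (s • v) r := by
      simpa using (((hasDerivAt_id r).mul_const s).smul_const v).const_add x
    have h2 := (hd _ (hmem r hr)).hasFDerivAt.comp_hasDerivAt r h1
    rwa [map_smul, h _ (hmem r hr), smul_zero] at h2
  have := constant_of_has_deriv_right_zero (f := fun r : ℝ => f (x + (r * s) • v)) (a := 0) (b := 1)
    (fun r hr => (hder r hr).continuousAt.continuousWithinAt)
    (fun r hr => (hder r ⟨hr.1, hr.2.le⟩).hasDerivWithinAt) 1 (by simp)
  simpa using this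

/-- Primitives in the direction of a coordinate. -/
lemma exists_partial_primitive {q : (Fin n → ℝ) → ℝ} {U : Set (Fin n → ℝ)} (hU : IsOpen U)
    (hq : ContDiffOn ℝ ∞ q U) {p : Fin n → ℝ} (hp : p ∈ U) (k : Fin n) :
    ∃ W ⊆ U, IsOpen W ∧ p ∈ W ∧ ∃ Q : (Fin n → ℝ) → ℝ, ContDiff ℝ ∞ Q ∧
      (∀ b ∈ W, fderiv ℝ Q b (Pi.single k 1) = q b) ∧
      ∀ i ≠ k, (∀ b ∈ U, fderiv ℝ q b (Pi.single i 1) = 0) →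
        ∀ b ∈ W, fderiv ℝ Q b (Pi.single i 1) = 0 := by
  obtain ⟨χ, hχ1, hχ0, hsm, hcs⟩ := exists_cutoff hU hq hp
  let f : C(Fin n → ℝ, ℝ) := ⟨fun x => χ x • q x, hsm.continuous⟩
  -- After multiplication by `b k - p k` and translation by `b`, this path runs from the hyperplane
  -- `x_k = p k` to `b`. The primitive is then an integral over a fixed interval of a superposition
  -- operator, hence smooth in `b`.
  let κ : C(unitInterval, Fin n → ℝ) :=
    ⟨fun r => ((r : ℝ) - 1) • Pi.single k 1, by fun_prop⟩
  let c : (Fin n → ℝ) →L[ℝ] C(unitInterval, Fin n → ℝ) := ContinuousLinearMap.const ℝ _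
  let path : (Fin n → ℝ) → C(unitInterval, Fin n → ℝ) := fun b => c b + (b k - p k) • κ
  have hpath : ContDiff ℝ ∞ path :=
    c.contDiff.add (ContDiff.smul (𝕜 := ℝ) (f := fun b : Fin n → ℝ => b k - p k) (by fun_prop)
      contDiff_const)
  let e : C(unitInterval, ℝ) →L[ℝ] ℝ := ContinuousMap.evalCLM ℝ (1 : unitInterval)
  let Q : (Fin n → ℝ) → ℝ := fun b =>
    (b k - p k) * e (pathPrimitive ℝ (superposition unitInterval f (path b)))
  have hQ : ContDiff ℝ ∞ Q := by
    refine ContDiff.mul (by fun_prop) ?_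
    exact e.contDiff.comp ((pathPrimitive ℝ).contDiff.comp
      ((contDiff_superposition f hsm hcs).comp hpath))
  have hQ1 : ∀ b, Q b = (b k - p k) *
      ∫ r in (0 : ℝ)..1, f (b + ((r - 1) * (b k - p k)) • Pi.single k 1) := by
    intro b
    simp only [Q]
    congr 1
    refine intervalIntegral.integral_congr fun r hr => ?_
    simp only [Icc.coe_one, uIcc_of_le (zero_le_one (α := ℝ))] at hr
    rw [IccExtend_of_mem _ _ hr]
    change f (b + (b k - p k) • ((r - 1) • Pi.single k 1)) = _
    rw [smul_smul, mul_comm]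
  have hQ2 : ∀ b, Q b =
      ∫ r in (0 : ℝ)..(b k - p k), f (b - (b k - p k) • Pi.single k 1 + r • Pi.single k 1) := by
    intro b
    have := intervalIntegral.mul_integral_comp_mul_right (a := 0) (b := 1) (c := b k - p k)
      (f := fun r => f (b - (b k - p k) • Pi.single k 1 + r • Pi.single k 1))
    rw [zero_mul, one_mul] at this
    rw [hQ1, ← this]
    congr 1
    refine intervalIntegral.integral_congr fun r _ => ?_
    congr 1
    module
  obtain ⟨O, hO, hOo, hpO⟩ := mem_nhds_iff.1 (hχ1.and (hU.mem_nhds hp))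
  obtain ⟨ε, hε, hεO⟩ := Metric.isOpen_iff.1 hOo p hpO
  refine ⟨Metric.ball p ε, fun x hx => (hO (hεO hx)).2, Metric.isOpen_ball,
    Metric.mem_ball_self hε, Q, hQ, ?_, ?_⟩
  · intro b hb
    refine fderiv_apply_eq_of_hasDerivAt (hQ.differentiable (by simp) b) ?_
    have hcont : Continuous fun r : ℝ =>
      f (b - (b k - p k) • Pi.single k 1 + r • Pi.single k 1) := f.continuous.comp (by fun_prop)
    have h1 := (hcont.integral_hasStrictDerivAt 0 (b k - p k)).hasDerivAt
    have h2 : HasDerivAt (fun s : ℝ => (b k - p k) + s) 1 0 := by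
      simpa using (hasDerivAt_id (0 : ℝ)).const_add (b k - p k)
    have h3 := HasDerivAt.comp (h := fun s : ℝ => (b k - p k) + s) (0 : ℝ)
      (by simpa using h1) h2
    have hfb : f b = q b := by
      change χ b • q b = q b
      rw [(hO (hεO hb)).1, one_smul]
    simp only [mul_one, hfb] at h3
    refine h3.congr_of_eventuallyEq (Eventually.of_forall fun s => ?_)
    refine (hQ2 _).trans ?_
    have e1 : (b + s • (Pi.single k 1 : Fin n → ℝ)) k - p k = b k - p k + s := by
      simp; ring
    rw [e1]
    refine intervalIntegral.integral_congr fun r _ => ?_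
    congr 1
    module
  · intro i hik hi b hb
    refine fderiv_apply_eq_of_hasDerivAt (hQ.differentiable (by simp) b) ?_
    have hline : ContinuousAt (fun s : ℝ => b + s • (Pi.single i 1 : Fin n → ℝ)) 0 := by fun_prop
    have hev : ∀ᶠ s : ℝ in 𝓝 0, b + s • (Pi.single i 1 : Fin n → ℝ) ∈ Metric.ball p ε := by
      refine hline.eventually (p := fun x => x ∈ Metric.ball p ε) ?_
      simp only [zero_smul, add_zero]
      exact Metric.isOpen_ball.mem_nhds hb
    refine (hasDerivAt_const (0 : ℝ) (Q b)).congr_of_eventuallyEq ?_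
    -- The ball is taken in the supremum norm, so moving one coordinate towards that of the centre
    -- does not leave it.
    have hmem : ∀ x ∈ Metric.ball p ε, ∀ r ∈ Icc (0 : ℝ) 1,
        x + ((r - 1) * (x k - p k)) • (Pi.single k 1 : Fin n → ℝ) ∈ Metric.ball p ε := by
      intro x hx r hr
      rw [mem_ball_iff_norm] at hx ⊢
      rw [pi_norm_lt_iff hε] at hx ⊢
      intro j
      by_cases hj : j = k
      · subst hj
        have := hx j
        simp only [Pi.sub_apply, Pi.add_apply, Pi.smul_apply, Pi.single_eq_same, smul_eq_mul,
          mul_one, Real.norm_eq_abs] at this ⊢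
        have e1 : x j + (r - 1) * (x j - p j) - p j = r * (x j - p j) := by ring
        rw [e1, abs_mul, abs_of_nonneg hr.1]
        exact (mul_le_of_le_one_left (abs_nonneg _) hr.2).trans_lt this
      · have := hx j
        simpa [hj] using this
    have hfq : ∀ x ∈ Metric.ball p ε, f x = q x := by
      intro x hx
      change χ x • q x = q x
      rw [(hO (hεO hx)).1, one_smul]
    filter_upwards [hev] with s hs
    rw [hQ1, hQ1]
    have e1 : (b + s • (Pi.single i 1 : Fin n → ℝ)) k = b k := by simp [Ne.symm hik]
    rw [e1]
    congr 1
    refine intervalIntegral.integral_congr fun r hr => ?_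
    rw [uIcc_of_le (zero_le_one (α := ℝ))] at hr
    have m1 := hmem _ hs r hr
    have m2 := hmem _ hb r hr
    rw [e1] at m1
    rw [hfq _ m1, hfq _ m2]
    rw [add_right_comm] at m1 ⊢
    exact apply_add_smul_eq (convex_ball p ε)
      (fun x hx => hq.differentiableAt_of_isOpen hU (hO (hεO hx)).2)
      (fun x hx => hi x (hO (hεO hx)).2) m2 m1

end FlowBox

/-! ### Prolongation and invariance criterion for affine fields -/

section AffineFields

/-- The vector field `(p t + p₀) ∂_t + (q x + q₀) ∂_x + (r u + s x + r₀) ∂_u`. -/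
def affineField (p p₀ q q₀ r s r₀ : ℝ) : Base → Base :=
  fun b => ![p * b 0 + p₀, q * b 1 + q₀, r * b 2 + s * b 1 + r₀]

/-- The third prolongation of `affineField`. -/
def affineProlongation (p p₀ q q₀ r s r₀ : ℝ) : Jet3 → Jet3 := fun z =>
  ![p * z 0 + p₀, q * z 1 + q₀, r * z 2 + s * z 1 + r₀, (r - q) * z 3 + s,
    (r - 2 * q) * z 4, (r - 3 * q) * z 5]

lemma fderiv_linear_add_const {n : ℕ} (k l : Fin n) (a c d : ℝ) (j v : Fin n → ℝ) :
    fderiv ℝ (fun i : Fin n → ℝ => a * i k + c * i l + d) j v = a * v k + c * v l := by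
  let A : (Fin n → ℝ) →L[ℝ] ℝ := a • ContinuousLinearMap.proj k + c • ContinuousLinearMap.proj l
  have : (fun i : Fin n → ℝ => a * i k + c * i l + d) = fun i => A i + d := by
    ext i; simp [A]
  rw [this, fderiv_add_const, ContinuousLinearMap.fderiv]
  simp [A]

lemma fderiv_smul_coord {n : ℕ} (k : Fin n) (a d : ℝ) (j v : Fin n → ℝ) :
    fderiv ℝ (fun i : Fin n → ℝ => a * i k + d) j v = a * v k := by
  simpa using fderiv_linear_add_const k k a 0 d j v

variable (p p₀ q q₀ r s r₀ : ℝ)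

/-- Here `D_x τ = 0` and `D_x ξ = q` is constant, so every further differentiation merely lowers the
weight of the next derivative by `q`. -/
lemma etas_affineField (j : Jet) :
    etaT (affineField p p₀ q q₀ r s r₀) j = (r - p) * j 7 ∧
    prolong3 (affineField p p₀ q q₀ r s r₀) j = affineProlongation p p₀ q q₀ r s r₀ (jet3 j) ∧
    eta4 (affineField p p₀ q q₀ r s r₀) j = (r - 4 * q) * j 6 := by
  have h0 : ∀ j, Dx (fun i => affineField p p₀ q q₀ r s r₀ (base i) 0) j = 0 := fun j => by
    exact (fderiv_smul_coord 0 p p₀ j _).trans (by simp)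
  have h1 : ∀ j, Dx (fun i => affineField p p₀ q q₀ r s r₀ (base i) 1) j = q := fun j => by
    exact (fderiv_smul_coord 1 q q₀ j _).trans (by simp)
  have h2 : ∀ j, Dx (fun i => affineField p p₀ q q₀ r s r₀ (base i) 2) j = r * j 3 + s := fun j => by
    exact (fderiv_linear_add_const 2 1 r s r₀ j _).trans (by simp)
  have e1 : eta1 (affineField p p₀ q q₀ r s r₀) = fun j => (r - q) * j 3 + s := by
    ext j; rw [eta1, h0, h1, h2]; ring
  have e2 : eta2 (affineField p p₀ q q₀ r s r₀) = fun j => (r - 2 * q) * j 4 + 0 := by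
    ext j; rw [eta2, h0, h1, e1, Dx, fderiv_smul_coord]; simp; ring
  have e3 : eta3 (affineField p p₀ q q₀ r s r₀) = fun j => (r - 3 * q) * j 5 + 0 := by
    ext j; rw [eta3, h0, h1, e2, Dx, fderiv_smul_coord]; simp; ring
  have e4 : eta4 (affineField p p₀ q q₀ r s r₀) = fun j => (r - 4 * q) * j 6 + 0 := by
    ext j; rw [eta4, h0, h1, e3, Dx, fderiv_smul_coord]; simp; ring
  refine ⟨?_, ?_, by rw [e4]; exact add_zero _⟩
  · have t0 : Dt (fun b => affineField p p₀ q q₀ r s r₀ b 0) j = p := 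
      (fderiv_smul_coord 0 p p₀ (base j) _).trans (by simp)
    have t1 : Dt (fun b => affineField p p₀ q q₀ r s r₀ b 1) j = 0 := 
      (fderiv_smul_coord 1 q q₀ (base j) _).trans (by simp)
    have t2 : Dt (fun b => affineField p p₀ q q₀ r s r₀ b 2) j = r * j 7 := 
      (fderiv_linear_add_const 2 1 r s r₀ (base j) _).trans (by simp)
    rw [etaT, t0, t1, t2]; ring
  · rw [prolong3, e1, e2, e3]
    simp [affineField, affineProlongation, base, jet3]

/-- The invariance criterion for an affine field. -/
lemma isSymmetry_affineField_iff {F G : Jet3 → ℝ} {Ω : Set Jet3} :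
    IsSymmetry F G Ω (affineField p p₀ q q₀ r s r₀) ↔ ∀ z ∈ Ω,
      fderiv ℝ F z (affineProlongation p p₀ q q₀ r s r₀ z) = (4 * q - p) * F z ∧
      fderiv ℝ G z (affineProlongation p p₀ q q₀ r s r₀ z) = (r - p) * G z := by
  constructor
  · intro h z hz
    -- On the equation `u_xxxx` remains free while `u_t` is determined by it. The criterion is
    -- affine in this free value, and the values 0 and 1 separate its two coefficients.
    have key : ∀ y : ℝ, (r - p) * (F z * y + G z)
        - fderiv ℝ F z (affineProlongation p p₀ q q₀ r s r₀ z) * y - F z * ((r - 4 * q) * y)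
        - fderiv ℝ G z (affineProlongation p p₀ q q₀ r s r₀ z) = 0 := by
      intro y
      let j : Jet := ![z 0, z 1, z 2, z 3, z 4, z 5, y, F z * y + G z, 0, 0, 0]
      have hj : jet3 j = z := by ext i; fin_cases i <;> rfl
      have := h j (by rwa [hj]) (by rw [hj]; rfl)
      obtain ⟨a, b, c⟩ := etas_affineField p p₀ q q₀ r s r₀ j
      rw [a, b, c, hj] at this
      exact this
    have k0 := key 0
    have k1 := key 1
    constructor <;> linarith
  · intro h j hj hE
    obtain ⟨a, b, c⟩ := etas_affineField p p₀ q q₀ r s r₀ j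
    obtain ⟨h1, h2⟩ := h _ hj
    rw [a, b, c, h1, h2, hE]
    ring

/-- This lets a single computation of prolongations and of brackets serve all fourteen generators.
-/
lemma canonical_eq_affineField :
    canonical (.inl 0) 0 = affineField 0 1 0 0 0 0 0 ∧
    canonical (.inl 0) 1 = affineField 0 0 0 1 0 0 0 ∧
    canonical (.inl 1) 0 = affineField 0 0 0 1 0 0 0 ∧
    canonical (.inl 1) 1 = affineField 0 0 0 0 0 0 1 ∧
    canonical (.inl 2) 0 = affineField 0 0 0 0 0 0 1 ∧
    canonical (.inl 2) 1 = affineField 0 0 0 0 0 1 0 ∧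
    canonical (.inr 0) 0 = affineField (-1) 0 (-1) 0 0 0 0 ∧
    canonical (.inr 0) 1 = affineField 0 1 0 0 0 0 0 ∧
    canonical (.inr 1) 0 = affineField (-1) 0 (-1) 0 0 0 0 ∧
    canonical (.inr 1) 1 = affineField 0 0 0 1 0 0 0 ∧
    canonical (.inr 2) 0 = affineField 0 0 (-1) 0 (-1) 0 0 ∧
    canonical (.inr 2) 1 = affineField 0 0 0 1 0 0 0 ∧
    canonical (.inr 3) 0 = affineField 0 0 (-1) 0 0 0 0 ∧
    canonical (.inr 3) 1 = affineField 0 0 0 1 0 0 0 := by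
  refine ⟨?_, ?_, ?_, ?_, ?_, ?_, ?_, ?_, ?_, ?_, ?_, ?_, ?_, ?_⟩ <;>
    (ext b i; fin_cases i <;> simp [canonical, affineField])

end AffineFields

/-! ### Homogeneous functions on boxes and smooth factorization -/

section Boxes

lemma IsOpenBox.isOpen {B : Set Jet3} (hB : IsOpenBox B) : IsOpen B := by
  obtain ⟨I, hI, rfl⟩ := hB
  exact isOpen_set_pi finite_univ fun k _ => (hI k).1

lemma IsOpenBox.convex {B : Set Jet3} (hB : IsOpenBox B) : Convex ℝ B := by
  obtain ⟨I, hI, rfl⟩ := hB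
  exact convex_pi fun k _ => (hI k).2.convex

/-- Coordinates of two points of a box may be mixed. -/
lemma IsOpenBox.mem_of_forall {B : Set Jet3} (hB : IsOpenBox B) {z z' y : Jet3} (hz : z ∈ B)
    (hz' : z' ∈ B) (h : ∀ k, y k ∈ uIcc (z k) (z' k)) : y ∈ B := by
  obtain ⟨I, hI, rfl⟩ := hB
  exact fun k _ => (hI k).2.uIcc_subset (hz k trivial) (hz' k trivial) (h k)

lemma isOpenBox_ball (z : Jet3) {ε : ℝ} (hε : 0 < ε) : IsOpenBox (Metric.ball z ε) := by
  refine ⟨fun k => Metric.ball (z k) ε, fun k => ⟨Metric.isOpen_ball,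
    (convex_ball _ _).ordConnected⟩, ?_⟩
  ext y
  simp [dist_pi_lt_iff hε]

lemma IsOpenBox.exists_subset {O : Set Jet3} (hO : IsOpen O) {z : Jet3} (hz : z ∈ O) :
    ∃ B ⊆ O, IsOpenBox B ∧ z ∈ B := by
  obtain ⟨ε, hε, h⟩ := Metric.isOpen_iff.1 hO z hz
  exact ⟨_, h, isOpenBox_ball z hε, Metric.mem_ball_self hε⟩

/-- A function on a box that is homogeneous for the infinitesimal scaling with weights `w`. -/
lemma IsOpenBox.apply_scaling {B : Set Jet3} (hB : IsOpenBox B) {H : Jet3 → ℝ}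
    (hH : ∀ z ∈ B, DifferentiableAt ℝ H z) {w : Fin 6 → ℝ} {κ : ℝ}
    (h : ∀ z ∈ B, fderiv ℝ H z (fun k => w k * z k) = κ * H z) {z z' : Jet3} (hz : z ∈ B)
    (hz' : z' ∈ B) {σ : ℝ} (hs : ∀ k, z' k = Real.exp (w k * σ) * z k) :
    H z' = Real.exp (κ * σ) * H z := by
  -- The orbit of the scaling from `z` to `z'` is monotone in every coordinate, so each coordinate
  -- stays between its two end values and the orbit stays in the box.
  let γ : ℝ → Jet3 := fun θ k => Real.exp (w k * σ * θ) * z k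
  have hmem : ∀ θ ∈ Icc (0 : ℝ) 1, γ θ ∈ B := by
    intro θ hθ
    refine hB.mem_of_forall hz hz' fun k => ?_
    have h1 : Real.exp (w k * σ * θ) ∈ uIcc 1 (Real.exp (w k * σ)) := by
      rcases le_total 0 (w k * σ) with hw | hw
      · rw [uIcc_of_le (Real.one_le_exp hw)]
        exact ⟨Real.one_le_exp (mul_nonneg hw hθ.1),
          Real.exp_le_exp.2 (mul_le_of_le_one_right hw hθ.2)⟩
      · rw [uIcc_of_ge (Real.exp_le_one_iff.2 hw)]
        exact ⟨Real.exp_le_exp.2 (by nlinarith [hθ.2]),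
          Real.exp_le_one_iff.2 (mul_nonpos_of_nonpos_of_nonneg hw hθ.1)⟩
    rw [hs k]
    have h2 : Real.exp (w k * σ * θ) * z k ∈ (fun x => x * z k) '' uIcc 1 (Real.exp (w k * σ)) :=
      ⟨_, h1, rfl⟩
    rwa [image_mul_const_uIcc, one_mul] at h2
  have hder : ∀ θ ∈ Icc (0 : ℝ) 1,
      HasDerivAt (fun θ => Real.exp (-(κ * σ) * θ) * H (γ θ)) 0 θ := by
    intro θ hθ
    have h1 : HasDerivAt γ (σ • fun k => w k * γ θ k) θ := by
      refine hasDerivAt_pi.2 fun k => ?_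
      have := (((hasDerivAt_id θ).const_mul (w k * σ)).exp).mul_const (z k)
      exact this.congr_deriv (by simp [γ]; ring)
    have h2 := (hH _ (hmem θ hθ)).hasFDerivAt.comp_hasDerivAt θ h1
    rw [map_smul, h _ (hmem θ hθ)] at h2
    have h3 := ((hasDerivAt_id θ).const_mul (-(κ * σ))).exp.mul h2
    exact h3.congr_deriv (by simp; ring)
  have := constant_of_has_deriv_right_zero (a := 0) (b := 1)
    (fun θ hθ => (hder θ hθ).continuousAt.continuousWithinAt)
    (fun θ hθ => (hder θ ⟨hθ.1, hθ.2.le⟩).hasDerivWithinAt) 1 (by simp)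
  have e0 : γ 0 = z := by ext k; simp [γ]
  have e1 : γ 1 = z' := by ext k; simp [γ, hs]
  simp only [e0, e1, mul_one, mul_zero, Real.exp_zero, one_mul] at this
  rw [← this, ← mul_assoc, ← Real.exp_add]
  simp

/-- A function on a box that does not depend infinitesimally on the coordinate `k`. -/
lemma IsOpenBox.apply_translation {B : Set Jet3} (hB : IsOpenBox B) {H : Jet3 → ℝ}
    (hH : ∀ z ∈ B, DifferentiableAt ℝ H z) {k : Fin 6}
    (h : ∀ z ∈ B, fderiv ℝ H z (Pi.single k 1) = 0) {z z' : Jet3} (hz : z ∈ B)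
    (hz' : z' ∈ B) (hk : ∀ i ≠ k, z' i = z i) : H z' = H z := by
  have : z' = z + (z' k - z k) • Pi.single k 1 := by
    ext i
    by_cases hi : i = k
    · subst hi; simp
    · simp [hi, hk i hi]
  rw [this] at hz' ⊢
  exact apply_add_smul_eq hB.convex hH h hz hz'

/-- A function whose quotient by `c` is constant on the fibres of `ι` factors smoothly. -/
lemma exists_smooth_factor {B : Set Jet3} (hB : IsOpen B) {H c : Jet3 → ℝ}
    {ι : Jet3 → Fin 4 → ℝ} (hH : ContDiffOn ℝ ∞ H B) (hc : ContDiffOn ℝ ∞ c B)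
    (hc0 : ∀ z ∈ B, c z ≠ 0)
    (hfib : ∀ z ∈ B, ∀ z' ∈ B, ι z' = ι z → H z' / c z' = H z / c z)
    (hsec : ∀ z ∈ B, ∃ σ : (Fin 4 → ℝ) → Jet3, ContDiffAt ℝ ∞ σ (ι z) ∧ σ (ι z) = z ∧
      ∀ y, ι (σ y) = y) :
    ∃ f : (Fin 4 → ℝ) → ℝ, ContDiffOn ℝ ∞ f (ι '' B) ∧ ∀ z ∈ B, H z = c z * f (ι z) := by
  classical
  let f : (Fin 4 → ℝ) → ℝ := fun y =>
    if h : ∃ z ∈ B, ι z = y then H h.choose / c h.choose else 0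
  have hf : ∀ z ∈ B, f (ι z) = H z / c z := by
    intro z hz
    have h : ∃ z' ∈ B, ι z' = ι z := ⟨z, hz, rfl⟩
    simp only [f, dif_pos h]
    exact hfib z hz _ h.choose_spec.1 h.choose_spec.2
  refine ⟨f, ?_, fun z hz => ?_⟩
  · rintro _ ⟨z, hz, rfl⟩
    obtain ⟨σ, hσ, hσz, hισ⟩ := hsec z hz
    have h1 : ∀ᶠ y in 𝓝 (ι z), σ y ∈ B := hσ.continuousAt.eventually (by
      rw [hσz]; exact hB.mem_nhds hz)
    have h2 : ContDiffAt ℝ ∞ (fun x => H x / c x) (σ (ι z)) := by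
      rw [hσz]
      exact (hH.contDiffAt (hB.mem_nhds hz)).div (hc.contDiffAt (hB.mem_nhds hz)) (hc0 z hz)
    -- Near `ι z` the chosen values of `f` coincide with the quotient `H / c` composed with the
    -- smooth section, since the quotient is constant on fibres.
    refine ((h2.comp _ hσ).congr_of_eventuallyEq ?_).contDiffWithinAt
    filter_upwards [h1] with y hy
    have := hf _ hy
    rwa [hισ] at this
  · rw [hf z hz, mul_div_cancel₀ _ (hc0 z hz)]

end Boxes

/-! ### Equations invariant under the canonical algebras -/

section Rows

/-- The third prolongations of the canonical fields. -/
def canonicalProlongation : Fin 3 ⊕ Fin 4 → Fin 2 → Jet3 → Jet3 :=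
  Sum.elim
    ![![fun _ => Pi.single 0 1, fun _ => Pi.single 1 1],
      ![fun _ => Pi.single 1 1, fun _ => Pi.single 2 1],
      ![fun _ => Pi.single 2 1, fun z => ![0, 0, z 1, 1, 0, 0]]]
    ![![fun z => ![-z 0, -z 1, 0, z 3, 2 * z 4, 3 * z 5], fun _ => Pi.single 0 1],
      ![fun z => ![-z 0, -z 1, 0, z 3, 2 * z 4, 3 * z 5], fun _ => Pi.single 1 1],
      ![fun z => ![0, -z 1, -z 2, 0, z 4, 2 * z 5], fun _ => Pi.single 1 1],
      ![fun z => ![0, -z 1, 0, z 3, 2 * z 4, 3 * z 5], fun _ => Pi.single 1 1]]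

/-- `H` is invariant under the second canonical field, and homogeneous of degree `κ` under the
first one. -/
def IsHomogeneousOn (i : Fin 3 ⊕ Fin 4) (κ : ℝ) (H : Jet3 → ℝ) (Ω : Set Jet3) : Prop :=
  ∀ z ∈ Ω, fderiv ℝ H z (canonicalProlongation i 0 z) = κ * H z ∧
    fderiv ℝ H z (canonicalProlongation i 1 z) = 0

/-- These are the numbers `4 * q - p` of `isSymmetry_affineField_iff` for the first generator of
each row, and `degreeG` lists its numbers `r - p`. For the second generator both vanish in every
row. -/
def degreeF : Fin 3 ⊕ Fin 4 → ℝ := Sum.elim (fun _ => 0) ![-3, -3, -4, -4]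

def degreeG : Fin 3 ⊕ Fin 4 → ℝ := Sum.elim (fun _ => 0) ![1, 1, -1, 0]

lemma isSymmetry_canonical_iff (i : Fin 3 ⊕ Fin 4) {F G : Jet3 → ℝ} {Ω : Set Jet3} :
    (∀ k, IsSymmetry F G Ω (canonical i k)) ↔
      IsHomogeneousOn i (degreeF i) F Ω ∧ IsHomogeneousOn i (degreeG i) G Ω := by
  obtain ⟨a0, a1, b0, b1, c0, c1, d0, d1, e0, e1, f0, f1, g0, g1⟩ := canonical_eq_affineField
  rw [Fin.forall_fin_two]
  have row : ∀ {p p₀ q q₀ r s r₀ p' p₀' q' q₀' r' s' r₀' : ℝ},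
      canonical i 0 = affineField p p₀ q q₀ r s r₀ →
      canonical i 1 = affineField p' p₀' q' q₀' r' s' r₀' →
      (∀ z, affineProlongation p p₀ q q₀ r s r₀ z = canonicalProlongation i 0 z) →
      (∀ z, affineProlongation p' p₀' q' q₀' r' s' r₀' z = canonicalProlongation i 1 z) →
      4 * q - p = degreeF i → r - p = degreeG i → 4 * q' - p' = 0 → r' - p' = 0 →
      (IsSymmetry F G Ω (canonical i 0) ∧ IsSymmetry F G Ω (canonical i 1) ↔
        IsHomogeneousOn i (degreeF i) F Ω ∧ IsHomogeneousOn i (degreeG i) G Ω) := by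
    intro p p₀ q q₀ r s r₀ p' p₀' q' q₀' r' s' r₀' h0 h1 h2 h3 h4 h5 h6 h7
    rw [h0, h1, isSymmetry_affineField_iff, isSymmetry_affineField_iff]
    simp only [h2, h3, h4, h5, h6, h7, zero_mul, IsHomogeneousOn]
    grind
  rcases i with i | i <;> fin_cases i
  · refine row a0 a1 (fun z => ?_) (fun z => ?_) ?_ ?_ ?_ ?_
    all_goals first
      | (ext j; fin_cases j <;> simp [affineProlongation, canonicalProlongation])
      | (simp [degreeF, degreeG])
  · refine row b0 b1 (fun z => ?_) (fun z => ?_) ?_ ?_ ?_ ?_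
    all_goals first
      | (ext j; fin_cases j <;> simp [affineProlongation, canonicalProlongation])
      | (simp [degreeF, degreeG])
  · refine row c0 c1 (fun z => ?_) (fun z => ?_) ?_ ?_ ?_ ?_
    all_goals first
      | (ext j; fin_cases j <;> simp [affineProlongation, canonicalProlongation])
      | (simp [degreeF, degreeG])
  · refine row d0 d1 (fun z => ?_) (fun z => ?_) ?_ ?_ ?_ ?_
    all_goals first
      | (ext j; fin_cases j <;> simp [affineProlongation, canonicalProlongation])
      | (simp [degreeF, degreeG] <;> norm_num)
  · refine row e0 e1 (fun z => ?_) (fun z => ?_) ?_ ?_ ?_ ?_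
    all_goals first
      | (ext j; fin_cases j <;> simp [affineProlongation, canonicalProlongation])
      | (simp [degreeF, degreeG] <;> norm_num)
  · refine row f0 f1 (fun z => ?_) (fun z => ?_) ?_ ?_ ?_ ?_
    all_goals first
      | (ext j; fin_cases j <;> simp [affineProlongation, canonicalProlongation] <;> norm_num)
      | (simp [degreeF, degreeG])
  · refine row g0 g1 (fun z => ?_) (fun z => ?_) ?_ ?_ ?_ ?_
    all_goals first
      | (ext j; fin_cases j <;> simp [affineProlongation, canonicalProlongation])
      | (simp [degreeF, degreeG])

lemma isOpen_regular (i : Fin 3 ⊕ Fin 4) : IsOpen (regular i) := by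
  have : ∀ k : Fin 6, IsOpen {z : Jet3 | z k ≠ 0} := fun k =>
    isOpen_ne_fun (continuous_apply k) continuous_const
  rcases i with i | i
  · exact isOpen_univ
  · fin_cases i
    exacts [this 1, this 0, this 2, this 3]

lemma dense_ne_zero {n : ℕ} (k : Fin n) : Dense {z : Fin n → ℝ | z k ≠ 0} :=
  (dense_compl_singleton (0 : ℝ)).preimage (isOpenMap_eval k)

lemma dense_regular (i : Fin 3 ⊕ Fin 4) : Dense (regular i) := by
  rcases i with i | i
  · exact dense_univ
  · fin_cases i
    exacts [dense_ne_zero 1, dense_ne_zero 0, dense_ne_zero 2, dense_ne_zero 3]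

/-- A coefficient of degree `κ`. -/
def IsCoefficient (i : Fin 3 ⊕ Fin 4) (κ : ℝ) (c : Jet3 → ℝ) : Prop :=
  ContDiffOn ℝ ∞ c (regular i) ∧ (∀ z ∈ regular i, c z ≠ 0) ∧ IsHomogeneousOn i κ c (regular i)

lemma contDiffOn_zpow_coord (k : Fin 6) (m : ℤ) :
    ContDiffOn ℝ ∞ (fun z : Jet3 => z k ^ m) {z | z k ≠ 0} := by
  intro z hz
  have : ContDiffAt ℝ ∞ (fun x : ℝ => x ^ m) (z k) := by
    cases m with
    | ofNat m => simpa using contDiffAt_id.pow m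
    | negSucc m =>
      simp only [zpow_negSucc]
      exact (contDiffAt_id.pow (m + 1)).inv (pow_ne_zero _ hz)
  exact (this.comp z (by fun_prop : ContDiffAt ℝ ∞ (fun z : Jet3 => z k) z)).contDiffWithinAt

/-- In the non-Abelian rows each coefficient is an integer power of the coordinate whose
nonvanishing defines regular points. This coordinate is an eigenfunction of the first prolonged
field, with eigenvalue `a`, and does not move under the second one. -/
lemma isCoefficient_zpow (i : Fin 4) (k : Fin 6) (m : ℤ) (a : ℝ) {κ : ℝ} {c : Jet3 → ℝ}
    (hκ : κ = m * a) (hc : ∀ z, c z = z k ^ m) (hreg : regular (.inr i) = {z | z k ≠ 0})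
    (h0 : ∀ z, canonicalProlongation (.inr i) 0 z k = a * z k)
    (h1 : ∀ z, canonicalProlongation (.inr i) 1 z k = 0) :
    IsCoefficient (.inr i) κ c := by
  obtain rfl : c = fun z => z k ^ m := funext hc
  rw [IsCoefficient, hreg]
  refine ⟨contDiffOn_zpow_coord k m, fun z hz => zpow_ne_zero _ hz, fun z hz => ?_⟩
  have hd : HasFDerivAt (fun z : Jet3 => z k ^ m)
      ((m * z k ^ (m - 1)) • ContinuousLinearMap.proj (R := ℝ) (φ := fun _ : Fin 6 => ℝ) k) z :=
    HasDerivAt.comp_hasFDerivAt (f := fun z : Jet3 => z k) z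
      (hasDerivAt_zpow m (z k) (Or.inl hz)) (hasFDerivAt_apply k z)
  rw [hd.fderiv]
  constructor
  · simp only [smul_apply, ContinuousLinearMap.proj_apply, h0, smul_eq_mul]
    rw [zpow_sub_one₀ hz, hκ]
    have : z k ≠ 0 := hz
    field_simp
  · simp [h1]

lemma isCoefficient_coeffF (i : Fin 3 ⊕ Fin 4) : IsCoefficient i (degreeF i) (coeffF i) := by
  rcases i with i | i
  · exact ⟨contDiffOn_const, fun _ _ => one_ne_zero, fun z _ => by
      simp [degreeF, coeffF]⟩
  · fin_cases i
    · refine isCoefficient_zpow 0 1 (3) (-1) ?_ (fun z => ?_) rfl (fun z => ?_) (fun z => ?_) <;>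
        simp [degreeF, coeffF, canonicalProlongation]
    · refine isCoefficient_zpow 1 0 (3) (-1) ?_ (fun z => ?_) rfl (fun z => ?_) (fun z => ?_) <;>
        simp [degreeF, coeffF, canonicalProlongation]
    · refine isCoefficient_zpow 2 2 (4) (-1) ?_ (fun z => ?_) rfl (fun z => ?_) (fun z => ?_) <;>
        simp [degreeF, coeffF, canonicalProlongation]
    · refine isCoefficient_zpow 3 3 (-4) (1) ?_ (fun z => ?_) rfl (fun z => ?_) (fun z => ?_) <;>
        simp [degreeF, coeffF, canonicalProlongation]

lemma isCoefficient_coeffG (i : Fin 3 ⊕ Fin 4) : IsCoefficient i (degreeG i) (coeffG i) := by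
  rcases i with i | i
  · exact ⟨contDiffOn_const, fun _ _ => one_ne_zero, fun z _ => by
      simp [degreeG, coeffG]⟩
  · fin_cases i
    · refine isCoefficient_zpow 0 1 (-1) (-1) ?_ (fun z => ?_) rfl (fun z => ?_) (fun z => ?_) <;>
        simp [degreeG, coeffG, canonicalProlongation]
    · refine isCoefficient_zpow 1 0 (-1) (-1) ?_ (fun z => ?_) rfl (fun z => ?_) (fun z => ?_) <;>
        simp [degreeG, coeffG, canonicalProlongation]
    · refine isCoefficient_zpow 2 2 (1) (-1) ?_ (fun z => ?_) rfl (fun z => ?_) (fun z => ?_) <;>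
        simp [degreeG, coeffG, canonicalProlongation]
    · refine isCoefficient_zpow 3 3 (0) (1) ?_ (fun z => ?_) rfl (fun z => ?_) (fun z => ?_) <;>
        simp [degreeG, coeffG, canonicalProlongation]

lemma differentiableAt_div {H c : Jet3 → ℝ} {z : Jet3} (hH : DifferentiableAt ℝ H z)
    (hc : DifferentiableAt ℝ c z) (h0 : c z ≠ 0) : DifferentiableAt ℝ (fun z => H z / c z) z := by
  simp only [div_eq_mul_inv]
  exact hH.fun_mul (hc.fun_inv h0)

lemma fderiv_div_apply {H c : Jet3 → ℝ} {z : Jet3} (hH : DifferentiableAt ℝ H z)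
    (hc : DifferentiableAt ℝ c z) (h0 : c z ≠ 0) (v : Jet3) :
    fderiv ℝ (fun z => H z / c z) z v =
      (fderiv ℝ H z v * c z - H z * fderiv ℝ c z v) / c z ^ 2 := by
  have h1 : HasDerivAt (fun s : ℝ => H (z + s • v)) (fderiv ℝ H z v) 0 :=
    hH.hasFDerivAt.hasLineDerivAt v
  have h2 : HasDerivAt (fun s : ℝ => c (z + s • v)) (fderiv ℝ c z v) 0 :=
    hc.hasFDerivAt.hasLineDerivAt v
  refine fderiv_apply_eq_of_hasDerivAt (differentiableAt_div hH hc h0) ?_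
  exact (h1.fun_div h2 (by simpa using h0)).congr_deriv (by simp)

lemma IsHomogeneousOn.div {i : Fin 3 ⊕ Fin 4} {κ : ℝ} {H c : Jet3 → ℝ} {B : Set Jet3}
    (hB : B ⊆ regular i) (hH : ∀ z ∈ B, DifferentiableAt ℝ H z) (hh : IsHomogeneousOn i κ H B)
    (hc : IsCoefficient i κ c) : IsHomogeneousOn i 0 (fun z => H z / c z) B := by
  intro z hz
  have h1 := hc.1.differentiableAt_of_isOpen (isOpen_regular i) (hB hz)
  have h2 := hc.2.1 z (hB hz)
  obtain ⟨a, b⟩ := hh z hz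
  obtain ⟨a', b'⟩ := hc.2.2 z (hB hz)
  rw [fderiv_div_apply (hH z hz) h1 h2, fderiv_div_apply (hH z hz) h1 h2, a, b, a', b']
  constructor
  · field_simp; ring
  · simp

/-- If the signs differed, replacing the `k`-th coordinate of `z` by 0 would give a point of the
box. Positivity allows the quotient to be written as `exp σ`, with `σ` the parameter of a scaling.
-/
lemma IsOpenBox.div_pos {B : Set Jet3} (hB : IsOpenBox B) {k : Fin 6} (hk : ∀ z ∈ B, z k ≠ 0)
    {z z' : Jet3} (hz : z ∈ B) (hz' : z' ∈ B) : 0 < z' k / z k := by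
  by_contra h
  have h1 := hk z hz
  have hmem : (0 : ℝ) ∈ uIcc (z k) (z' k) := by
    rw [mem_uIcc]
    by_contra h2
    apply h
    rcases lt_or_gt_of_ne h1 with h3 | h3
    · exact div_pos_of_neg_of_neg (by grind) h3
    · exact _root_.div_pos (by grind) h3
  refine hk (Function.update z k 0) (hB.mem_of_forall hz hz' fun j => ?_) (by simp)
  by_cases hj : j = k
  · subst hj; simpa using hmem
  · simp [hj]

/-- Functions that are invariant under the canonical fields are constant on the fibres of the
invariants in a box. -/
lemma IsHomogeneousOn.eq_of_invariants_eq {i : Fin 3 ⊕ Fin 4} {K : Jet3 → ℝ} {B : Set Jet3}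
    (hB : IsOpenBox B) (hreg : B ⊆ regular i) (hd : ∀ z ∈ B, DifferentiableAt ℝ K z)
    (hK : IsHomogeneousOn i 0 K B) {z z' : Jet3} (hz : z ∈ B) (hz' : z' ∈ B)
    (h : invariants i z' = invariants i z) : K z' = K z := by
  have mix : ∀ k : Fin 6, Function.update z' k (z k) ∈ B := by
    intro k
    refine hB.mem_of_forall hz hz' fun j => ?_
    by_cases hj : j = k
    · subst hj; simp
    · simp [hj]
  have move : ∀ k : Fin 6, (∀ y ∈ B, fderiv ℝ K y (Pi.single k 1) = 0) →
      K z' = K (Function.update z' k (z k)) := fun k hk =>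
    hB.apply_translation hd hk (mix k) hz' fun j hj => by simp [hj]
  -- In the non-Abelian rows two points of a fibre are joined by moving the translated coordinate
  -- `k`, then scaling by the logarithm of the quotient of the `m`-th coordinates.
  have scale : ∀ (k m : Fin 6) (w : Fin 6 → ℝ), (∀ y ∈ B, y m ≠ 0) →
      (∀ y ∈ B, fderiv ℝ K y (Pi.single k 1) = 0) →
      (∀ y ∈ B, fderiv ℝ K y (fun j => w j * y j) = 0) →
      (∀ σ : ℝ, z' m / z m = Real.exp σ →
        ∀ j, Function.update z' k (z k) j = Real.exp (w j * σ) * z j) → K z' = K z := by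
    intro k m w hm hk hw hσ
    have hpos := hB.div_pos hm hz hz'
    rw [move k hk, hB.apply_scaling (κ := 0) hd (fun y hy => by rw [hw y hy, zero_mul]) hz (mix k)
      (hσ (Real.log (z' m / z m)) (Real.exp_log hpos).symm)]
    simp
  have comb : ∀ {y v v' w : Jet3} (a b : ℝ), fderiv ℝ K y v = 0 * K y → fderiv ℝ K y v' = 0 →
      w = a • v + b • v' → fderiv ℝ K y w = 0 := by
    intro y v v' w a b h1 h2 h3
    rw [h3, map_add, map_smul, map_smul, h1, h2]; simp
  have unscale : ∀ {a b x x' σ : ℝ} (n : ℕ), x' = Real.exp σ * x → x ≠ 0 →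
      x' ^ n * b = x ^ n * a → b = Real.exp (-(n : ℝ) * σ) * a := by
    intro a b x x' σ n hx hx0 hab
    rw [hx] at hab
    rw [neg_mul, Real.exp_neg, Real.exp_nat_mul]
    have := Real.exp_pos σ
    field_simp
    refine mul_left_cancel₀ (pow_ne_zero n hx0) (Eq.trans ?_ hab)
    ring
  rcases i with i | i <;> fin_cases i
  · have e0 := move 0 fun y hy => by simpa [canonicalProlongation] using (hK y hy).1
    rw [e0]
    refine hB.apply_translation hd (k := 1)
      (fun y hy => by simpa [canonicalProlongation] using (hK y hy).2) hz (mix 0) fun j hj => ?_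
    have h2 : z' 2 = z 2 := congrFun h 0
    have h3 : z' 3 = z 3 := congrFun h 1
    have h4 : z' 4 = z 4 := congrFun h 2
    have h5 : z' 5 = z 5 := congrFun h 3
    clear hd hK h mix move scale comb e0
    fin_cases j <;> simp [h2, h3, h4, h5] at hj ⊢
  · have e0 := move 1 fun y hy => by simpa [canonicalProlongation] using (hK y hy).1
    rw [e0]
    refine hB.apply_translation hd (k := 2)
      (fun y hy => by simpa [canonicalProlongation] using (hK y hy).2) hz (mix 1) fun j hj => ?_
    have h0 : z' 0 = z 0 := congrFun h 0
    have h3 : z' 3 = z 3 := congrFun h 1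
    have h4 : z' 4 = z 4 := congrFun h 2
    have h5 : z' 5 = z 5 := congrFun h 3
    clear hd hK h mix move scale comb e0
    fin_cases j <;> simp [h0, h3, h4, h5] at hj ⊢
  · have e0 := move 2 fun y hy => by simpa [canonicalProlongation] using (hK y hy).1
    rw [e0]
    -- Subtracting `x ∂_u` from the prolongation `x ∂_u + ∂_{u_x}` of the second generator leaves
    -- the translation in `u_x`.
    refine hB.apply_translation hd (k := 3) (fun y hy => comb (-y 1) 1 (hK y hy).1 (hK y hy).2 ?_)
      hz (mix 2) fun j hj => ?_
    · ext j; fin_cases j <;> simp [canonicalProlongation]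
    have h0 : z' 0 = z 0 := congrFun h 0
    have h1 : z' 1 = z 1 := congrFun h 1
    have h4 : z' 4 = z 4 := congrFun h 2
    have h5 : z' 5 = z 5 := congrFun h 3
    clear hd hK h mix move scale comb e0
    fin_cases j <;> simp [h0, h1, h4, h5] at hj ⊢
  -- Adding a multiple of the translation removes its coordinate from the scaling. The remaining
  -- field has the weights listed here, normalised so that the `m`-th one is 1; the later rows
  -- proceed in the same way.
  · refine scale 0 1 ![0, 1, 0, -1, -2, -3] hreg (fun y hy => (hK y hy).2)
      (fun y hy => comb (-1) (-y 0) (hK y hy).1 (hK y hy).2 ?_) fun σ hσ j => ?_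
    · ext j; fin_cases j <;> simp [canonicalProlongation]
    have hz1 : z 1 ≠ 0 := hreg hz
    rw [div_eq_iff hz1] at hσ
    have h2 : z' 2 = z 2 := congrFun h 0
    have h3 : z' 3 = Real.exp (-(1 : ℕ) * σ) * z 3 := unscale _ hσ hz1 (by
      simpa [invariants] using congrFun h 1)
    have h4 : z' 4 = Real.exp (-(2 : ℕ) * σ) * z 4 := unscale _ hσ hz1 (by
      simpa [invariants] using congrFun h 2)
    have h5 : z' 5 = Real.exp (-(3 : ℕ) * σ) * z 5 := unscale _ hσ hz1 (by
      simpa [invariants] using congrFun h 3)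
    clear hd hK h mix move scale comb
    fin_cases j <;> simp [h2, h3, h4, h5, hσ]
  · refine scale 1 0 ![1, 0, 0, -1, -2, -3] hreg (fun y hy => (hK y hy).2)
      (fun y hy => comb (-1) (-y 1) (hK y hy).1 (hK y hy).2 ?_) fun σ hσ j => ?_
    · ext j; fin_cases j <;> simp [canonicalProlongation]
    have hz1 : z 0 ≠ 0 := hreg hz
    rw [div_eq_iff hz1] at hσ
    have h2 : z' 2 = z 2 := congrFun h 0
    have h3 : z' 3 = Real.exp (-(1 : ℕ) * σ) * z 3 := unscale _ hσ hz1 (by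
      simpa [invariants] using congrFun h 1)
    have h4 : z' 4 = Real.exp (-(2 : ℕ) * σ) * z 4 := unscale _ hσ hz1 (by
      simpa [invariants] using congrFun h 2)
    have h5 : z' 5 = Real.exp (-(3 : ℕ) * σ) * z 5 := unscale _ hσ hz1 (by
      simpa [invariants] using congrFun h 3)
    clear hd hK h mix move scale comb
    fin_cases j <;> simp [h2, h3, h4, h5, hσ]
  · refine scale 1 2 ![0, 0, 1, 0, -1, -2] hreg (fun y hy => (hK y hy).2)
      (fun y hy => comb (-1) (-y 1) (hK y hy).1 (hK y hy).2 ?_) fun σ hσ j => ?_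
    · ext j; fin_cases j <;> simp [canonicalProlongation]
    have hz1 : z 2 ≠ 0 := hreg hz
    rw [div_eq_iff hz1] at hσ
    have h0 : z' 0 = z 0 := congrFun h 0
    have h3 : z' 3 = z 3 := congrFun h 1
    have h4 : z' 4 = Real.exp (-(1 : ℕ) * σ) * z 4 := unscale _ hσ hz1 (by
      simpa [invariants] using congrFun h 2)
    have h5 : z' 5 = Real.exp (-(2 : ℕ) * σ) * z 5 := unscale _ hσ hz1 (by
      simpa [invariants] using congrFun h 3)
    clear hd hK h mix move scale comb
    fin_cases j <;> simp [h0, h3, h4, h5, hσ]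
  · refine scale 1 3 ![0, 0, 0, 1, 2, 3] hreg (fun y hy => (hK y hy).2)
      (fun y hy => comb 1 (y 1) (hK y hy).1 (hK y hy).2 ?_) fun σ hσ j => ?_
    · ext j; fin_cases j <;> simp [canonicalProlongation]
    have hz1 : z 3 ≠ 0 := hreg hz
    rw [div_eq_iff hz1] at hσ
    have hz3 : z' 3 ≠ 0 := hreg hz'
    have h0 : z' 0 = z 0 := congrFun h 0
    have h2 : z' 2 = z 2 := congrFun h 1
    have h4 : z' 4 / z' 3 ^ 2 = z 4 / z 3 ^ 2 := congrFun h 2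
    have h5 : z' 5 / z' 3 ^ 3 = z 5 / z 3 ^ 3 := congrFun h 3
    rw [div_eq_div_iff (pow_ne_zero _ hz3) (pow_ne_zero _ hz1), hσ] at h4 h5
    have e4 : z' 4 = Real.exp ((2 : ℕ) * σ) * z 4 := by
      rw [Real.exp_nat_mul]
      refine mul_right_cancel₀ (pow_ne_zero 2 hz1) (h4.trans ?_); ring
    have e5 : z' 5 = Real.exp ((3 : ℕ) * σ) * z 5 := by
      rw [Real.exp_nat_mul]
      refine mul_right_cancel₀ (pow_ne_zero 3 hz1) (h5.trans ?_); ring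
    clear hd hK h mix move scale comb
    fin_cases j <;> simp [h0, h2, hσ, e4, e5]

/-- Smooth sections of the invariants. -/
lemma exists_section (i : Fin 3 ⊕ Fin 4) {z : Jet3} (hz : z ∈ regular i) :
    ∃ σ : (Fin 4 → ℝ) → Jet3, ContDiff ℝ ∞ σ ∧ σ (invariants i z) = z ∧
      ∀ y, invariants i (σ y) = y := by
  have sm : ∀ {a b c d e f : (Fin 4 → ℝ) → ℝ}, ContDiff ℝ ∞ a → ContDiff ℝ ∞ b →
      ContDiff ℝ ∞ c → ContDiff ℝ ∞ d → ContDiff ℝ ∞ e → ContDiff ℝ ∞ f →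
      ContDiff ℝ ∞ fun y => (![a y, b y, c y, d y, e y, f y] : Jet3) := by
    intro a b c d e f ha hb hc hd he hf
    refine contDiff_pi.2 fun k => ?_
    fin_cases k <;> assumption
  rcases i with i | i <;> fin_cases i
  · refine ⟨fun y => ![z 0, z 1, y 0, y 1, y 2, y 3], sm ?_ ?_ ?_ ?_ ?_ ?_, ?_, fun y => ?_⟩
    any_goals fun_prop
    all_goals ext k; fin_cases k <;> simp [invariants]
  · refine ⟨fun y => ![y 0, z 1, z 2, y 1, y 2, y 3], sm ?_ ?_ ?_ ?_ ?_ ?_, ?_, fun y => ?_⟩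
    any_goals fun_prop
    all_goals ext k; fin_cases k <;> simp [invariants]
  · refine ⟨fun y => ![y 0, y 1, z 2, z 3, y 2, y 3], sm ?_ ?_ ?_ ?_ ?_ ?_, ?_, fun y => ?_⟩
    any_goals fun_prop
    all_goals ext k; fin_cases k <;> simp [invariants]
  · have h : z 1 ≠ 0 := hz
    refine ⟨fun y => ![z 0, z 1, y 0, (z 1)⁻¹ * y 1, (z 1 ^ 2)⁻¹ * y 2, (z 1 ^ 3)⁻¹ * y 3],
      sm ?_ ?_ ?_ ?_ ?_ ?_, ?_, fun y => ?_⟩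
    any_goals fun_prop
    all_goals ext k; fin_cases k <;> simp [invariants, h]
  · have h : z 0 ≠ 0 := hz
    refine ⟨fun y => ![z 0, z 1, y 0, (z 0)⁻¹ * y 1, (z 0 ^ 2)⁻¹ * y 2, (z 0 ^ 3)⁻¹ * y 3],
      sm ?_ ?_ ?_ ?_ ?_ ?_, ?_, fun y => ?_⟩
    any_goals fun_prop
    all_goals ext k; fin_cases k <;> simp [invariants, h]
  · have h : z 2 ≠ 0 := hz
    refine ⟨fun y => ![y 0, z 1, z 2, y 1, (z 2)⁻¹ * y 2, (z 2 ^ 2)⁻¹ * y 3],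
      sm ?_ ?_ ?_ ?_ ?_ ?_, ?_, fun y => ?_⟩
    any_goals fun_prop
    all_goals ext k; fin_cases k <;> simp [invariants, h]
  · have h : z 3 ≠ 0 := hz
    refine ⟨fun y => ![y 0, z 1, y 1, z 3, z 3 ^ 2 * y 2, z 3 ^ 3 * y 3],
      sm ?_ ?_ ?_ ?_ ?_ ?_, ?_, fun y => ?_⟩
    any_goals fun_prop
    all_goals ext k; fin_cases k <;> simp [invariants, h]
    all_goals field_simp

/-- The orbits of the canonical fields lie in the fibres of the invariants. -/
lemma exists_orbit (i : Fin 3 ⊕ Fin 4) (k : Fin 2) (z : Jet3) :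
    ∃ γ : ℝ → Jet3, γ 0 = z ∧ HasDerivAt γ (canonicalProlongation i k z) 0 ∧
      ∀ s, invariants i (γ s) = invariants i z := by
  have line : ∀ v : Jet3, HasDerivAt (fun s : ℝ => z + s • v) v 0 := fun v => by
    simpa using ((hasDerivAt_id (0 : ℝ)).smul_const v).const_add z
  have scal : ∀ w : Fin 6 → ℝ,
      HasDerivAt (fun (s : ℝ) (j : Fin 6) => Real.exp (w j * s) * z j) (fun j => w j * z j) 0 := by
    intro w
    refine hasDerivAt_pi.2 fun j => ?_
    have := (((hasDerivAt_id (0 : ℝ)).const_mul (w j)).exp).mul_const (z j)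
    exact this.congr_deriv (by simp)
  have hexp : ∀ (n : ℕ) (s : ℝ), Real.exp ((n : ℝ) * s) = Real.exp s ^ n := fun n s =>
    Real.exp_nat_mul s n
  have additive : ∀ v : Jet3, canonicalProlongation i k z = v →
      (∀ s : ℝ, invariants i (z + s • v) = invariants i z) →
      ∃ γ : ℝ → Jet3, γ 0 = z ∧ HasDerivAt γ (canonicalProlongation i k z) 0 ∧
        ∀ s, invariants i (γ s) = invariants i z := fun v h1 h2 =>
    ⟨fun s => z + s • v, by simp, h1 ▸ line v, h2⟩
  have multiplicative : ∀ w : Fin 6 → ℝ, (∀ j, canonicalProlongation i k z j = w j * z j) →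
      (∀ s : ℝ, invariants i (fun j => Real.exp (w j * s) * z j) = invariants i z) →
      ∃ γ : ℝ → Jet3, γ 0 = z ∧ HasDerivAt γ (canonicalProlongation i k z) 0 ∧
        ∀ s, invariants i (γ s) = invariants i z := fun w h1 h2 =>
    ⟨fun s j => Real.exp (w j * s) * z j, by ext j; simp, (scal w).congr_deriv (funext fun j =>
      (h1 j).symm), h2⟩
  rcases i with i | i
  · refine additive _ rfl fun s => ?_
    fin_cases i <;> fin_cases k <;>
      (ext j; fin_cases j <;> simp [invariants, canonicalProlongation] <;> rfl)
  · obtain rfl | rfl : k = 0 ∨ k = 1 := by fin_cases k <;> simp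
    · fin_cases i
      · refine multiplicative ![-1, -1, 0, 1, 2, 3] (fun j => ?_) fun s => ?_
        · fin_cases j <;> simp [canonicalProlongation]
        · have e2 := hexp 2 s
          have e3 := hexp 3 s
          push_cast at e2 e3
          ext j; fin_cases j <;> simp [invariants, Real.exp_neg, e2, e3] <;> field_simp
      · refine multiplicative ![-1, -1, 0, 1, 2, 3] (fun j => ?_) fun s => ?_
        · fin_cases j <;> simp [canonicalProlongation]
        · have e2 := hexp 2 s
          have e3 := hexp 3 s
          push_cast at e2 e3
          ext j; fin_cases j <;> simp [invariants, Real.exp_neg, e2, e3] <;> field_simp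
      · refine multiplicative ![0, -1, -1, 0, 1, 2] (fun j => ?_) fun s => ?_
        · fin_cases j <;> simp [canonicalProlongation]
        · have e2 := hexp 2 s
          push_cast at e2
          ext j; fin_cases j <;> simp [invariants, Real.exp_neg, e2] <;> field_simp
      · refine multiplicative ![0, -1, 0, 1, 2, 3] (fun j => ?_) fun s => ?_
        · fin_cases j <;> simp [canonicalProlongation]
        · have e2 := hexp 2 s
          have e3 := hexp 3 s
          push_cast at e2 e3
          have := Real.exp_pos s
          ext j; fin_cases j <;> simp [invariants, e2, e3] <;> rw [mul_pow] <;>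
            exact mul_div_mul_left _ _ (by positivity)
    · refine additive _ rfl fun s => ?_
      fin_cases i <;> (ext j; fin_cases j <;> simp [invariants, canonicalProlongation])

/-- The quotient of `H` by a coefficient of the same degree is invariant, hence constant on the
fibres of the invariants within a box; sections of the invariants make the induced function smooth.
-/
lemma exists_factor_of_isHomogeneousOn {i : Fin 3 ⊕ Fin 4} {κ : ℝ} {H c : Jet3 → ℝ}
    {B : Set Jet3} (hc : IsCoefficient i κ c) (hB : IsOpenBox B) (hreg : B ⊆ regular i)
    (hH : ContDiffOn ℝ ∞ H B) (hh : IsHomogeneousOn i κ H B) :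
    ∃ f : (Fin 4 → ℝ) → ℝ, ContDiffOn ℝ ∞ f (invariants i '' B) ∧
      ∀ z ∈ B, H z = c z * f (invariants i z) := by
  have hd : ∀ z ∈ B, DifferentiableAt ℝ H z := fun z hz =>
    hH.differentiableAt_of_isOpen hB.isOpen hz
  refine exists_smooth_factor hB.isOpen hH (hc.1.mono hreg) (fun z hz => hc.2.1 z (hreg hz)) ?_ ?_
  · intro z hz z' hz' h
    refine (hh.div hreg hd hc).eq_of_invariants_eq hB hreg (fun y hy => ?_) hz hz' h
    exact differentiableAt_div (hd y hy) (hc.1.differentiableAt_of_isOpen (isOpen_regular i) (hreg hy))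
      (hc.2.1 y (hreg hy))
  · intro z hz
    obtain ⟨σ, h1, h2, h3⟩ := exists_section i (hreg hz)
    exact ⟨σ, h1.contDiffAt, h2, h3⟩

/-- At a regular point `H / c` is constant along orbits of the fields, since these lie in the fibres
of the invariants, and differentiation gives the homogeneity. Regular points are dense in `Ω` and
both sides of the equations are continuous, so the remaining points follow. -/
lemma isHomogeneousOn_of_exists_factor {i : Fin 3 ⊕ Fin 4} {κ : ℝ} {H c : Jet3 → ℝ}
    {Ω : Set Jet3} (hc : IsCoefficient i κ c) (hΩ : IsOpen Ω) (hH : ContDiffOn ℝ ∞ H Ω)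
    (hcont : ∀ k, Continuous (canonicalProlongation i k))
    (h : ∀ B ⊆ Ω ∩ regular i, IsOpenBox B → ∃ f : (Fin 4 → ℝ) → ℝ,
      ∀ z ∈ B, H z = c z * f (invariants i z)) : IsHomogeneousOn i κ H Ω := by
  have hreg : ∀ z ∈ Ω ∩ regular i, fderiv ℝ H z (canonicalProlongation i 0 z) = κ * H z ∧
      fderiv ℝ H z (canonicalProlongation i 1 z) = 0 := by
    intro z hz
    obtain ⟨B, hBΩ, hB, hzB⟩ := IsOpenBox.exists_subset (hΩ.inter (isOpen_regular i)) hz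
    obtain ⟨f, hf⟩ := h B hBΩ hB
    have hd := hH.differentiableAt_of_isOpen hΩ hz.1
    have hcd := hc.1.differentiableAt_of_isOpen (isOpen_regular i) hz.2
    have hc0 := hc.2.1 z hz.2
    have key : ∀ k, fderiv ℝ H z (canonicalProlongation i k z) * c z =
        H z * fderiv ℝ c z (canonicalProlongation i k z) := by
      intro k
      obtain ⟨γ, hγ0, hγ, hinv⟩ := exists_orbit i k z
      have h1 : HasDerivAt (fun s => H (γ s) / c (γ s))
          (fderiv ℝ (fun z => H z / c z) z (canonicalProlongation i k z)) 0 := by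
        refine HasFDerivAt.comp_hasDerivAt (0 : ℝ) (l := fun z => H z / c z) ?_ hγ
        rw [hγ0]
        exact (differentiableAt_div hd hcd hc0).hasFDerivAt
      have h2 : HasDerivAt (fun s => H (γ s) / c (γ s)) 0 0 := by
        refine (hasDerivAt_const (0 : ℝ) (f (invariants i z))).congr_of_eventuallyEq ?_
        have : ∀ᶠ s in 𝓝 (0 : ℝ), γ s ∈ B := hγ.continuousAt.eventually (by
          rw [hγ0]; exact hB.isOpen.mem_nhds hzB)
        filter_upwards [this] with s hs
        rw [hf _ hs, hinv, mul_div_cancel_left₀ _ (hc.2.1 _ (hBΩ hs).2)]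
      have h3 := h1.unique h2
      rw [fderiv_div_apply hd hcd hc0, div_eq_zero_iff] at h3
      have := h3.resolve_right (pow_ne_zero 2 hc0)
      linarith
    obtain ⟨a, b⟩ := hc.2.2 z hz.2
    have k0 := key 0
    have k1 := key 1
    rw [a] at k0
    rw [b, mul_zero] at k1
    refine ⟨mul_right_cancel₀ hc0 (k0.trans (by ring)), ?_⟩
    exact (mul_eq_zero.1 k1).resolve_right hc0
  have hdense : Ω ⊆ closure (Ω ∩ regular i) := (dense_regular i).open_subset_closure_inter hΩ
  have hcd : ∀ k, ContinuousOn (fun z => fderiv ℝ H z (canonicalProlongation i k z)) Ω := fun k =>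
    (hH.fderiv_infty hΩ).continuousOn.clm_apply (hcont k).continuousOn
  have ext : ∀ {a b : Jet3 → ℝ}, ContinuousOn a Ω → ContinuousOn b Ω →
      (∀ z ∈ Ω ∩ regular i, a z = b z) → ∀ z ∈ Ω, a z = b z := by
    intro a b ha hb hab z hz
    exact Set.EqOn.of_subset_closure (s := Ω ∩ regular i) hab ha hb inter_subset_left hdense hz
  exact fun z hz => ⟨ext (hcd 0) (continuousOn_const.mul hH.continuousOn) (fun y hy =>
    (hreg y hy).1) z hz, ext (hcd 1) continuousOn_const (fun y hy => (hreg y hy).2) z hz⟩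

lemma continuous_canonicalProlongation (i : Fin 3 ⊕ Fin 4) (k : Fin 2) :
    Continuous (canonicalProlongation i k) := by
  rcases i with i | i <;> fin_cases i <;> fin_cases k <;>
    simp only [canonicalProlongation] <;> first
    | exact continuous_const
    | (refine continuous_pi fun j => ?_
       fin_cases j <;> simp <;> fun_prop)

/-- The equations that admit a canonical algebra. -/
theorem isSymmetry_canonical_iff_hasTableForm (i : Fin 3 ⊕ Fin 4) {F G : Jet3 → ℝ}
    {Ω : Set Jet3} (hE : IsEquation F G Ω) :
    (∀ k, IsSymmetry F G Ω (canonical i k)) ↔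
      ∀ B ⊆ Ω ∩ regular i, IsOpenBox B → HasTableForm i F G B := by
  rw [isSymmetry_canonical_iff]
  constructor
  · rintro ⟨hF, hG⟩ B hBΩ hB
    have h1 := hBΩ.trans inter_subset_left
    have h2 := hBΩ.trans inter_subset_right
    obtain ⟨f, hf, hf'⟩ := exists_factor_of_isHomogeneousOn (isCoefficient_coeffF i) hB h2
      (hE.smooth_F.mono h1) fun z hz => hF z (h1 hz)
    obtain ⟨g, hg, hg'⟩ := exists_factor_of_isHomogeneousOn (isCoefficient_coeffG i) hB h2
      (hE.smooth_G.mono h1) fun z hz => hG z (h1 hz)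
    exact ⟨h2, f, g, hf, hg, fun z hz => ⟨hf' z hz, hg' z hz⟩⟩
  · intro h
    refine ⟨isHomogeneousOn_of_exists_factor (isCoefficient_coeffF i) hE.isOpen hE.smooth_F
      (continuous_canonicalProlongation i) fun B hB hbox => ?_,
      isHomogeneousOn_of_exists_factor (isCoefficient_coeffG i) hE.isOpen hE.smooth_G
      (continuous_canonicalProlongation i) fun B hB hbox => ?_⟩
    · obtain ⟨-, f, g, -, -, hfg⟩ := h B hB hbox
      exact ⟨f, fun z hz => (hfg z hz).1⟩
    · obtain ⟨-, f, g, -, -, hfg⟩ := h B hB hbox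
      exact ⟨g, fun z hz => (hfg z hz).2⟩

end Rows

/-! ### Total derivatives and dependence on jet coordinates -/

section TotalDerivatives

/-- The direction of the total derivative `D_x`. -/
def dxVec (j : Jet) : Jet := ![0, 1, j 3, j 4, j 5, j 6, 0, j 8, j 9, j 10, 0]

lemma Dx_eq (f : Jet → ℝ) (j : Jet) : Dx f j = fderiv ℝ f j (dxVec j) := rfl

lemma contDiff_dxVec : ContDiff ℝ ∞ dxVec := by
  refine contDiff_pi.2 fun k => ?_
  fin_cases k <;> simp only [dxVec] <;> simp <;> fun_prop

lemma contDiff_base : ContDiff ℝ ∞ base := by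
  refine contDiff_pi.2 fun k => ?_
  fin_cases k <;> simp only [base] <;> simp <;> fun_prop

lemma contDiff_jet3 : ContDiff ℝ ∞ jet3 := by
  refine contDiff_pi.2 fun k => ?_
  fin_cases k <;> simp only [jet3] <;> simp <;> fun_prop

lemma contDiff_base3 : ContDiff ℝ ∞ base3 := by
  refine contDiff_pi.2 fun k => ?_
  fin_cases k <;> simp only [base3] <;> simp <;> fun_prop

lemma base3_jet3 (j : Jet) : base3 (jet3 j) = base j := rfl

lemma base_add_smul (j v : Jet) (s : ℝ) : base (j + s • v) = base j + s • base v := by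
  ext k; fin_cases k <;> simp [base]

lemma jet3_add_smul (j v : Jet) (s : ℝ) : jet3 (j + s • v) = jet3 j + s • jet3 v := by
  ext k; fin_cases k <;> simp [jet3]

lemma isOpenMap_base3 : IsOpenMap base3 := by
  have h1 : Function.Surjective base3 := fun b =>
    ⟨![b 0, b 1, b 2, 0, 0, 0], by ext k; fin_cases k <;> simp [base3]⟩
  let L : Jet3 →ₗ[ℝ] Base :=
    { toFun := base3
      map_add' := fun x y => by ext k; fin_cases k <;> simp [base3]
      map_smul' := fun c x => by ext k; fin_cases k <;> simp [base3] }
  exact L.isOpenMap_of_finiteDimensional h1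

/-- Chain rule for a linear inner map given by its action on lines. -/
lemma fderiv_comp_base {f : Base → ℝ} {j : Jet} (hf : DifferentiableAt ℝ f (base j)) (v : Jet) :
    fderiv ℝ (fun i => f (base i)) j v = fderiv ℝ f (base j) (base v) := by
  have hb := contDiff_base.differentiable (by simp) j
  refine fderiv_apply_eq_of_hasDerivAt (hf.comp j hb) ?_
  simp only [base_add_smul]
  exact hf.hasFDerivAt.hasLineDerivAt (base v)

lemma fderiv_coord {n : ℕ} (k : Fin n) (j v : Fin n → ℝ) :
    fderiv ℝ (fun i : Fin n → ℝ => i k) j v = v k := by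
  simpa using fderiv_smul_coord k 1 0 j v

lemma Dx_comp_base {f : Base → ℝ} {j : Jet} (hf : DifferentiableAt ℝ f (base j)) :
    Dx (fun i => f (base i)) j = fderiv ℝ f (base j) ![0, 1, j 3] := by
  rw [Dx_eq, fderiv_comp_base hf]; rfl

lemma contDiffOn_Dx {f : Jet → ℝ} {O : Set Jet} (hO : IsOpen O) (hf : ContDiffOn ℝ ∞ f O) :
    ContDiffOn ℝ ∞ (Dx f) O :=
  (hf.fderiv_infty hO).clm_apply contDiff_dxVec.contDiffOn

lemma Dx_congr {f g : Jet → ℝ} {O : Set Jet} (hO : IsOpen O) (h : EqOn f g O) :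
    EqOn (Dx f) (Dx g) O := by
  intro j hj
  rw [Dx_eq, Dx_eq, (h.eventuallyEq_of_mem (hO.mem_nhds hj)).fderiv_eq]

/-- `f` does not depend on the `l`-th jet coordinate. -/
def IndepOf (l : Fin 11) (f : Jet → ℝ) : Prop := ∀ (j : Jet) (s : ℝ), f (j + s • Pi.single l 1) = f j

/-- `f` depends only on the coordinates up to the `k`-th one. -/
def DependsUpTo (k : Fin 11) (f : Jet → ℝ) : Prop := ∀ l, k < l → IndepOf l f

lemma DependsUpTo.mono {k k' : Fin 11} {f : Jet → ℝ} (h : DependsUpTo k f) (hk : k ≤ k') :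
    DependsUpTo k' f := fun l hl => h l (hk.trans_lt hl)

lemma IndepOf.fderiv_single {l : Fin 11} {f : Jet → ℝ} (h : IndepOf l f) (j : Jet) :
    fderiv ℝ f j (Pi.single l 1) = 0 := by
  by_cases hf : DifferentiableAt ℝ f j
  · refine fderiv_apply_eq_of_hasDerivAt hf ?_
    simp only [h j]
    exact hasDerivAt_const _ _
  · simp [fderiv_zero_of_not_differentiableAt hf]

lemma IndepOf.fderiv_add {l : Fin 11} {f : Jet → ℝ} (h : IndepOf l f) (j : Jet) (s : ℝ) :
    fderiv ℝ f (j + s • Pi.single l 1) = fderiv ℝ f j := by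
  have : (fun i => f (i + s • Pi.single l 1)) = f := funext fun i => h i s
  rw [← fderiv_comp_add_right, this]

lemma DependsUpTo.fderiv_congr {k : Fin 11} {f : Jet → ℝ} (h : DependsUpTo k f) {j v v' : Jet}
    (hv : ∀ l ≤ k, v l = v' l) : fderiv ℝ f j v = fderiv ℝ f j v' := by
  rw [← sub_eq_zero, ← map_sub, pi_eq_sum_univ' (v - v'), map_sum]
  refine Finset.sum_eq_zero fun l _ => ?_
  rw [map_smul]
  rcases le_or_gt l k with hl | hl
  · simp [hv l hl]
  · have := (h l hl).fderiv_single j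
    rw [this, smul_zero]

lemma DependsUpTo.congr {k : Fin 11} {f : Jet → ℝ} (h : DependsUpTo k f) {j j' : Jet}
    (hj : ∀ l ≤ k, j l = j' l) : f j = f j' := by
  have key : ∀ s : Finset (Fin 11), f (j + ∑ l ∈ s, (j' l - j l) • Pi.single l 1) = f j := by
    intro s
    induction s using Finset.induction_on with
    | empty => simp
    | insert l s hl ih =>
      rw [Finset.sum_insert hl, add_comm ((j' l - j l) • (Pi.single l (1 : ℝ) : Jet)), ← add_assoc]
      rcases le_or_gt l k with hlk | hlk
      · rw [hj l hlk, sub_self, zero_smul, add_zero, ih]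
      · rw [h l hlk, ih]
  have e : j + ∑ l, (j' l - j l) • Pi.single l (1 : ℝ) = j' := by
    ext i
    simp [Finset.sum_apply, Pi.single_apply]
  rw [← key Finset.univ, e]

lemma dependsUpTo_comp_base (f : Base → ℝ) : DependsUpTo 2 fun i => f (base i) := by
  intro l hl j s
  simp only [base_add_smul]
  congr 1
  have : base (Pi.single l 1) = 0 := by
    ext k
    have h0 : l ≠ 0 := by rintro rfl; exact absurd hl (by decide)
    have h1 : l ≠ 1 := by rintro rfl; exact absurd hl (by decide)
    have h2 : l ≠ 2 := by rintro rfl; exact absurd hl (by decide)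
    fin_cases k <;> simp [base, h0, h1, h2]
  rw [this, smul_zero, add_zero]

lemma dependsUpTo_coord {k l : Fin 11} (h : l ≤ k) : DependsUpTo k fun j => j l := by
  intro m hm j s
  have : l ≠ m := by rintro rfl; exact absurd (h.trans_lt hm) (lt_irrefl _)
  simp [this]

/-- As `f` does not depend on the coordinate `l`, a change in it affects `D_x f` only through the
direction of differentiation, in which it is the component `m`. Thus the slope of `D_x f` in the
higher derivative is that of `f` in the lower one. -/
lemma IndepOf.Dx_add {m l : Fin 11} {f : Jet → ℝ} (h : IndepOf l f)
    (hml : ∀ (j : Jet) (s : ℝ),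
      dxVec (j + s • Pi.single l 1) = dxVec j + s • Pi.single m 1) (j : Jet) (s : ℝ) :
    Dx f (j + s • Pi.single l 1) = Dx f j + s * fderiv ℝ f j (Pi.single m 1) := by
  rw [Dx_eq, h.fderiv_add, hml, map_add, map_smul]; rfl

lemma dxVec_add_single (j : Jet) (s : ℝ) :
    dxVec (j + s • Pi.single 3 1) = dxVec j + s • Pi.single 2 1 ∧
    dxVec (j + s • Pi.single 4 1) = dxVec j + s • Pi.single 3 1 ∧
    dxVec (j + s • Pi.single 5 1) = dxVec j + s • Pi.single 4 1 ∧
    dxVec (j + s • Pi.single 6 1) = dxVec j + s • Pi.single 5 1 ∧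
    dxVec (j + s • Pi.single 7 1) = dxVec j ∧
    dxVec (j + s • Pi.single 8 1) = dxVec j + s • Pi.single 7 1 ∧
    dxVec (j + s • Pi.single 9 1) = dxVec j + s • Pi.single 8 1 ∧
    dxVec (j + s • Pi.single 10 1) = dxVec j + s • Pi.single 9 1 := by
  refine ⟨?_, ?_, ?_, ?_, ?_, ?_, ?_, ?_⟩ <;>
    (ext k; fin_cases k <;> simp [dxVec])

lemma IndepOf.Dx {m l : Fin 11} {f : Jet → ℝ} (h : IndepOf l f) (hm : IndepOf m f)
    (hml : ∀ (j : Jet) (s : ℝ),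
      dxVec (j + s • Pi.single l 1) = dxVec j + s • Pi.single m 1) :
    IndepOf l (Dx f) := fun j s => by
  rw [h.Dx_add hml, hm.fderiv_single, mul_zero, add_zero]

lemma IndepOf.Dx_seven {f : Jet → ℝ} (h : IndepOf 7 f) : IndepOf 7 (EvolutionSymmetry.Dx f) :=
  fun j s => by
    rw [Dx_eq, h.fderiv_add, (dxVec_add_single j s).2.2.2.2.1]; rfl

/-- Each coordinate beyond `k'` enters the direction of `D_x` at most in the component just before
it, on which `f` does not depend. The coordinate `u_t`, with index 7, does not enter it at all. -/
lemma DependsUpTo.Dx {k k' : Fin 11} {f : Jet → ℝ} (h : DependsUpTo k f) (hk : 2 ≤ k)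
    (hkk : (k' : ℕ) = k + 1) : DependsUpTo k' (Dx f) := by
  intro l hl
  have hl' := h l (lt_trans (by rw [Fin.lt_def]; omega) hl)
  have h2 : ∀ m : Fin 11, (l : ℕ) = m + 1 → IndepOf m f := fun m hm =>
    h m (by rw [Fin.lt_def] at hl ⊢; omega)
  have hl4 : (4 : ℕ) ≤ l := by rw [Fin.lt_def] at hl; rw [Fin.le_def] at hk; simp at hk; omega
  fin_cases l <;> simp at hl4
  · exact hl'.Dx (h2 3 rfl) fun j s => (dxVec_add_single j s).2.1
  · exact hl'.Dx (h2 4 rfl) fun j s => (dxVec_add_single j s).2.2.1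
  · exact hl'.Dx (h2 5 rfl) fun j s => (dxVec_add_single j s).2.2.2.1
  · exact hl'.Dx_seven
  · exact hl'.Dx (h2 7 rfl) fun j s => (dxVec_add_single j s).2.2.2.2.2.1
  · exact hl'.Dx (h2 8 rfl) fun j s => (dxVec_add_single j s).2.2.2.2.2.2.1
  · exact hl'.Dx (h2 9 rfl) fun j s => (dxVec_add_single j s).2.2.2.2.2.2.2

lemma fderiv_single_of_affine {l : Fin 11} {f : Jet → ℝ} {j : Jet} {c : ℝ}
    (hf : DifferentiableAt ℝ f j) (h : ∀ s : ℝ, f (j + s • Pi.single l 1) = f j + s * c) :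
    fderiv ℝ f j (Pi.single l 1) = c := by
  refine fderiv_apply_eq_of_hasDerivAt hf ?_
  simp only [h]
  simpa using ((hasDerivAt_id (0 : ℝ)).mul_const c).const_add (f j)

end TotalDerivatives

/-! ### The time component of a symmetry -/

section TimeComponent

/-- `f` is infinitesimally a function of the time alone. -/
def IsTimeOnly (f : Base → ℝ) (M : Set Base) : Prop :=
  ∀ b ∈ M, fderiv ℝ f b (Pi.single 1 1) = 0 ∧ fderiv ℝ f b (Pi.single 2 1) = 0

lemma IsTimeOnly.apply {f : Base → ℝ} {M : Set Base} (h : IsTimeOnly f M) {b : Base} (hb : b ∈ M)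
    (v : Base) : fderiv ℝ f b v = v 0 * fderiv ℝ f b (Pi.single 0 1) := by
  have : v = v 0 • Pi.single 0 1 + v 1 • Pi.single 1 1 + v 2 • Pi.single 2 1 := by
    ext k; fin_cases k <;> simp
  conv_lhs => rw [this]
  rw [map_add, map_add, map_smul, map_smul, map_smul, (h b hb).1, (h b hb).2]
  simp

lemma IsTimeOnly.mono {f : Base → ℝ} {M M' : Set Base} (h : IsTimeOnly f M) (hM : M' ⊆ M) :
    IsTimeOnly f M' := fun b hb => h b (hM hb)

variable {V : Base → Base} {M : Set Base}

lemma isOpen_cylinder (hM : IsOpen M) : IsOpen {j : Jet | base j ∈ M} :=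
  hM.preimage contDiff_base.continuous

lemma contDiffOn_component {n : ℕ} {E : Type*} [NormedAddCommGroup E] [NormedSpace ℝ E]
    {f : E → Fin n → ℝ} {s : Set E} (hf : ContDiffOn ℝ ∞ f s) (k : Fin n) :
    ContDiffOn ℝ ∞ (fun b => f b k) s := contDiffOn_pi.1 hf k

lemma contDiffOn_lift {f : Base → ℝ} (hf : ContDiffOn ℝ ∞ f M) :
    ContDiffOn ℝ ∞ (fun i => f (base i)) {j : Jet | base j ∈ M} :=
  hf.comp contDiff_base.contDiffOn fun _ hj => hj

lemma contDiffOn_etas (hM : IsOpen M) (hV : ContDiffOn ℝ ∞ V M) :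
    ContDiffOn ℝ ∞ (eta1 V) {j | base j ∈ M} ∧ ContDiffOn ℝ ∞ (eta2 V) {j | base j ∈ M} ∧
    ContDiffOn ℝ ∞ (eta3 V) {j | base j ∈ M} := by
  have hO := isOpen_cylinder hM
  have hD : ∀ k, ContDiffOn ℝ ∞ (Dx fun i => V (base i) k) {j | base j ∈ M} := fun k =>
    contDiffOn_Dx hO (contDiffOn_lift (contDiffOn_component hV k))
  have hc : ∀ k : Fin 11, ContDiffOn ℝ ∞ (fun j : Jet => j k) {j | base j ∈ M} := fun k => by
    fun_prop
  have h1 : ContDiffOn ℝ ∞ (eta1 V) {j | base j ∈ M} :=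
    ((hD 2).sub ((hc 7).mul (hD 0))).sub ((hc 3).mul (hD 1))
  have h2 : ContDiffOn ℝ ∞ (eta2 V) {j | base j ∈ M} :=
    ((contDiffOn_Dx hO h1).sub ((hc 8).mul (hD 0))).sub ((hc 4).mul (hD 1))
  exact ⟨h1, h2, ((contDiffOn_Dx hO h2).sub ((hc 9).mul (hD 0))).sub ((hc 5).mul (hD 1))⟩

/-- `u_txxx` occurs in the prolonged criterion only through `D_x τ`. -/
lemma eta4_add_single (hM : IsOpen M) (hV : ContDiffOn ℝ ∞ V M) {j : Jet} (hj : base j ∈ M)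
    (s : ℝ) :
    eta1 V (j + s • Pi.single 10 1) = eta1 V j ∧ eta2 V (j + s • Pi.single 10 1) = eta2 V j ∧
    eta3 V (j + s • Pi.single 10 1) = eta3 V j ∧
    eta4 V (j + s • Pi.single 10 1) = eta4 V j - s * (4 * Dx (fun i => V (base i) 0) j) := by
  have hO := isOpen_cylinder hM
  obtain ⟨c1, c2, c3⟩ := contDiffOn_etas hM hV
  have hI : ∀ (k : Fin 3) (l : Fin 11), 4 ≤ l → IndepOf l (Dx fun i => V (base i) k) := by
    intro k l hl
    exact (dependsUpTo_comp_base fun b => V b k).Dx (k' := 3) le_rfl rfl l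
      (lt_of_lt_of_le (by decide) hl)
  have a1 : ∀ l : Fin 11, 4 ≤ l → l ≠ 7 → IndepOf l (eta1 V) := by
    intro l hl h7 j s
    have h3 : l ≠ 3 := by rintro rfl; exact absurd hl (by decide)
    simp only [eta1]
    rw [hI 0 l hl, hI 1 l hl, hI 2 l hl]
    simp [h7.symm, h3.symm]
  -- The slope of the first coefficient in `u_t` is `-D_x τ`. Each later coefficient inherits the
  -- slope of its predecessor through `D_x` and acquires a further `-D_x τ` from its explicit term,
  -- so the slopes in `u_tx`, `u_txx`, `u_txxx` are `-2`, `-3`, `-4` times `D_x τ`.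
  have b1 : ∀ (j : Jet) (s : ℝ), eta1 V (j + s • Pi.single 7 1) =
      eta1 V j + s * (-Dx (fun i => V (base i) 0) j) := by
    intro j s
    simp only [eta1]
    rw [hI 0 7 (by decide), hI 1 7 (by decide), hI 2 7 (by decide)]
    simp; ring
  have a2 : ∀ l : Fin 11, l = 9 ∨ l = 10 → IndepOf l (eta2 V) := by
    intro l hl
    have h4 : 4 ≤ l := by rcases hl with rfl | rfl <;> decide
    have hd : IndepOf l (Dx (eta1 V)) := by
      rcases hl with rfl | rfl
      · exact (a1 9 h4 (by decide)).Dx (a1 8 (by decide) (by decide))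
          fun j s => (dxVec_add_single j s).2.2.2.2.2.2.1
      · exact (a1 10 h4 (by decide)).Dx (a1 9 (by decide) (by decide))
          fun j s => (dxVec_add_single j s).2.2.2.2.2.2.2
    intro j s
    simp only [eta2]
    rw [hI 0 l h4, hI 1 l h4, hd]
    rcases hl with rfl | rfl <;> simp
  have b2 : ∀ (j : Jet), base j ∈ M → ∀ s : ℝ, eta2 V (j + s • Pi.single 8 1) =
      eta2 V j + s * (-2 * Dx (fun i => V (base i) 0) j) := by
    intro j hj s
    simp only [eta2]
    rw [hI 0 8 (by decide), hI 1 8 (by decide), (a1 8 (by decide) (by decide)).Dx_add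
      (fun j s => (dxVec_add_single j s).2.2.2.2.2.1),
      fderiv_single_of_affine (c1.differentiableAt_of_isOpen hO hj) (b1 j)]
    simp; ring
  have a3 : IndepOf 10 (eta3 V) := by
    have hd := (a2 10 (Or.inr rfl)).Dx (a2 9 (Or.inl rfl))
      fun j s => (dxVec_add_single j s).2.2.2.2.2.2.2
    intro j s
    simp only [eta3]
    rw [hI 0 10 (by decide), hI 1 10 (by decide), hd]
    simp
  have b3 : ∀ (j : Jet), base j ∈ M → ∀ s : ℝ, eta3 V (j + s • Pi.single 9 1) =
      eta3 V j + s * (-3 * Dx (fun i => V (base i) 0) j) := by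
    intro j hj s
    simp only [eta3]
    rw [hI 0 9 (by decide), hI 1 9 (by decide), (a2 9 (Or.inl rfl)).Dx_add
      (fun j s => (dxVec_add_single j s).2.2.2.2.2.2.1),
      fderiv_single_of_affine (c2.differentiableAt_of_isOpen hO hj) (b2 j hj)]
    simp; ring
  refine ⟨a1 10 (by decide) (by decide) j s, a2 10 (Or.inr rfl) j s, a3 j s, ?_⟩
  simp only [eta4]
  rw [hI 0 10 (by decide), hI 1 10 (by decide), a3.Dx_add
      (fun j s => (dxVec_add_single j s).2.2.2.2.2.2.2),
      fderiv_single_of_affine (c3.differentiableAt_of_isOpen hO hj) (b3 j hj)]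
  simp; ring

/-- The time component of a symmetry depends on the time only. -/
lemma IsSymmetry.isTimeOnly {F G : Jet3 → ℝ} {Ω : Set Jet3} (hE : IsEquation F G Ω)
    (hV : ContDiffOn ℝ ∞ V (base3 '' Ω)) (h : IsSymmetry F G Ω V) :
    IsTimeOnly (fun b => V b 0) (base3 '' Ω) := by
  have hM : IsOpen (base3 '' Ω) := isOpenMap_base3 _ hE.isOpen
  -- The criterion is compared at two jets on the equation that differ only in `u_txxx`; the
  -- difference is `4 F D_x τ`.
  have key : ∀ z ∈ Ω, fderiv ℝ (fun b => V b 0) (base3 z) ![0, 1, z 3] = 0 := by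
    intro z hz
    let j : Jet := ![z 0, z 1, z 2, z 3, z 4, z 5, 0, G z, 0, 0, 0]
    have hj : jet3 j = z := by ext i; fin_cases i <;> rfl
    have hjM : base j ∈ base3 '' Ω := ⟨z, hz, rfl⟩
    obtain ⟨e1, e2, e3, e4⟩ := eta4_add_single hM hV hjM 1
    have s1 := h j (by rwa [hj]) (by rw [hj]; simp [j])
    have hj' : jet3 (j + (1 : ℝ) • Pi.single 10 1) = z := by
      rw [← hj]; ext i; fin_cases i <;> simp [jet3]
    have s2 := h (j + (1 : ℝ) • Pi.single 10 1) (by rwa [hj']) (by rw [hj']; simp [j])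
    have hbj : base (j + (1 : ℝ) • Pi.single 10 1) = base j := by
      rw [← base3_jet3, ← base3_jet3, hj, hj']
    have eT : etaT V (j + (1 : ℝ) • Pi.single 10 1) = etaT V j := by
      simp only [etaT, Dt, hbj]
      simp
    have eP : prolong3 V (j + (1 : ℝ) • Pi.single 10 1) = prolong3 V j := by
      simp only [prolong3, hbj, e1, e2, e3]
    rw [eT, eP, e4, hj'] at s2
    rw [hj] at s1
    have e6 : (j + (1 : ℝ) • (Pi.single 10 1 : Jet)) 6 = j 6 := by simp
    rw [e6] at s2
    have h3 : F z * (4 * Dx (fun i => V (base i) 0) j) = 0 := by linarith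
    have h4 : Dx (fun i => V (base i) 0) j = 0 := by
      have := (mul_eq_zero.1 h3).resolve_left (hE.ne_zero z hz)
      linarith
    rwa [Dx_comp_base (f := fun b => V b 0)
      ((contDiffOn_component hV 0).differentiableAt_of_isOpen hM hjM)] at h4
  rintro _ ⟨z, hz, rfl⟩
  -- The relation `τ_x + u_x τ_u = 0` holds for an open set of values of `u_x` over the same base
  -- point, so two of them separate the two derivatives.
  have hline : ContinuousAt (fun s : ℝ => z + s • (Pi.single 3 1 : Jet3)) 0 := by fun_prop
  have hev : ∀ᶠ s : ℝ in 𝓝 0, z + s • (Pi.single 3 1 : Jet3) ∈ Ω :=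
    hline.eventually (p := fun y => y ∈ Ω) (by simpa using hE.isOpen.mem_nhds hz)
  obtain ⟨ε, hε, hball⟩ := Metric.eventually_nhds_iff.1 hev
  have hs : z + (ε / 2) • (Pi.single 3 1 : Jet3) ∈ Ω := hball (by
    rw [Real.dist_0_eq_abs, abs_of_pos (by positivity)]; linarith)
  have k1 := key z hz
  have k2 := key _ hs
  have hb : base3 (z + (ε / 2) • (Pi.single 3 1 : Jet3)) = base3 z := by
    ext i; fin_cases i <;> simp [base3]
  rw [hb] at k2
  set A := fderiv ℝ (fun b => V b 0) (base3 z)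
  have e : (![0, 1, (z + (ε / 2) • (Pi.single 3 1 : Jet3)) 3] : Base) =
      ![0, 1, z 3] + (ε / 2) • Pi.single 2 1 := by
    ext i; fin_cases i <;> simp
  rw [e, map_add, k1, zero_add, map_smul, smul_eq_mul] at k2
  have h2 : A (Pi.single 2 1) = 0 := (mul_eq_zero.1 k2).resolve_left (by positivity)
  refine ⟨?_, h2⟩
  have e' : (Pi.single 1 1 : Base) = ![0, 1, z 3] - z 3 • Pi.single 2 1 := by
    ext i; fin_cases i <;> simp
  rw [e', map_sub, k1, map_smul, h2]
  simp

end TimeComponent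

/-! ### Prolongation when the time component depends on time only -/

section Prolongation

/-- The coefficients `η, η^x, η^xx, …` of the prolongation of a vector field whose time component
depends on the time only. -/
noncomputable def reducedEta (V : Base → Base) : ℕ → Jet → ℝ
  | 0 => fun j => V (base j) 2
  | m + 1 => fun j =>
      -- For `m ≤ 3`, the range that enters `prolongation`, the index `m + 3` is that of the
      -- `x`-derivative of order `m + 1`.
      Dx (reducedEta V m) j - j (Fin.ofNat 11 (m + 3)) * Dx (fun i => V (base i) 1) j

/-- The prolongation of a vector field whose time component depends on the time only, without the
components in the directions of the mixed derivatives. -/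
noncomputable def prolongation (V : Base → Base) (j : Jet) : Jet :=
  ![V (base j) 0, V (base j) 1, V (base j) 2, reducedEta V 1 j, reducedEta V 2 j, reducedEta V 3 j,
    reducedEta V 4 j, etaT V j, 0, 0, 0]

variable {V : Base → Base} {M : Set Base}

lemma contDiffOn_reducedEta (hM : IsOpen M) (hV : ContDiffOn ℝ ∞ V M) (m : ℕ) :
    ContDiffOn ℝ ∞ (reducedEta V m) {j | base j ∈ M} := by
  have hO := isOpen_cylinder hM
  induction m with
  | zero => exact contDiffOn_lift (contDiffOn_component hV 2)
  | succ m ih =>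
    have h1 : ContDiffOn ℝ ∞ (Dx fun i => V (base i) 1) {j | base j ∈ M} :=
      contDiffOn_Dx hO (contDiffOn_lift (contDiffOn_component hV 1))
    have h2 : ContDiffOn ℝ ∞ (fun j : Jet => j (Fin.ofNat 11 (m + 3))) {j | base j ∈ M} := by
      fun_prop
    exact (contDiffOn_Dx hO ih).sub (h2.mul h1)

lemma IndepOf.sub {l : Fin 11} {f g : Jet → ℝ} (hf : IndepOf l f) (hg : IndepOf l g) :
    IndepOf l fun j => f j - g j := fun j s => by simp only [hf j s, hg j s]

lemma IndepOf.mul {l : Fin 11} {f g : Jet → ℝ} (hf : IndepOf l f) (hg : IndepOf l g) :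
    IndepOf l fun j => f j * g j := fun j s => by simp only [hf j s, hg j s]

lemma IndepOf.div {l : Fin 11} {f g : Jet → ℝ} (hf : IndepOf l f) (hg : IndepOf l g) :
    IndepOf l fun j => f j / g j := fun j s => by simp only [hf j s, hg j s]

lemma dependsUpTo_Dx_comp_base (f : Base → ℝ) : DependsUpTo 3 (Dx fun i => f (base i)) :=
  (dependsUpTo_comp_base f).Dx le_rfl rfl

lemma dependsUpTo_reducedEta (V : Base → Base) (m : ℕ) (hm : m + 2 < 11) :
    DependsUpTo ⟨m + 2, hm⟩ (reducedEta V m) := by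
  induction m with
  | zero => exact dependsUpTo_comp_base fun b => V b 2
  | succ m ih =>
    intro l hl
    have h1 : DependsUpTo ⟨m + 1 + 2, hm⟩ (Dx (reducedEta V m)) :=
      (ih (by omega)).Dx (by rw [Fin.le_def]; simp) rfl
    refine (h1 l hl).sub (IndepOf.mul ?_ ?_)
    · refine dependsUpTo_coord ?_ l hl
      rw [Fin.le_def]; simp [Fin.ofNat]; omega
    · refine dependsUpTo_Dx_comp_base (fun b => V b 1) l (lt_of_le_of_lt ?_ hl)
      rw [Fin.le_def]; simp

lemma contDiffOn_Dt (hM : IsOpen M) {f : Base → ℝ} (hf : ContDiffOn ℝ ∞ f M) :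
    ContDiffOn ℝ ∞ (Dt f) {j | base j ∈ M} := by
  refine ((hf.fderiv_infty hM).comp contDiff_base.contDiffOn fun _ hj => hj).clm_apply ?_
  refine (contDiff_pi.2 fun k => ?_).contDiffOn
  fin_cases k <;> simp <;> fun_prop

lemma contDiffOn_etaT (hM : IsOpen M) (hV : ContDiffOn ℝ ∞ V M) :
    ContDiffOn ℝ ∞ (etaT V) {j | base j ∈ M} := by
  have h := fun k => contDiffOn_Dt hM (contDiffOn_component hV k)
  have hc : ∀ k : Fin 11, ContDiffOn ℝ ∞ (fun j : Jet => j k) {j | base j ∈ M} := fun k => by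
    fun_prop
  exact ((h 2).sub ((hc 7).mul (h 0))).sub ((hc 3).mul (h 1))

lemma contDiffOn_prolongation (hM : IsOpen M) (hV : ContDiffOn ℝ ∞ V M) :
    ContDiffOn ℝ ∞ (prolongation V) {j | base j ∈ M} := by
  have h := fun k => contDiffOn_lift (contDiffOn_component hV k)
  have he := contDiffOn_reducedEta hM hV
  have h0 : ContDiffOn ℝ ∞ (fun _ : Jet => (0 : ℝ)) {j | base j ∈ M} := contDiffOn_const
  refine contDiffOn_pi.2 fun k => ?_
  fin_cases k
  exacts [h 0, h 1, h 2, he 1, he 2, he 3, he 4, contDiffOn_etaT hM hV, h0, h0, h0]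

lemma IsTimeOnly.Dx_eq_zero (hM : IsOpen M) {f : Base → ℝ} (hf : ContDiffOn ℝ ∞ f M)
    (h : IsTimeOnly f M) {j : Jet} (hj : base j ∈ M) : Dx (fun i => f (base i)) j = 0 := by
  rw [Dx_comp_base (hf.differentiableAt_of_isOpen hM hj), h.apply hj]
  simp

lemma eta_eq_reducedEta (hM : IsOpen M) (hV : ContDiffOn ℝ ∞ V M)
    (ht : IsTimeOnly (fun b => V b 0) M) {j : Jet} (hj : base j ∈ M) :
    eta1 V j = reducedEta V 1 j ∧ eta2 V j = reducedEta V 2 j ∧ eta3 V j = reducedEta V 3 j ∧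
      eta4 V j = reducedEta V 4 j := by
  have hO := isOpen_cylinder hM
  have h0 : ∀ j : Jet, base j ∈ M → Dx (fun i => V (base i) 0) j = 0 := fun j hj =>
    ht.Dx_eq_zero hM (contDiffOn_component hV 0) hj
  have h1 : EqOn (eta1 V) (reducedEta V 1) {j | base j ∈ M} := fun j hj => by
    simp only [eta1, h0 j hj, mul_zero, sub_zero]; rfl
  have h2 : EqOn (eta2 V) (reducedEta V 2) {j | base j ∈ M} := fun j hj => by
    simp only [eta2, h0 j hj, mul_zero, sub_zero, Dx_congr hO h1 hj]; rfl
  have h3 : EqOn (eta3 V) (reducedEta V 3) {j | base j ∈ M} := fun j hj => by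
    simp only [eta3, h0 j hj, mul_zero, sub_zero, Dx_congr hO h2 hj]; rfl
  refine ⟨h1 hj, h2 hj, h3 hj, ?_⟩
  simp only [eta4, h0 j hj, mul_zero, sub_zero, Dx_congr hO h3 hj]; rfl

/-- The difference of the two sides of the equation. -/
def defect (F G : Jet3 → ℝ) (j : Jet) : ℝ := j 7 - F (jet3 j) * j 6 - G (jet3 j)

lemma contDiffOn_defect {F G : Jet3 → ℝ} {Ω : Set Jet3} (hE : IsEquation F G Ω) :
    ContDiffOn ℝ ∞ (defect F G) {j | jet3 j ∈ Ω} := by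
  have hF : ContDiffOn ℝ ∞ (fun j => F (jet3 j)) {j | jet3 j ∈ Ω} :=
    hE.smooth_F.comp contDiff_jet3.contDiffOn fun _ hj => hj
  have hG : ContDiffOn ℝ ∞ (fun j => G (jet3 j)) {j | jet3 j ∈ Ω} :=
    hE.smooth_G.comp contDiff_jet3.contDiffOn fun _ hj => hj
  have hc : ∀ k : Fin 11, ContDiffOn ℝ ∞ (fun j : Jet => j k) {j | jet3 j ∈ Ω} := fun k => by
    fun_prop
  exact ((hc 7).sub (hF.mul (hc 6))).sub hG

lemma fderiv_defect {F G : Jet3 → ℝ} {Ω : Set Jet3} (hE : IsEquation F G Ω) {j : Jet}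
    (hj : jet3 j ∈ Ω) (v : Jet) :
    fderiv ℝ (defect F G) j v = v 7 - fderiv ℝ F (jet3 j) (jet3 v) * j 6 - F (jet3 j) * v 6
      - fderiv ℝ G (jet3 j) (jet3 v) := by
  have dF := hE.smooth_F.differentiableAt_of_isOpen hE.isOpen hj
  have dG := hE.smooth_G.differentiableAt_of_isOpen hE.isOpen hj
  have hO : IsOpen {j | jet3 j ∈ Ω} := hE.isOpen.preimage contDiff_jet3.continuous
  refine fderiv_apply_eq_of_hasDerivAt
    ((contDiffOn_defect hE).differentiableAt_of_isOpen hO hj) ?_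
  have hF : HasDerivAt (fun s : ℝ => F (jet3 (j + s • v))) (fderiv ℝ F (jet3 j) (jet3 v)) 0 := by
    simp only [jet3_add_smul]
    exact dF.hasFDerivAt.hasLineDerivAt (jet3 v)
  have hG : HasDerivAt (fun s : ℝ => G (jet3 (j + s • v))) (fderiv ℝ G (jet3 j) (jet3 v)) 0 := by
    simp only [jet3_add_smul]
    exact dG.hasFDerivAt.hasLineDerivAt (jet3 v)
  have hl : ∀ k : Fin 11, HasDerivAt (fun s : ℝ => (j + s • v) k) (v k) 0 := fun k => by
    simpa using ((hasDerivAt_id (0 : ℝ)).mul_const (v k)).const_add (j k)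
  have := ((hl 7).sub (hF.mul (hl 6))).sub hG
  refine this.congr_deriv ?_
  simp only [zero_smul, add_zero]
  ring

/-- With `D_x τ = 0` the mixed derivatives disappear from the prolongation coefficients. The
criterion becomes the vanishing of the derivative of one function along one vector field on jets,
and changes of variables reduce to the chain rule. -/
lemma isSymmetry_iff_fderiv_defect {F G : Jet3 → ℝ} {Ω : Set Jet3} (hE : IsEquation F G Ω)
    (hM : IsOpen M) (hΩ : base3 '' Ω ⊆ M) (hV : ContDiffOn ℝ ∞ V M)
    (ht : IsTimeOnly (fun b => V b 0) M) :
    IsSymmetry F G Ω V ↔ ∀ j, jet3 j ∈ Ω → defect F G j = 0 →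
      fderiv ℝ (defect F G) j (prolongation V j) = 0 := by
  refine forall_congr' fun j => forall_congr' fun hj => ?_
  have hb : base j ∈ M := hΩ ⟨jet3 j, hj, base3_jet3 j⟩
  obtain ⟨e1, e2, e3, e4⟩ := eta_eq_reducedEta hM hV ht hb
  have e : prolong3 V j = jet3 (prolongation V j) := by
    simp only [prolong3, e1, e2, e3]
    ext k; fin_cases k <;> rfl
  rw [fderiv_defect hE hj, e, e4]
  refine imp_congr ?_ ?_
  · rw [defect, sub_sub, sub_eq_zero]
  · exact Iff.of_eq (by simp only [prolongation]; congr 1)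

lemma prolongation_smul_add {V₁ V₂ : Base → Base} (hM : IsOpen M)
    (h₁ : ContDiffOn ℝ ∞ V₁ M) (h₂ : ContDiffOn ℝ ∞ V₂ M) (a c : ℝ) {j : Jet} (hj : base j ∈ M) :
    prolongation (fun b => a • V₁ b + c • V₂ b) j =
      a • prolongation V₁ j + c • prolongation V₂ j := by
  have hO := isOpen_cylinder hM
  have hD : ∀ {f g : Jet → ℝ}, ContDiffOn ℝ ∞ f {j | base j ∈ M} →
      ContDiffOn ℝ ∞ g {j | base j ∈ M} → ∀ j : Jet, base j ∈ M →
      Dx (fun i => a * f i + c * g i) j = a * Dx f j + c * Dx g j := by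
    intro f g hf hg j hj
    have df := hf.differentiableAt_of_isOpen hO hj
    have dg := hg.differentiableAt_of_isOpen hO hj
    simp only [Dx_eq]
    rw [fderiv_fun_add (df.const_mul a) (dg.const_mul c), fderiv_const_mul df, fderiv_const_mul dg]
    simp
  have hDt : ∀ k, Dt (fun b => a * V₁ b k + c * V₂ b k) j =
      a * Dt (fun b => V₁ b k) j + c * Dt (fun b => V₂ b k) j := by
    intro k
    have df := (contDiffOn_component h₁ k).differentiableAt_of_isOpen hM hj
    have dg := (contDiffOn_component h₂ k).differentiableAt_of_isOpen hM hj
    simp only [Dt]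
    rw [fderiv_fun_add (df.const_mul a) (dg.const_mul c), fderiv_const_mul df, fderiv_const_mul dg]
    simp
  have hr : ∀ m, EqOn (reducedEta (fun b => a • V₁ b + c • V₂ b) m)
      (fun j => a * reducedEta V₁ m j + c * reducedEta V₂ m j) {j | base j ∈ M} := by
    intro m
    induction m with
    | zero => intro j _; simp [reducedEta]
    | succ m ih =>
      intro j hj
      have e1 := hD (contDiffOn_lift (contDiffOn_component h₁ 1))
        (contDiffOn_lift (contDiffOn_component h₂ 1)) j hj
      simp only [reducedEta]
      rw [Dx_congr hO ih hj, hD (contDiffOn_reducedEta hM h₁ m) (contDiffOn_reducedEta hM h₂ m) j hj]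
      simp only [Pi.add_apply, Pi.smul_apply, smul_eq_mul, e1]
      ring
  ext k
  have hr' := fun m => hr m hj
  fin_cases k
  · simp [prolongation]
  · simp [prolongation]
  · simp [prolongation]
  · exact hr' 1
  · exact hr' 2
  · exact hr' 3
  · exact hr' 4
  · change etaT _ j = a * etaT V₁ j + c * etaT V₂ j
    simp only [etaT, Pi.add_apply, Pi.smul_apply, smul_eq_mul, hDt]
    ring
  · simp [prolongation]
  · simp [prolongation]
  · simp [prolongation]

/-- The prolongation commutes with the total derivative up to the factor `D_x ξ`. -/
lemma fderiv_Dx_prolongation (hM : IsOpen M) (hV : ContDiffOn ℝ ∞ V M)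
    (ht : IsTimeOnly (fun b => V b 0) M) {O : Set Jet} (hO : IsOpen O) (hOM : ∀ j ∈ O, base j ∈ M)
    {f : Jet → ℝ} (hf : ContDiffOn ℝ ∞ f O) (hd : DependsUpTo 5 f) {j : Jet} (hj : j ∈ O) :
    fderiv ℝ (Dx f) j (prolongation V j) =
      Dx (fun i => fderiv ℝ f i (prolongation V i)) j
        - Dx (fun i => V (base i) 1) j * Dx f j := by
  have hjM := hOM j hj
  have dP := (contDiffOn_prolongation hM hV).differentiableAt_of_isOpen (isOpen_cylinder hM) hjM
  have dX : DifferentiableAt ℝ dxVec j := contDiff_dxVec.differentiable (by simp) j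
  have dd := (hf.fderiv_infty hO).differentiableAt_of_isOpen hO hj
  have hs : IsSymmSndFDerivAt ℝ f j :=
    (hf.contDiffAt (hO.mem_nhds hj)).isSymmSndFDerivAt (by simp; exact WithTop.coe_le_coe.2 le_top)
  have e1 : fderiv ℝ (Dx f) j (prolongation V j) =
      fderiv ℝ f j (fderiv ℝ dxVec j (prolongation V j)) +
        fderiv ℝ (fderiv ℝ f) j (prolongation V j) (dxVec j) := by
    change fderiv ℝ (fun i => fderiv ℝ f i (dxVec i)) j _ = _
    rw [fderiv_clm_apply dd dX]; rfl
  have e2 : Dx (fun i => fderiv ℝ f i (prolongation V i)) j =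
      fderiv ℝ f j (fderiv ℝ (prolongation V) j (dxVec j)) +
        fderiv ℝ (fderiv ℝ f) j (dxVec j) (prolongation V j) := by
    rw [Dx_eq, fderiv_clm_apply dd dP]; rfl
  -- The second derivatives of `f` cancel by symmetry, which leaves the commutator of the two
  -- directions. It has the required form only in the coordinates up to `u_xxx`, because `u_xxxxx`
  -- and the mixed derivatives have been truncated; this suffices for `f`.
  have e3 : fderiv ℝ f j (fderiv ℝ (prolongation V) j (dxVec j)) =
      fderiv ℝ f j (fderiv ℝ dxVec j (prolongation V j)
        + Dx (fun i => V (base i) 1) j • dxVec j) := by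
    refine hd.fderiv_congr fun l hl => ?_
    have eP : ∀ v, fderiv ℝ (prolongation V) j v l = fderiv ℝ (fun i => prolongation V i l) j v :=
      fun v => by rw [fderiv_pi (fun k => (differentiableAt_pi.1 dP k))]; rfl
    have eX : ∀ v, fderiv ℝ dxVec j v l = fderiv ℝ (fun i => dxVec i l) j v :=
      fun v => by rw [fderiv_pi (fun k => (differentiableAt_pi.1 dX k))]; rfl
    rw [Pi.add_apply, Pi.smul_apply, eP, eX, smul_eq_mul]
    have h0 := ht.Dx_eq_zero hM (contDiffOn_component hV 0) hjM
    have hr : ∀ m : ℕ, Dx (reducedEta V m) j = reducedEta V (m + 1) j +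
        Dx (fun i => V (base i) 1) j * j (Fin.ofNat 11 (m + 3)) := fun m => by
      simp only [reducedEta]; ring
    have hc : ∀ k : Fin 11, fderiv ℝ (fun i : Jet => i k) j (prolongation V j) = prolongation V j k :=
      fun k => fderiv_coord k j _
    fin_cases l
    · exact h0.trans (by simp [dxVec])
    · simp [dxVec]; rfl
    · exact (hr 0).trans (congrArg (· + _) (hc 3).symm)
    · exact (hr 1).trans (congrArg (· + _) (hc 4).symm)
    · exact (hr 2).trans (congrArg (· + _) (hc 5).symm)
    · exact (hr 3).trans (congrArg (· + _) (hc 6).symm)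
    all_goals exact absurd hl (by decide)
  rw [e1, e2, e3, map_add, map_smul, hs (prolongation V j) (dxVec j), smul_eq_mul, ← Dx_eq]
  ring

/-- The prolongation commutes with the total time derivative up to terms in `D_t τ` and
`D_t ξ`. -/
lemma fderiv_Dt_prolongation (hM : IsOpen M) (hV : ContDiffOn ℝ ∞ V M)
    {f : Base → ℝ} (hf : ContDiffOn ℝ ∞ f M) {j : Jet} (hj : base j ∈ M) :
    fderiv ℝ (Dt f) j (prolongation V j) =
      Dt (fun b => fderiv ℝ f b (V b)) j - Dt (fun b => V b 0) j * Dt f j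
        - Dt (fun b => V b 1) j * Dx (fun i => f (base i)) j := by
  have dV := hV.differentiableAt_of_isOpen hM hj
  have dd := (hf.fderiv_infty hM).differentiableAt_of_isOpen hM hj
  have hs : IsSymmSndFDerivAt ℝ f (base j) :=
    (hf.contDiffAt (hM.mem_nhds hj)).isSymmSndFDerivAt (by simp; exact WithTop.coe_le_coe.2 le_top)
  let w : Jet → Base := fun i => ![1, 0, i 7]
  have dw : DifferentiableAt ℝ w j := by
    refine differentiableAt_pi.2 fun k => ?_
    fin_cases k <;> simp [w] <;> fun_prop
  have db : DifferentiableAt ℝ base j := contDiff_base.differentiable (by simp) j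
  have hfb : fderiv ℝ base j (prolongation V j) = V (base j) := by
    refine fderiv_apply_eq_of_hasDerivAt db ?_
    simp only [base_add_smul]
    have : base (prolongation V j) = V (base j) := by ext k; fin_cases k <;> rfl
    rw [this]
    simpa using ((hasDerivAt_id (0 : ℝ)).smul_const (V (base j))).const_add (base j)
  have hfw : fderiv ℝ w j (prolongation V j) = ![0, 0, etaT V j] := by
    rw [fderiv_pi (fun k => (differentiableAt_pi.1 dw k))]
    ext k
    fin_cases k
    · simp [w]
    · simp [w]
    · exact fderiv_coord 7 j _
  have e1 : fderiv ℝ (Dt f) j (prolongation V j) =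
      fderiv ℝ f (base j) ![0, 0, etaT V j] +
        fderiv ℝ (fderiv ℝ f) (base j) (V (base j)) (w j) := by
    change fderiv ℝ (fun i => (fderiv ℝ f ∘ base) i (w i)) j _ = _
    rw [fderiv_clm_apply (dd.comp j db) dw, ← hfw, ← hfb]
    rw [fderiv_comp j dd db]; rfl
  have e2 : Dt (fun b => fderiv ℝ f b (V b)) j =
      fderiv ℝ f (base j) (fderiv ℝ V (base j) (w j)) +
        fderiv ℝ (fderiv ℝ f) (base j) (w j) (V (base j)) := by
    rw [Dt, fderiv_clm_apply dd dV]; rfl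
  have hx : Dx (fun i => f (base i)) j = fderiv ℝ f (base j) ![0, 1, j 3] :=
    Dx_comp_base (hf.differentiableAt_of_isOpen hM hj)
  -- In the last component this is the definition of `etaT` solved for `D_t η`.
  have e3 : fderiv ℝ V (base j) (w j) = ![0, 0, etaT V j] + Dt (fun b => V b 0) j • w j
      + Dt (fun b => V b 1) j • ![0, 1, j 3] := by
    rw [fderiv_pi (fun k => (differentiableAt_pi.1 dV k))]
    ext k
    fin_cases k
    · simp [w, Dt]
    · simp [w, Dt]
    · simp [w, etaT, Dt]; ring
  rw [e1, e2, e3, map_add, map_add, map_smul, map_smul, hs (V (base j)) (w j), hx]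
  simp only [smul_eq_mul, Dt, w]
  ring

end Prolongation

/-! ### The action of transformations on jets -/

section JetMap

/-- The derivatives `u', u'_x', u'_x'x', …` of the transformed function. -/
noncomputable def newDeriv (φ : Base → Base) : ℕ → Jet → ℝ
  | 0 => fun j => φ (base j) 2
  | m + 1 => fun j => Dx (newDeriv φ m) j / DxX φ j

/-- The action of a transformation on jets, with the mixed derivatives left alone. -/
noncomputable def jetMap (φ : Base → Base) (j : Jet) : Jet :=
  ![φ (base j) 0, φ (base j) 1, φ (base j) 2, newDeriv φ 1 j, newDeriv φ 2 j, newDeriv φ 3 j,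
    newDeriv φ 4 j, newUt φ j, j 8, j 9, j 10]

/-- The jets over `W` at which `D_x X` does not vanish. -/
def regularJets (φ : Base → Base) (W : Set Base) : Set Jet := {j | base j ∈ W ∧ DxX φ j ≠ 0}

variable {φ : Base → Base} {W : Set Base}

lemma base_jetMap (j : Jet) : base (jetMap φ j) = φ (base j) := by
  ext k; fin_cases k <;> rfl

lemma jet3_jetMap (j : Jet) : jet3 (jetMap φ j) = newJet3 φ j := by
  ext k; fin_cases k <;> rfl

lemma IsEquivalence.mono {W' : Set Base} (h : IsEquivalence φ W) (hW : W' ⊆ W) (ho : IsOpen W') :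
    IsEquivalence φ W' :=
  ⟨ho, h.smooth.mono hW, h.injOn.mono hW, fun b hb => h.det_ne_zero b (hW hb),
    h.time.imp fun _ hT b hb => hT b (hW hb)⟩

lemma IsEquivalence.isTimeOnly (h : IsEquivalence φ W) : IsTimeOnly (fun b => φ b 0) W := by
  obtain ⟨T, hT⟩ := h.time
  have key : ∀ b ∈ W, ∀ k : Fin 3, k ≠ 0 → fderiv ℝ (fun b => φ b 0) b (Pi.single k 1) = 0 := by
    intro b hb k hk
    refine fderiv_apply_eq_of_hasDerivAt
      ((contDiffOn_component h.smooth 0).differentiableAt_of_isOpen h.isOpen hb) ?_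
    have hline : ContinuousAt (fun s : ℝ => b + s • (Pi.single k 1 : Base)) 0 := by fun_prop
    have hev : ∀ᶠ s : ℝ in 𝓝 0, b + s • (Pi.single k 1 : Base) ∈ W :=
      hline.eventually (p := fun y => y ∈ W) (by simpa using h.isOpen.mem_nhds hb)
    refine (hasDerivAt_const (0 : ℝ) (T (b 0))).congr_of_eventuallyEq ?_
    filter_upwards [hev] with s hs
    rw [hT _ hs]
    simp [hk.symm]
  exact fun b hb => ⟨key b hb 1 (by decide), key b hb 2 (by decide)⟩

lemma IsEquivalence.fderiv_apply (h : IsEquivalence φ W) {b : Base} (hb : b ∈ W) (v : Base)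
    (k : Fin 3) : fderiv ℝ φ b v k = fderiv ℝ (fun b => φ b k) b v := by
  have d := h.smooth.differentiableAt_of_isOpen h.isOpen hb
  rw [fderiv_pi (fun k => (differentiableAt_pi.1 d k))]; rfl

lemma IsEquivalence.eq_zero (h : IsEquivalence φ W) {b : Base} (hb : b ∈ W) {v : Base}
    (hv : ∀ k, fderiv ℝ (fun b => φ b k) b v = 0) : v = 0 :=
  eq_zero_of_det_ne_zero (h.det_ne_zero b hb) (by ext k; rw [h.fderiv_apply hb]; exact hv k)

/-- The time row of the Jacobian matrix has no entries besides this one, so its vanishing would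
contradict surjectivity. -/
lemma IsEquivalence.fderiv_time (h : IsEquivalence φ W) {b : Base} (hb : b ∈ W) :
    fderiv ℝ (fun b => φ b 0) b (Pi.single 0 1) ≠ 0 := by
  intro h0
  have h1 := h.isTimeOnly.apply hb
  have key : ∀ v : Base, fderiv ℝ φ b v 0 = 0 := fun v => by
    rw [h.fderiv_apply hb, h1, h0, mul_zero]
  have hsurj : Function.Surjective (fderiv ℝ φ b) := by
    have hinj : Function.Injective (fderiv ℝ φ b : Base →ₗ[ℝ] Base) := by
      rw [injective_iff_map_eq_zero]
      exact fun v hv => eq_zero_of_det_ne_zero (h.det_ne_zero b hb) hv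
    exact LinearMap.injective_iff_surjective.1 hinj
  obtain ⟨v, hv⟩ := hsurj (Pi.single 0 1)
  have := key v
  rw [hv] at this
  simp at this

lemma IsEquivalence.Dt_time (h : IsEquivalence φ W) {j : Jet} (hj : base j ∈ W) :
    Dt (fun b => φ b 0) j = fderiv ℝ (fun b => φ b 0) (base j) (Pi.single 0 1) := by
  rw [Dt, h.isTimeOnly.apply hj]; simp

lemma IsEquivalence.contDiffOn_DxX (h : IsEquivalence φ W) :
    ContDiffOn ℝ ∞ (DxX φ) {j | base j ∈ W} :=
  contDiffOn_Dx (isOpen_cylinder h.isOpen) (contDiffOn_lift (contDiffOn_component h.smooth 1))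

lemma IsEquivalence.isOpen_regularJets (h : IsEquivalence φ W) : IsOpen (regularJets φ W) :=
  h.contDiffOn_DxX.continuousOn.isOpen_inter_preimage (isOpen_cylinder h.isOpen)
    isOpen_compl_singleton

lemma regularJets_subset : regularJets φ W ⊆ {j | base j ∈ W} := fun _ h => h.1

lemma IsEquivalence.contDiffOn_newDeriv (h : IsEquivalence φ W) (m : ℕ) :
    ContDiffOn ℝ ∞ (newDeriv φ m) (regularJets φ W) := by
  induction m with
  | zero =>
    exact (contDiffOn_lift (contDiffOn_component h.smooth 2)).mono regularJets_subset
  | succ m ih =>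
    exact (contDiffOn_Dx h.isOpen_regularJets ih).div (h.contDiffOn_DxX.mono regularJets_subset)
      fun j hj => hj.2

lemma IsEquivalence.contDiffOn_newUt (h : IsEquivalence φ W) :
    ContDiffOn ℝ ∞ (newUt φ) (regularJets φ W) := by
  have hD := fun k => (contDiffOn_Dt h.isOpen (contDiffOn_component h.smooth k)).mono
    (regularJets_subset (φ := φ))
  exact ((hD 2).sub ((h.contDiffOn_newDeriv 1).mul (hD 1))).div (hD 0) fun j hj => by
    rw [h.Dt_time hj.1]; exact h.fderiv_time hj.1

lemma IsEquivalence.contDiffOn_jetMap (h : IsEquivalence φ W) :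
    ContDiffOn ℝ ∞ (jetMap φ) (regularJets φ W) := by
  have hb := fun k => (contDiffOn_lift (contDiffOn_component h.smooth k)).mono
    (regularJets_subset (φ := φ))
  have hc : ∀ k : Fin 11, ContDiffOn ℝ ∞ (fun j : Jet => j k) (regularJets φ W) := fun k => by
    fun_prop
  have hn := h.contDiffOn_newDeriv
  refine contDiffOn_pi.2 fun k => ?_
  fin_cases k
  exacts [hb 0, hb 1, hb 2, hn 1, hn 2, hn 3, hn 4, h.contDiffOn_newUt, hc 8, hc 9, hc 10]

lemma dependsUpTo_DxX (φ : Base → Base) : DependsUpTo 3 (DxX φ) :=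
  dependsUpTo_Dx_comp_base fun b => φ b 1

lemma dependsUpTo_newDeriv (φ : Base → Base) (m : ℕ) (hm : m + 2 < 11) :
    DependsUpTo ⟨m + 2, hm⟩ (newDeriv φ m) := by
  induction m with
  | zero => exact dependsUpTo_comp_base fun b => φ b 2
  | succ m ih =>
    intro l hl
    have h1 : DependsUpTo ⟨m + 1 + 2, hm⟩ (Dx (newDeriv φ m)) :=
      (ih (by omega)).Dx (by rw [Fin.le_def]; simp) rfl
    refine (h1 l hl).div (dependsUpTo_DxX φ l (lt_of_le_of_lt ?_ hl))
    rw [Fin.le_def]; simp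

lemma Dx_newDeriv {j : Jet} (hj : DxX φ j ≠ 0) (m : ℕ) :
    Dx (newDeriv φ m) j = DxX φ j * newDeriv φ (m + 1) j := by
  simp only [newDeriv]; field_simp

/-- Chain rule for the total derivative `D_x`. -/
lemma IsEquivalence.Dx_comp_jetMap (h : IsEquivalence φ W) {j : Jet} (hj : j ∈ regularJets φ W)
    {f : Jet → ℝ} (hf : DifferentiableAt ℝ f (jetMap φ j)) (hd : DependsUpTo 5 f) :
    Dx (fun i => f (jetMap φ i)) j = DxX φ j * Dx f (jetMap φ j) := by
  have dΦ := h.contDiffOn_jetMap.differentiableAt_of_isOpen h.isOpen_regularJets hj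
  -- The recursion for `newDeriv` says that the action on jets sends the direction of `D_x` to `D_x
  -- X` times the new one, in the coordinates up to `u_xxx`.
  have e : fderiv ℝ f (jetMap φ j) (fderiv ℝ (jetMap φ) j (dxVec j)) =
      fderiv ℝ f (jetMap φ j) (DxX φ j • dxVec (jetMap φ j)) := by
    refine hd.fderiv_congr fun l hl => ?_
    have eP : fderiv ℝ (jetMap φ) j (dxVec j) l = Dx (fun i => jetMap φ i l) j := by
      rw [fderiv_pi (fun k => (differentiableAt_pi.1 dΦ k))]; rfl
    rw [eP, Pi.smul_apply, smul_eq_mul]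
    have h0 := h.isTimeOnly.Dx_eq_zero h.isOpen (contDiffOn_component h.smooth 0) hj.1
    have hn := Dx_newDeriv hj.2
    fin_cases l
    · exact h0.trans (by simp [dxVec])
    · exact (mul_one (DxX φ j)).symm
    · exact hn 0
    · exact hn 1
    · exact hn 2
    · exact hn 3
    all_goals exact absurd hl (by decide)
  have hc := fderiv_comp j hf dΦ
  rw [Dx_eq]
  change fderiv ℝ (f ∘ jetMap φ) j (dxVec j) = _
  rw [hc, ContinuousLinearMap.comp_apply, e, map_smul]; rfl

lemma IsEquivalence.newUt_mul (h : IsEquivalence φ W) {j : Jet} (hj : base j ∈ W) :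
    newUt φ j * Dt (fun b => φ b 0) j =
      Dt (fun b => φ b 2) j - newDeriv φ 1 j * Dt (fun b => φ b 1) j :=
  div_mul_cancel₀ _ (by rw [h.Dt_time hj]; exact h.fderiv_time hj)

/-- Chain rule for the total derivative `D_t`. -/
lemma IsEquivalence.Dt_comp (h : IsEquivalence φ W) {j : Jet} (hj : base j ∈ W)
    {f : Base → ℝ} (hf : DifferentiableAt ℝ f (φ (base j))) :
    Dt (fun b => f (φ b)) j = Dt (fun b => φ b 0) j * Dt f (jetMap φ j)
      + Dt (fun b => φ b 1) j * Dx (fun i => f (base i)) (jetMap φ j) := by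
  have d := h.smooth.differentiableAt_of_isOpen h.isOpen hj
  have hx : Dx (fun i => f (base i)) (jetMap φ j) =
      fderiv ℝ f (φ (base j)) ![0, 1, newDeriv φ 1 j] := by
    rw [Dx_comp_base (by rwa [base_jetMap]), base_jetMap]; rfl
  have e : fderiv ℝ φ (base j) ![1, 0, j 7] = Dt (fun b => φ b 0) j • ![1, 0, newUt φ j]
      + Dt (fun b => φ b 1) j • ![0, 1, newDeriv φ 1 j] := by
    have := h.newUt_mul hj
    ext k
    rw [h.fderiv_apply hj]
    fin_cases k
    · simp [Dt]
    · simp [Dt]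
    · change Dt (fun b => φ b 2) j = Dt (fun b => φ b 0) j * newUt φ j
        + Dt (fun b => φ b 1) j * newDeriv φ 1 j
      linarith
  have ht : Dt f (jetMap φ j) = fderiv ℝ f (φ (base j)) ![1, 0, newUt φ j] := by
    rw [Dt, base_jetMap]; rfl
  change fderiv ℝ (f ∘ φ) (base j) ![1, 0, j 7] = _
  rw [fderiv_comp _ hf d, ContinuousLinearMap.comp_apply, e, map_add, map_smul, map_smul, hx, ht]
  rfl

variable {V V' : Base → Base} {M' : Set Base}

/-- The prolongations of two vector fields related by a transformation are related by its action on
jets. -/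
lemma IsEquivalence.fderiv_newDeriv_prolongation (h : IsEquivalence φ W) (hV : ContDiffOn ℝ ∞ V W)
    (ht : IsTimeOnly (fun b => V b 0) W) (hM' : IsOpen M') (hV' : ContDiffOn ℝ ∞ V' M')
    (hφM : MapsTo φ W M') (hpush : ∀ b ∈ W, fderiv ℝ φ b (V b) = V' (φ b)) (m : ℕ) (hm : m ≤ 4)
    {j : Jet} (hj : j ∈ regularJets φ W) :
    fderiv ℝ (newDeriv φ m) j (prolongation V j) = reducedEta V' m (jetMap φ j) := by
  have hO := h.isOpen_regularJets
  have hpc : ∀ k, ∀ b ∈ W, fderiv ℝ (fun b => φ b k) b (V b) = V' (φ b) k := fun k b hb => by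
    rw [← h.fderiv_apply hb, hpush b hb]
  have hb : ∀ k, ∀ j : Jet, base j ∈ W →
      fderiv ℝ (fun i => φ (base i) k) j (prolongation V j) = V' (φ (base j)) k := by
    intro k j hj
    rw [fderiv_comp_base (f := fun b => φ b k)
      ((contDiffOn_component h.smooth k).differentiableAt_of_isOpen h.isOpen hj), ← hpc k _ hj]
    congr 1
    ext k; fin_cases k <;> rfl
  induction m generalizing j with
  | zero => exact (hb 2 j hj.1).trans (congrArg (fun b => V' b 2) (base_jetMap j).symm)
  | succ m ih =>
    have hcy := isOpen_cylinder h.isOpen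
    have dm1 := (h.contDiffOn_newDeriv (m + 1)).differentiableAt_of_isOpen hO hj
    have dX := h.contDiffOn_DxX.differentiableAt_of_isOpen hcy hj.1
    have hd : DependsUpTo 5 (newDeriv φ m) := (dependsUpTo_newDeriv φ m (by omega)).mono (by
      rw [Fin.le_def]; simp; omega)
    have hd' : DependsUpTo 5 (reducedEta V' m) :=
      (dependsUpTo_reducedEta V' m (by omega)).mono (by rw [Fin.le_def]; simp; omega)
    have hΦM : base (jetMap φ j) ∈ M' := by rw [base_jetMap]; exact hφM hj.1
    have hcy' := isOpen_cylinder hM'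
    -- The inductive step differentiates `D_x u'_m = D_x X · u'_{m+1}` along the prolongation.
    -- Commuting with `D_x` and the chain rule for `jetMap` turn the known terms into `D_x X` times
    -- new total derivatives, and the factor `D_x X` cancels.
    have e1 : fderiv ℝ (Dx (newDeriv φ m)) j (prolongation V j) =
        fderiv ℝ (DxX φ) j (prolongation V j) * newDeriv φ (m + 1) j
          + DxX φ j * fderiv ℝ (newDeriv φ (m + 1)) j (prolongation V j) := by
      have : Dx (newDeriv φ m) =ᶠ[𝓝 j] fun i => DxX φ i * newDeriv φ (m + 1) i := by
        filter_upwards [hO.mem_nhds hj] with i hi using Dx_newDeriv hi.2 m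
      rw [this.fderiv_eq, fderiv_fun_mul dX dm1]
      simp; ring
    have e2 := fderiv_Dx_prolongation h.isOpen hV ht hO regularJets_subset
      (h.contDiffOn_newDeriv m) hd hj
    rw [Dx_congr hO (fun i hi => ih (by omega) hi) hj, h.Dx_comp_jetMap hj
      ((contDiffOn_reducedEta hM' hV' m).differentiableAt_of_isOpen hcy' hΦM) hd',
      Dx_newDeriv hj.2] at e2
    have e3 := fderiv_Dx_prolongation h.isOpen hV ht hcy (fun _ h => h)
      (contDiffOn_lift (contDiffOn_component h.smooth 1))
      ((dependsUpTo_comp_base fun b => φ b 1).mono (by decide)) hj.1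
    rw [Dx_congr hcy (g := fun i => V' (base (jetMap φ i)) 1)
        (fun i hi => (hb 1 i hi).trans (congrArg (fun b => V' b 1) (base_jetMap i).symm)) hj.1,
      h.Dx_comp_jetMap (f := fun i => V' (base i) 1) hj
        ((contDiffOn_lift (contDiffOn_component hV' 1)).differentiableAt_of_isOpen hcy' hΦM)
        ((dependsUpTo_comp_base fun b => V' b 1).mono (by decide))] at e3
    change fderiv ℝ (DxX φ) j _ = _ - _ * DxX φ j at e3
    rw [e3] at e1
    have hX := hj.2
    have hnd : jetMap φ j (Fin.ofNat 11 (m + 3)) = newDeriv φ (m + 1) j := by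
      have : m ≤ 3 := by omega
      interval_cases m <;> rfl
    rw [e2] at e1
    simp only [reducedEta]
    rw [hnd]
    refine mul_left_cancel₀ hX ?_
    linear_combination -e1

/-- The relation `u'_t' D_t T = D_t U - u'_x' D_t X` is differentiated along the prolongation, and
each `D_t` is commuted past it. Terms in `D_t ξ` cancel because `D_x U = u'_x' D_x X` and `D_x T =
0`; the terms in `D_t τ` recombine to the original relation. -/
lemma IsEquivalence.fderiv_newUt_prolongation (h : IsEquivalence φ W) (hV : ContDiffOn ℝ ∞ V W)
    (ht : IsTimeOnly (fun b => V b 0) W) (hM' : IsOpen M') (hV' : ContDiffOn ℝ ∞ V' M')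
    (ht' : IsTimeOnly (fun b => V' b 0) M')
    (hφM : MapsTo φ W M') (hpush : ∀ b ∈ W, fderiv ℝ φ b (V b) = V' (φ b))
    {j : Jet} (hj : j ∈ regularJets φ W) :
    fderiv ℝ (newUt φ) j (prolongation V j) = etaT V' (jetMap φ j) := by
  have hO := h.isOpen_regularJets
  have hcy := isOpen_cylinder h.isOpen
  have hpc : ∀ k, ∀ b ∈ W, fderiv ℝ (fun b => φ b k) b (V b) = V' (φ b) k := fun k b hb => by
    rw [← h.fderiv_apply hb, hpush b hb]
  have hc := fun k => contDiffOn_component h.smooth k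
  have dD : ∀ k, DifferentiableAt ℝ (Dt fun b => φ b k) j := fun k =>
    (contDiffOn_Dt h.isOpen (hc k)).differentiableAt_of_isOpen hcy hj.1
  have dn := (h.contDiffOn_newDeriv 1).differentiableAt_of_isOpen hO hj
  have dt := h.contDiffOn_newUt.differentiableAt_of_isOpen hO hj
  have e1 : fderiv ℝ (newUt φ) j (prolongation V j) * Dt (fun b => φ b 0) j
        + newUt φ j * fderiv ℝ (Dt fun b => φ b 0) j (prolongation V j) =
      fderiv ℝ (Dt fun b => φ b 2) j (prolongation V j)
        - (fderiv ℝ (newDeriv φ 1) j (prolongation V j) * Dt (fun b => φ b 1) j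
          + newDeriv φ 1 j * fderiv ℝ (Dt fun b => φ b 1) j (prolongation V j)) := by
    have : (fun i => newUt φ i * Dt (fun b => φ b 0) i) =ᶠ[𝓝 j]
        fun i => Dt (fun b => φ b 2) i - newDeriv φ 1 i * Dt (fun b => φ b 1) i := by
      filter_upwards [hO.mem_nhds hj] with i hi using h.newUt_mul hi.1
    have h2 := congrArg (fun A : Jet →L[ℝ] ℝ => A (prolongation V j)) this.fderiv_eq
    rw [fderiv_fun_mul dt (dD 0), fderiv_fun_sub (dD 2) (dn.fun_mul (dD 1)),
      fderiv_fun_mul dn (dD 1)] at h2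
    simp at h2
    linarith
  have e2 : ∀ k, fderiv ℝ (Dt fun b => φ b k) j (prolongation V j) =
      Dt (fun b => φ b 0) j * Dt (fun b => V' b k) (jetMap φ j)
      + Dt (fun b => φ b 1) j * Dx (fun i => V' (base i) k) (jetMap φ j)
      - Dt (fun b => V b 0) j * Dt (fun b => φ b k) j
        - Dt (fun b => V b 1) j * Dx (fun i => φ (base i) k) j := by
    intro k
    rw [fderiv_Dt_prolongation h.isOpen hV (hc k) hj.1, ← h.Dt_comp hj.1 (f := fun b => V' b k)
      ((contDiffOn_component hV' k).differentiableAt_of_isOpen hM' (hφM hj.1))]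
    congr 2
    simp only [Dt]
    rw [((show EqOn (fun b => fderiv ℝ (fun b => φ b k) b (V b)) (fun b => V' (φ b) k) W from
      hpc k).eventuallyEq_of_mem (h.isOpen.mem_nhds hj.1)).fderiv_eq]
  have e3 := h.fderiv_newDeriv_prolongation hV ht hM' hV' hφM hpush 1 (by norm_num) hj
  have e4 : reducedEta V' 1 (jetMap φ j) = Dx (fun i => V' (base i) 2) (jetMap φ j)
    - newDeriv φ 1 j * Dx (fun i => V' (base i) 1) (jetMap φ j) := rfl
  have hΦM : base (jetMap φ j) ∈ M' := by rw [base_jetMap]; exact hφM hj.1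
  have h0 : Dx (fun i => V' (base i) 0) (jetMap φ j) = 0 :=
    ht'.Dx_eq_zero hM' (contDiffOn_component hV' 0) hΦM
  have h0' : Dx (fun i => φ (base i) 0) j = 0 :=
    h.isTimeOnly.Dx_eq_zero h.isOpen (hc 0) hj.1
  have e5 : Dx (fun i => φ (base i) 2) j = Dx (fun i => φ (base i) 1) j * newDeriv φ 1 j :=
    Dx_newDeriv hj.2 0
  have e6 := h.newUt_mul hj.1
  have hT : Dt (fun b => φ b 0) j ≠ 0 := by rw [h.Dt_time hj.1]; exact h.fderiv_time hj.1
  have e7 : etaT V' (jetMap φ j) = Dt (fun b => V' b 2) (jetMap φ j)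
      - newUt φ j * Dt (fun b => V' b 0) (jetMap φ j)
      - newDeriv φ 1 j * Dt (fun b => V' b 1) (jetMap φ j) := rfl
  rw [e2, e2, e2, e3, e4, h0, h0', e5] at e1
  rw [e7]
  refine mul_right_cancel₀ hT ?_
  linear_combination e1 + Dt (fun b => V b 0) j * e6

/-- Naturality of prolongation. The slots of the mixed derivatives match trivially, since `jetMap`
fixes these coordinates and the prolongations vanish there. -/
lemma IsEquivalence.fderiv_jetMap_prolongation (h : IsEquivalence φ W) (hV : ContDiffOn ℝ ∞ V W)
    (ht : IsTimeOnly (fun b => V b 0) W) (hM' : IsOpen M') (hV' : ContDiffOn ℝ ∞ V' M')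
    (ht' : IsTimeOnly (fun b => V' b 0) M')
    (hφM : MapsTo φ W M') (hpush : ∀ b ∈ W, fderiv ℝ φ b (V b) = V' (φ b))
    {j : Jet} (hj : j ∈ regularJets φ W) :
    fderiv ℝ (jetMap φ) j (prolongation V j) = prolongation V' (jetMap φ j) := by
  have dΦ := h.contDiffOn_jetMap.differentiableAt_of_isOpen h.isOpen_regularJets hj
  have hn := fun m hm => h.fderiv_newDeriv_prolongation hV ht hM' hV' hφM hpush m hm hj
  have hb : ∀ k, fderiv ℝ (fun i => φ (base i) k) j (prolongation V j) =
      V' (base (jetMap φ j)) k := by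
    intro k
    rw [fderiv_comp_base (f := fun b => φ b k)
      ((contDiffOn_component h.smooth k).differentiableAt_of_isOpen h.isOpen hj.1),
      base_jetMap, ← hpush _ hj.1, h.fderiv_apply hj.1]
    congr 1
    ext k; fin_cases k <;> rfl
  have hU := h.fderiv_newUt_prolongation hV ht hM' hV' ht' hφM hpush hj
  have h8 : fderiv ℝ (fun i : Jet => i 8) j (prolongation V j) = 0 := fderiv_coord 8 j _
  have h9 : fderiv ℝ (fun i : Jet => i 9) j (prolongation V j) = 0 := fderiv_coord 9 j _
  have h10 : fderiv ℝ (fun i : Jet => i 10) j (prolongation V j) = 0 := fderiv_coord 10 j _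
  have eP : ∀ k, fderiv ℝ (jetMap φ) j (prolongation V j) k =
      fderiv ℝ (fun i => jetMap φ i k) j (prolongation V j) :=
    fun v => by rw [fderiv_pi (fun k => (differentiableAt_pi.1 dΦ k))]; rfl
  generalize prolongation V j = P at *
  ext k
  rw [eP]
  fin_cases k
  · exact hb 0
  · exact hb 1
  · exact hb 2
  · exact hn 1 (by norm_num)
  · exact hn 2 (by norm_num)
  · exact hn 3 (by norm_num)
  · exact hn 4 (by norm_num)
  · exact hU
  · exact h8
  · exact h9
  · exact h10

end JetMap

/-! ### Transformation of equations and of their symmetries -/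

section TransformedEquation

variable {φ : Base → Base} {W : Set Base}

/-- The jet over a point of `Jet3` whose remaining coordinates vanish. -/
def lift (z : Jet3) : Jet := ![z 0, z 1, z 2, z 3, z 4, z 5, 0, 0, 0, 0, 0]

lemma jet3_lift (z : Jet3) : jet3 (lift z) = z := by ext k; fin_cases k <;> rfl

lemma contDiff_lift : ContDiff ℝ ∞ lift := by
  refine contDiff_pi.2 fun k => ?_
  fin_cases k <;> simp only [lift] <;> simp <;> fun_prop

lemma lift_add_smul (z v : Jet3) (s : ℝ) : lift (z + s • v) = lift z + s • lift v := by
  ext k; fin_cases k <;> simp [lift]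

lemma fderiv_comp_lift {f : Jet → ℝ} {z : Jet3} (hf : DifferentiableAt ℝ f (lift z)) (v : Jet3) :
    fderiv ℝ (fun i => f (lift i)) z v = fderiv ℝ f (lift z) (lift v) := by
  have hb := contDiff_lift.differentiable (by simp) z
  refine fderiv_apply_eq_of_hasDerivAt (hf.comp z hb) ?_
  simp only [lift_add_smul]
  exact hf.hasFDerivAt.hasLineDerivAt (lift v)

lemma DependsUpTo.apply_lift {f : Jet → ℝ} (hf : DependsUpTo 5 f) (j : Jet) :
    f (lift (jet3 j)) = f j := by
  refine hf.congr fun l hl => ?_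
  fin_cases l
  all_goals first | rfl | exact absurd hl (by decide)

/-- The factor by which `u_x` enters the derivative `u'_x'`, up to `D_x X`. -/
noncomputable def jetFactor (φ : Base → Base) (j : Jet) : ℝ :=
  fderiv ℝ (fun b => φ b 2) (base j) (Pi.single 2 1)
    - newDeriv φ 1 j * fderiv ℝ (fun b => φ b 1) (base j) (Pi.single 2 1)

lemma IsEquivalence.Dx_eq_zero (h : IsEquivalence φ W) {j : Jet} (hj : base j ∈ W) :
    fderiv ℝ (fun b => φ b 0) (base j) ![0, 1, j 3] = 0 := by
  rw [h.isTimeOnly.apply hj]; simp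

lemma IsEquivalence.Dx_component (h : IsEquivalence φ W) {j : Jet} (hj : base j ∈ W) (k : Fin 3) :
    Dx (fun i => φ (base i) k) j = fderiv ℝ (fun b => φ b k) (base j) ![0, 1, j 3] :=
  Dx_comp_base (f := fun b => φ b k)
    ((contDiffOn_component h.smooth k).differentiableAt_of_isOpen h.isOpen hj)

/-- Up to the factor `D_x X` this is the Jacobian `D(X,U)/D(x,u)`: if it vanished, the derivative of
`φ` would annihilate `∂_u - c (∂_x + u_x ∂_u)` with `c = X_u / D_x X`. -/
lemma IsEquivalence.jetFactor_ne_zero (h : IsEquivalence φ W) {j : Jet}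
    (hj : j ∈ regularJets φ W) : jetFactor φ j ≠ 0 := by
  intro h0
  have e1 : fderiv ℝ (fun b => φ b 1) (base j) ![0, 1, j 3] = DxX φ j :=
    (h.Dx_component hj.1 1).symm
  have e2 : fderiv ℝ (fun b => φ b 2) (base j) ![0, 1, j 3] = DxX φ j * newDeriv φ 1 j :=
    (h.Dx_component hj.1 2).symm.trans (Dx_newDeriv hj.2 0)
  set c := fderiv ℝ (fun b => φ b 1) (base j) (Pi.single 2 1) / DxX φ j with hc
  have hX := hj.2
  have hv : (Pi.single 2 1 - c • ![0, 1, j 3] : Base) = 0 := by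
    refine h.eq_zero hj.1 fun k => ?_
    rw [map_sub, map_smul, smul_eq_mul]
    fin_cases k
    · have := h.Dx_eq_zero hj.1
      have := (h.isTimeOnly _ hj.1).2
      simp_all
    · change fderiv ℝ (fun b => φ b 1) (base j) (Pi.single 2 1)
        - c * fderiv ℝ (fun b => φ b 1) (base j) ![0, 1, j 3] = 0
      rw [e1, hc, div_mul_cancel₀ _ hX]
      exact sub_self _
    · change fderiv ℝ (fun b => φ b 2) (base j) (Pi.single 2 1)
        - c * fderiv ℝ (fun b => φ b 2) (base j) ![0, 1, j 3] = 0
      rw [e2, hc, ← mul_assoc, div_mul_cancel₀ _ hX]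
      rw [jetFactor] at h0
      linarith
  have h1 := congrFun hv 1
  have h2 := congrFun hv 2
  simp at h1
  simp [h1] at h2

lemma IsEquivalence.fderiv_newDeriv_one (h : IsEquivalence φ W) {j : Jet}
    (hj : j ∈ regularJets φ W) :
    fderiv ℝ (newDeriv φ 1) j (Pi.single 3 1) = jetFactor φ j / DxX φ j := by
  have hO := h.isOpen_regularJets
  have hcy := isOpen_cylinder h.isOpen
  have hI : ∀ k : Fin 3, IndepOf 3 fun i => φ (base i) k := fun k =>
    dependsUpTo_comp_base (fun b => φ b k) 3 (by decide)
  have hs : base (Pi.single 2 1) = Pi.single 2 1 := by ext k; fin_cases k <;> simp [base]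
  have hD : ∀ k, fderiv ℝ (Dx fun i => φ (base i) k) j (Pi.single 3 1) =
      fderiv ℝ (fun b => φ b k) (base j) (Pi.single 2 1) := by
    intro k
    have hf := contDiffOn_component h.smooth k
    refine fderiv_single_of_affine
      ((contDiffOn_Dx hcy (contDiffOn_lift hf)).differentiableAt_of_isOpen hcy hj.1) fun s => ?_
    rw [(hI k).Dx_add (fun j s => (dxVec_add_single j s).1), fderiv_comp_base (f := fun b => φ b k)
      (hf.differentiableAt_of_isOpen h.isOpen hj.1), hs]
  have dn := (h.contDiffOn_newDeriv 1).differentiableAt_of_isOpen hO hj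
  have dX := h.contDiffOn_DxX.differentiableAt_of_isOpen hcy hj.1
  have e : (Dx fun i => φ (base i) 2) =ᶠ[𝓝 j] fun i => DxX φ i * newDeriv φ 1 i := by
    filter_upwards [hO.mem_nhds hj] with i hi using Dx_newDeriv hi.2 0
  have e2 := hD 2
  have e1 : fderiv ℝ (DxX φ) j (Pi.single 3 1) = _ := hD 1
  rw [e.fderiv_eq, fderiv_fun_mul dX dn] at e2
  simp only [add_apply, smul_apply, smul_eq_mul, e1] at e2
  rw [eq_div_iff hj.2, jetFactor]
  linarith

/-- Transformed derivatives of order at least two are affine in their highest derivative. The slope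
arises from the preceding order by one division by `D_x X`. -/
lemma newDeriv_add_single (φ : Base → Base) {m : ℕ} {k l : Fin 11} (hm : 1 ≤ m)
    (hk : (k : ℕ) = m + 2) (hl : (l : ℕ) = m + 3) (hl6 : m ≤ 3) (j : Jet) (s : ℝ) :
    newDeriv φ (m + 1) (j + s • Pi.single l 1) =
      newDeriv φ (m + 1) j + s * (fderiv ℝ (newDeriv φ m) j (Pi.single k 1) / DxX φ j) := by
  have hI : IndepOf l (newDeriv φ m) :=
    dependsUpTo_newDeriv φ m (by omega) l (by rw [Fin.lt_def]; simp; omega)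
  have hX : IndepOf l (DxX φ) := dependsUpTo_DxX φ l (by rw [Fin.lt_def]; simp; omega)
  have hd : ∀ (j : Jet) (s : ℝ), dxVec (j + s • Pi.single l 1) = dxVec j + s • Pi.single k 1 := by
    intro j s
    have := dxVec_add_single j s
    interval_cases m
    · obtain rfl : k = 3 := Fin.ext hk
      obtain rfl : l = 4 := Fin.ext hl
      exact this.2.1
    · obtain rfl : k = 4 := Fin.ext hk
      obtain rfl : l = 5 := Fin.ext hl
      exact this.2.2.1
    · obtain rfl : k = 5 := Fin.ext hk
      obtain rfl : l = 6 := Fin.ext hl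
      exact this.2.2.2.1
  simp only [newDeriv]
  rw [hI.Dx_add hd, hX]
  ring

lemma IsEquivalence.fderiv_newDeriv_single (h : IsEquivalence φ W) {j : Jet}
    (hj : j ∈ regularJets φ W) (m : ℕ) (hm : m ≤ 3) (l : Fin 11) (hl : (l : ℕ) = m + 3) :
    fderiv ℝ (newDeriv φ (m + 1)) j (Pi.single l 1) = jetFactor φ j / DxX φ j ^ (m + 1) := by
  induction m generalizing l with
  | zero =>
    have : l = 3 := Fin.ext hl
    rw [this, h.fderiv_newDeriv_one hj, zero_add, pow_one]
  | succ m ih =>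
    refine fderiv_single_of_affine
      ((h.contDiffOn_newDeriv (m + 2)).differentiableAt_of_isOpen h.isOpen_regularJets hj)
      fun s => ?_
    rw [newDeriv_add_single φ (k := ⟨m + 3, by omega⟩) (by omega) rfl hl (by omega),
      ih (by omega) _ rfl, div_div, ← pow_succ]

/-- With `newUt_eq` this shows that the transformed equation can again be solved for `u'_t'` and is
linear in `u'_x'x'x'x'`: both depend on the old highest coordinates by affine maps with nonzero
slope. -/
lemma IsEquivalence.newDeriv_four (h : IsEquivalence φ W) {j : Jet} (hj : j ∈ regularJets φ W) :
    newDeriv φ 4 j = newDeriv φ 4 (lift (jet3 j)) + j 6 * (jetFactor φ j / DxX φ j ^ 4) := by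
  have hd : DependsUpTo 6 (newDeriv φ 4) := dependsUpTo_newDeriv φ 4 (by norm_num)
  have e : newDeriv φ 4 j = newDeriv φ 4 (lift (jet3 j) + j 6 • Pi.single 6 1) := by
    refine hd.congr fun l hl => ?_
    fin_cases l
    · simp [lift, jet3]
    · simp [lift, jet3]
    · simp [lift, jet3]
    · simp [lift, jet3]
    · simp [lift, jet3]
    · simp [lift, jet3]
    · simp [lift]
    all_goals exact absurd hl (by decide)
  have hX := ((dependsUpTo_DxX φ).mono (by decide)).apply_lift j
  have hn : newDeriv φ 1 (lift (jet3 j)) = newDeriv φ 1 j := DependsUpTo.apply_lift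
    ((dependsUpTo_newDeriv φ 1 (by norm_num)).mono (by decide)) j
  have hL : lift (jet3 j) ∈ regularJets φ W := ⟨hj.1, by rw [hX]; exact hj.2⟩
  have hκ : jetFactor φ (lift (jet3 j)) = jetFactor φ j := by rw [jetFactor, hn]; rfl
  rw [e, newDeriv_add_single φ (m := 3) (k := 5) (l := 6) (by norm_num) rfl rfl le_rfl,
    h.fderiv_newDeriv_single hL 2 (by norm_num) 5 rfl, hX, hκ, div_div, ← pow_succ]

lemma IsEquivalence.newUt_eq (h : IsEquivalence φ W) {j : Jet} (hj : base j ∈ W) :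
    newUt φ j = newUt φ (lift (jet3 j)) + j 7 * (jetFactor φ j / Dt (fun b => φ b 0) j) := by
  have hn : newDeriv φ 1 (lift (jet3 j)) = newDeriv φ 1 j := DependsUpTo.apply_lift
    ((dependsUpTo_newDeriv φ 1 (by norm_num)).mono (by decide)) j
  have hD : ∀ k, Dt (fun b => φ b k) j = Dt (fun b => φ b k) (lift (jet3 j))
      + j 7 * fderiv ℝ (fun b => φ b k) (base j) (Pi.single 2 1) := by
    intro k
    have e : (![1, 0, j 7] : Base) = ![1, 0, 0] + j 7 • Pi.single 2 1 := by
      ext k; fin_cases k <;> simp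
    rw [Dt, e, map_add, map_smul]; rfl
  have h0 : Dt (fun b => φ b 0) j = Dt (fun b => φ b 0) (lift (jet3 j)) := by
    rw [hD, (h.isTimeOnly _ hj).2, mul_zero, add_zero]
  change (_ - newDeriv φ 1 j * _) / _ = (_ - newDeriv φ 1 (lift (jet3 j)) * _) / _ + _
  rw [hn, ← h0, hD 2, hD 1, jetFactor]
  ring

/-- The transformation of the coordinates `(t, x, u, u_x, u_xx, u_xxx)`. -/
noncomputable def jet3Map (φ : Base → Base) (z : Jet3) : Jet3 := newJet3 φ (lift z)

lemma newJet3_eq (j : Jet) : newJet3 φ j = jet3Map φ (jet3 j) := by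
  have hn : ∀ m (_ : m ≤ 3), newDeriv φ m (lift (jet3 j)) = newDeriv φ m j := fun m hm =>
    ((dependsUpTo_newDeriv φ m (by omega)).mono (by rw [Fin.le_def]; simp; omega)).apply_lift j
  have h1 := hn 1 (by norm_num)
  have h2 := hn 2 (by norm_num)
  have h3 := hn 3 (by norm_num)
  ext k
  fin_cases k
  · rfl
  · rfl
  · rfl
  · exact h1.symm
  · exact h2.symm
  · exact h3.symm

/-- The points over which `lift` gives a regular jet. -/
lemma IsEquivalence.isOpen_regularPoints (h : IsEquivalence φ W) :
    IsOpen {z : Jet3 | lift z ∈ regularJets φ W} :=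
  h.isOpen_regularJets.preimage contDiff_lift.continuous

lemma IsEquivalence.contDiffOn_comp_lift (_ : IsEquivalence φ W) {f : Jet → ℝ}
    (hf : ContDiffOn ℝ ∞ f (regularJets φ W)) :
    ContDiffOn ℝ ∞ (fun z => f (lift z)) {z : Jet3 | lift z ∈ regularJets φ W} :=
  hf.comp contDiff_lift.contDiffOn fun _ h => h

lemma IsEquivalence.contDiffOn_jet3Map (h : IsEquivalence φ W) :
    ContDiffOn ℝ ∞ (jet3Map φ) {z : Jet3 | lift z ∈ regularJets φ W} := by
  have e : jet3Map φ = fun z => jet3 (jetMap φ (lift z)) := by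
    funext z; rw [jet3_jetMap]; rfl
  rw [e]
  exact contDiff_jet3.comp_contDiffOn
    (h.contDiffOn_jetMap.comp contDiff_lift.contDiffOn fun _ h => h)

/-- The Jacobian matrix is block triangular: the block of `(t, x, u)` is that of `φ`, and the
diagonal entries for the derivatives are `jetFactor` divided by powers of `D_x X`. -/
lemma IsEquivalence.det_jet3Map_ne_zero (h : IsEquivalence φ W) {z : Jet3}
    (hz : lift z ∈ regularJets φ W) : (fderiv ℝ (jet3Map φ) z).det ≠ 0 := by
  have hO := h.isOpen_regularPoints
  have dN := h.contDiffOn_jet3Map.differentiableAt_of_isOpen hO hz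
  refine det_ne_zero_of_forall fun v hv => ?_
  have hcomp : ∀ k, fderiv ℝ (fun y => jet3Map φ y k) z v = 0 := by
    intro k
    rw [fderiv_pi (fun k => (differentiableAt_pi.1 dN k))] at hv
    exact congrFun hv k
  have hb : ∀ k : Fin 3, fderiv ℝ (fun b => φ b k) (base3 z) (base (lift v)) = 0 := by
    intro k
    have d := (contDiffOn_component h.smooth k).differentiableAt_of_isOpen h.isOpen hz.1
    have e := fderiv_comp_lift (f := fun i => φ (base i) k) (z := z)
      ((contDiffOn_lift (contDiffOn_component h.smooth k)).differentiableAt_of_isOpen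
        (isOpen_cylinder h.isOpen) hz.1) v
    rw [fderiv_comp_base (f := fun b => φ b k) d] at e
    refine e.symm.trans ?_
    fin_cases k
    exacts [hcomp 0, hcomp 1, hcomp 2]
  have hv0 : base (lift v) = 0 := h.eq_zero (b := base3 z) hz.1 hb
  have v0 : v 0 = 0 := congrFun hv0 0
  have v1 : v 1 = 0 := congrFun hv0 1
  have v2 : v 2 = 0 := congrFun hv0 2
  have step : ∀ m (hm : m ≤ 2), (∀ l : Fin 6, (l : ℕ) < m + 3 → v l = 0) →
      fderiv ℝ (fun y => newDeriv φ (m + 1) (lift y)) z v = 0 → v ⟨m + 3, by omega⟩ = 0 := by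
    intro m hm hl h0
    have d := (h.contDiffOn_newDeriv (m + 1)).differentiableAt_of_isOpen h.isOpen_regularJets hz
    rw [fderiv_comp_lift d] at h0
    have hd : DependsUpTo ⟨m + 3, by omega⟩ (newDeriv φ (m + 1)) :=
      dependsUpTo_newDeriv φ (m + 1) (by omega)
    have e : fderiv ℝ (newDeriv φ (m + 1)) (lift z) (lift v) =
        fderiv ℝ (newDeriv φ (m + 1)) (lift z)
          (v ⟨m + 3, by omega⟩ • Pi.single ⟨m + 3, by omega⟩ 1) := by
      refine hd.fderiv_congr fun l hlm => ?_
      have hlm' : (l : ℕ) ≤ m + 3 := hlm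
      have hl6 : (l : ℕ) < 6 := by omega
      have el : lift v l = v ⟨l, hl6⟩ := by
        obtain ⟨l, hl11⟩ := l
        simp only at hl6
        interval_cases l <;> rfl
      rw [el]
      rcases hlm'.lt_or_eq with hlt | heq
      · rw [hl ⟨l, hl6⟩ hlt]
        have : l ≠ ⟨m + 3, by omega⟩ := by rw [Ne, Fin.ext_iff]; exact hlt.ne
        simp [this]
      · obtain ⟨l, hl11⟩ := l
        simp only at heq
        subst heq
        simp
    rw [e, map_smul, h.fderiv_newDeriv_single hz m (by omega) _ rfl, smul_eq_mul] at h0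
    exact (mul_eq_zero.1 h0).resolve_right
      (div_ne_zero (h.jetFactor_ne_zero hz) (pow_ne_zero _ hz.2))
  have v3 : v 3 = 0 := step 0 (by norm_num) (fun l hl => by
    obtain ⟨l, _⟩ := l; simp only at hl; interval_cases l <;> assumption) (hcomp 3)
  have v4 : v 4 = 0 := step 1 (by norm_num) (fun l hl => by
    obtain ⟨l, _⟩ := l; simp only at hl; interval_cases l <;> assumption) (hcomp 4)
  have v5 : v 5 = 0 := step 2 (by norm_num) (fun l hl => by
    obtain ⟨l, _⟩ := l; simp only at hl; interval_cases l <;> assumption) (hcomp 5)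
  ext k
  fin_cases k <;> assumption

/-- Near generic points the total derivative `D_x X` does not vanish. -/
lemma IsEquivalence.exists_regular (h : IsEquivalence φ W) {Ω₀ : Set Jet3} (hΩ : IsOpen Ω₀)
    (hne : Ω₀.Nonempty) (hW : base3 '' Ω₀ ⊆ W) : ∃ z ∈ Ω₀, lift z ∈ regularJets φ W := by
  obtain ⟨z, hz⟩ := hne
  have hzW : base3 z ∈ W := hW ⟨z, hz, rfl⟩
  by_contra! hcon
  have hX : ∀ y ∈ Ω₀, fderiv ℝ (fun b => φ b 1) (base3 y) ![0, 1, y 3] = 0 := by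
    intro y hy
    have hyW : base (lift y) ∈ W := hW ⟨y, hy, rfl⟩
    have := hcon y hy
    simp only [regularJets, mem_ofPred_eq, not_and, not_not] at this
    exact (h.Dx_component hyW 1).symm.trans (this hyW)
  -- If `X_x + u_x X_u` vanished on the whole open set, two values of `u_x` over one base point
  -- would give `X_u = 0`.
  have hline : ContinuousAt (fun s : ℝ => z + s • (Pi.single 3 1 : Jet3)) 0 := by fun_prop
  have hev : ∀ᶠ s : ℝ in 𝓝 0, z + s • (Pi.single 3 1 : Jet3) ∈ Ω₀ :=
    hline.eventually (p := fun y => y ∈ Ω₀) (by simpa using hΩ.mem_nhds hz)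
  obtain ⟨ε, hε, hball⟩ := Metric.eventually_nhds_iff.1 hev
  have hs : z + (ε / 2) • (Pi.single 3 1 : Jet3) ∈ Ω₀ := hball (by
    rw [Real.dist_0_eq_abs, abs_of_pos (by positivity)]; linarith)
  have k1 := hX z hz
  have k2 := hX _ hs
  have hb : base3 (z + (ε / 2) • (Pi.single 3 1 : Jet3)) = base3 z := by
    ext i; fin_cases i <;> simp [base3]
  rw [hb] at k2
  have e : (![0, 1, (z + (ε / 2) • (Pi.single 3 1 : Jet3)) 3] : Base) =
      ![0, 1, z 3] + (ε / 2) • Pi.single 2 1 := by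
    ext i; fin_cases i <;> simp
  rw [e, map_add, k1, zero_add, map_smul, smul_eq_mul] at k2
  have h2 : fderiv ℝ (fun b => φ b 1) (base3 z) (Pi.single 2 1) = 0 :=
    (mul_eq_zero.1 k2).resolve_left (by positivity)
  have t1 := h.Dx_eq_zero (j := lift z) hzW
  have t2 := (h.isTimeOnly _ hzW).2
  set p := fderiv ℝ (fun b => φ b 2) (base3 z) ![0, 1, z 3] with hp
  set q := fderiv ℝ (fun b => φ b 2) (base3 z) (Pi.single 2 1) with hq
  -- Then `∂_x + u_x ∂_u` and `∂_u` are both mapped to multiples of the `u`-direction, so a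
  -- combination of them is annihilated; injectivity forces `q = 0`, and then `∂_u` itself is
  -- annihilated.
  have hv : (q • ![0, 1, z 3] - p • Pi.single 2 1 : Base) = 0 := by
    refine h.eq_zero hzW fun k => ?_
    rw [map_sub, map_smul, map_smul, smul_eq_mul, smul_eq_mul]
    fin_cases k
    · change q * fderiv ℝ (fun b => φ b 0) (base3 z) ![0, 1, z 3]
        - p * fderiv ℝ (fun b => φ b 0) (base3 z) (Pi.single 2 1) = 0
      have t1' : fderiv ℝ (fun b => φ b 0) (base3 z) ![0, 1, z 3] = 0 := t1
      rw [t1', t2]; ring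
    · change q * fderiv ℝ (fun b => φ b 1) (base3 z) ![0, 1, z 3]
        - p * fderiv ℝ (fun b => φ b 1) (base3 z) (Pi.single 2 1) = 0
      rw [k1, h2]; ring
    · change q * p - p * q = 0
      ring
  have q0 : q = 0 := by simpa using congrFun hv 1
  have hs : (Pi.single 2 1 : Base) = 0 := by
    refine h.eq_zero hzW fun k => ?_
    fin_cases k
    exacts [t2, h2, q0]
  simpa using congrFun hs 2

/-- If a transformation carries one equation to another one, then it carries symmetries to
symmetries. -/
theorem IsEquivalence.isSymmetry_push (h : IsEquivalence φ W) {F G F' G' : Jet3 → ℝ}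
    {Ω Ω₁ B : Set Jet3} (hE : IsEquation F G Ω) (hE' : IsEquation F' G' B) (hΩ₁ : IsOpen Ω₁)
    (hsub : Ω₁ ⊆ Ω) (hreg : ∀ j, jet3 j ∈ Ω₁ → j ∈ regularJets φ W) {lam : Jet → ℝ}
    (hlam : ContDiffOn ℝ ∞ lam (regularJets φ W)) (hlam0 : ∀ j ∈ regularJets φ W, lam j ≠ 0)
    (hdef : ∀ j, jet3 j ∈ Ω₁ → defect F' G' (jetMap φ j) = lam j * defect F G j)
    (hsurj : ∀ i, jet3 i ∈ B → ∃ j, jet3 j ∈ Ω₁ ∧ jetMap φ j = i)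
    {V V' : Base → Base} (hV : ContDiffOn ℝ ∞ V (base3 '' Ω)) (hsym : IsSymmetry F G Ω V)
    (hV' : ContDiffOn ℝ ∞ V' univ) (ht' : IsTimeOnly (fun b => V' b 0) univ)
    (hpush : ∀ b ∈ W ∩ base3 '' Ω, fderiv ℝ φ b (V b) = V' (φ b)) : IsSymmetry F' G' B V' := by
  have hMo : IsOpen (base3 '' Ω) := isOpenMap_base3 _ hE.isOpen
  have ht := hsym.isTimeOnly hE hV
  have hres := h.mono (W' := W ∩ base3 '' Ω) inter_subset_left (h.isOpen.inter hMo)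
  rw [isSymmetry_iff_fderiv_defect hE hMo subset_rfl hV ht] at hsym
  rw [isSymmetry_iff_fderiv_defect hE' isOpen_univ (subset_univ _) hV' ht']
  intro i hi hi0
  obtain ⟨j, hjΩ₁, rfl⟩ := hsurj i hi
  have hjr := hreg j hjΩ₁
  have hjΩ : jet3 j ∈ Ω := hsub hjΩ₁
  have hjr' : j ∈ regularJets φ (W ∩ base3 '' Ω) := ⟨⟨hjr.1, ⟨_, hjΩ, rfl⟩⟩, hjr.2⟩
  have hdj : defect F G j = 0 := by
    have := hdef j hjΩ₁
    rw [hi0] at this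
    exact (mul_eq_zero.1 this.symm).resolve_left (hlam0 j hjr)
  have key := hsym j hjΩ hdj
  have hΦ := hres.fderiv_jetMap_prolongation (hV.mono inter_subset_right)
    (ht.mono inter_subset_right) isOpen_univ hV' ht' (mapsTo_univ _ _) hpush hjr'
  have dΦ := h.contDiffOn_jetMap.differentiableAt_of_isOpen h.isOpen_regularJets hjr
  have dE' := (contDiffOn_defect hE').differentiableAt_of_isOpen
    (hE'.isOpen.preimage contDiff_jet3.continuous) hi
  have dE := (contDiffOn_defect hE).differentiableAt_of_isOpen
    (hE.isOpen.preimage contDiff_jet3.continuous) hjΩ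
  have dl := hlam.differentiableAt_of_isOpen h.isOpen_regularJets hjr
  -- On the equation the defect is zero, so the derivative of the product reduces to `lam` times the
  -- derivative of the old defect, which vanishes along the prolongation.
  have hev : (defect F' G' ∘ jetMap φ) =ᶠ[𝓝 j] fun j => lam j * defect F G j := by
    filter_upwards [(hΩ₁.preimage contDiff_jet3.continuous).mem_nhds hjΩ₁] with k hk
    exact hdef k hk
  have hfin := congrArg (fun A : Jet →L[ℝ] ℝ => A (prolongation V j)) hev.fderiv_eq
  rw [fderiv_comp j dE' dΦ, fderiv_fun_mul dl dE] at hfin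
  simp only [ContinuousLinearMap.comp_apply, smul_apply, hΦ, key, hdj, smul_zero,
    zero_smul, add_zero] at hfin
  exact hfin

/-- The action on jets is onto over the image of a regular point. -/
lemma IsEquivalence.exists_jetMap_eq (h : IsEquivalence φ W) {z : Jet3}
    (hz : lift z ∈ regularJets φ W) {i : Jet} (hi : jet3Map φ z = jet3 i) :
    ∃ j, jet3 j = z ∧ jetMap φ j = i := by
  set a := jetFactor φ (lift z) / DxX φ (lift z) ^ 4 with ha
  set c := jetFactor φ (lift z) / Dt (fun b => φ b 0) (lift z) with hc
  have ha0 : a ≠ 0 := div_ne_zero (h.jetFactor_ne_zero hz) (pow_ne_zero _ hz.2)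
  have hc0 : c ≠ 0 := div_ne_zero (h.jetFactor_ne_zero hz)
    (by rw [h.Dt_time hz.1]; exact h.fderiv_time hz.1)
  obtain ⟨j, hjz, h6, h7, h8, h9, h10⟩ : ∃ j : Jet, jet3 j = z ∧
      j 6 = (i 6 - newDeriv φ 4 (lift z)) / a ∧ j 7 = (i 7 - newUt φ (lift z)) / c ∧
      j 8 = i 8 ∧ j 9 = i 9 ∧ j 10 = i 10 :=
    ⟨![z 0, z 1, z 2, z 3, z 4, z 5, (i 6 - newDeriv φ 4 (lift z)) / a,
      (i 7 - newUt φ (lift z)) / c, i 8, i 9, i 10], by ext k; fin_cases k <;> rfl,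
      rfl, rfl, rfl, rfl, rfl⟩
  have hjb : base j = base (lift z) := by rw [← hjz]; rfl
  have hX : DxX φ j = DxX φ (lift z) := by
    rw [← ((dependsUpTo_DxX φ).mono (by decide)).apply_lift j, hjz]
  have hn : newDeriv φ 1 j = newDeriv φ 1 (lift z) := by
    rw [← DependsUpTo.apply_lift
      ((dependsUpTo_newDeriv φ 1 (by norm_num)).mono (by decide)) j, hjz]
  have hκ : jetFactor φ j = jetFactor φ (lift z) := by rw [jetFactor, hn, hjb]; rfl
  have hjr : j ∈ regularJets φ W := ⟨by rw [hjb]; exact hz.1, by rw [hX]; exact hz.2⟩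
  have hD : Dt (fun b => φ b 0) j = Dt (fun b => φ b 0) (lift z) := by
    rw [h.Dt_time hjr.1, h.Dt_time hz.1, hjb]
  have e3 : newJet3 φ j = jet3 i := by rw [newJet3_eq, hjz, hi]
  have e6 : newDeriv φ 4 j = i 6 := by
    rw [h.newDeriv_four hjr, hκ, hX, hjz, ← ha, h6, div_mul_cancel₀ _ ha0]; ring
  have e7 : newUt φ j = i 7 := by
    rw [h.newUt_eq hjr.1, hκ, hD, hjz, ← hc, h7, div_mul_cancel₀ _ hc0]; ring
  refine ⟨j, hjz, ?_⟩
  ext k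
  fin_cases k
  · exact congrFun e3 0
  · exact congrFun e3 1
  · exact congrFun e3 2
  · exact congrFun e3 3
  · exact congrFun e3 4
  · exact congrFun e3 5
  · exact e6
  · exact e7
  · exact h8
  · exact h9
  · exact h10

/-- Near generic points a transformation carries an equation of the class to an equation of the
class, and its symmetries to symmetries. -/
theorem IsEquivalence.exists_carriesEquation (h : IsEquivalence φ W) {F G : Jet3 → ℝ}
    {Ω : Set Jet3} (hE : IsEquation F G Ω) {Ω₀ : Set Jet3} (hsub : Ω₀ ⊆ Ω) (hΩ₀ : IsOpen Ω₀)
    (hne : Ω₀.Nonempty) (hW : base3 '' Ω₀ ⊆ W) {R : Set Jet3} (hR : IsOpen R) (hRd : Dense R) :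
    ∃ Ω₁ ⊆ Ω₀, IsOpen Ω₁ ∧ Ω₁.Nonempty ∧ ∃ (F' G' : Jet3 → ℝ) (Ω' : Set Jet3),
      IsEquation F' G' Ω' ∧ CarriesEquation φ F G Ω₁ F' G' Ω' ∧ IsOpenBox Ω' ∧ Ω' ⊆ R ∧
      ∀ V V' : Base → Base, ContDiffOn ℝ ∞ V (base3 '' Ω) → IsSymmetry F G Ω V →
        ContDiffOn ℝ ∞ V' univ → IsTimeOnly (fun b => V' b 0) univ →
        (∀ b ∈ W ∩ base3 '' Ω, fderiv ℝ φ b (V b) = V' (φ b)) → IsSymmetry F' G' Ω' V' := by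
  obtain ⟨z₀, hz₀, hz₀r⟩ := h.exists_regular hΩ₀ hne hW
  have hU : IsOpen (Ω₀ ∩ {z : Jet3 | lift z ∈ regularJets φ W}) := hΩ₀.inter h.isOpen_regularPoints
  obtain ⟨S, hSU, hS, hzS, hinj, hdet⟩ := exists_injOn_nhd hU
    (h.contDiffOn_jet3Map.mono inter_subset_right) ⟨hz₀, hz₀r⟩ (h.det_jet3Map_ne_zero hz₀r)
  have hNs := h.contDiffOn_jet3Map.mono (hSU.trans inter_subset_right)
  obtain ⟨hSo, g, hg, hgN⟩ := exists_smooth_inverse hS hNs hinj hdet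
  -- The image is open and meets the dense set `R`. Shrinking it to a box there makes the row of the
  -- table available with a single pair of functions.
  obtain ⟨y₁, hy₁, hy₁R⟩ := hRd.inter_open_nonempty _ hSo ⟨_, mem_image_of_mem _ hzS⟩
  obtain ⟨B, hBsub, hB, hyB⟩ := IsOpenBox.exists_subset (hSo.inter hR) ⟨hy₁, hy₁R⟩
  have hgS : ∀ y ∈ B, g y ∈ S ∧ jet3Map φ (g y) = y := by
    intro y hy
    obtain ⟨z, hz, rfl⟩ := (hBsub hy).1
    rw [hgN z hz]
    exact ⟨hz, rfl⟩
  have hgr : ∀ y ∈ B, lift (g y) ∈ regularJets φ W := fun y hy => (hSU (hgS y hy).1).2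
  have hgΩ : ∀ y ∈ B, g y ∈ Ω := fun y hy => hsub (hSU (hgS y hy).1).1
  have hgB : ContDiffOn ℝ ∞ g B := hg.mono fun y hy => (hBsub hy).1
  have hpull : ∀ {f : Jet → ℝ}, ContDiffOn ℝ ∞ f (regularJets φ W) →
      ContDiffOn ℝ ∞ (fun y => f (lift (g y))) B := fun hf =>
    (h.contDiffOn_comp_lift hf).comp hgB hgr
  have hDt := h.contDiffOn_newUt
  have hDtφ : ContDiffOn ℝ ∞ (Dt fun b => φ b 0) (regularJets φ W) :=
    (contDiffOn_Dt h.isOpen (contDiffOn_component h.smooth 0)).mono regularJets_subset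
  have hX := h.contDiffOn_DxX.mono (regularJets_subset (φ := φ))
  have hDt0 : ∀ j ∈ regularJets φ W, Dt (fun b => φ b 0) j ≠ 0 := fun j hj => by
    rw [h.Dt_time hj.1]; exact h.fderiv_time hj.1
  have hκ : ContDiffOn ℝ ∞ (jetFactor φ) (regularJets φ W) := by
    have hd : ∀ k, ContDiffOn ℝ ∞
        (fun j : Jet => fderiv ℝ (fun b => φ b k) (base j) (Pi.single 2 1)) (regularJets φ W) :=
      fun k => (contDiffOn_lift (((contDiffOn_component h.smooth k).fderiv_infty
        h.isOpen).clm_apply contDiffOn_const)).mono regularJets_subset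
    exact (hd 2).sub ((h.contDiffOn_newDeriv 1).mul (hd 1))
  let lam : Jet → ℝ := fun j => jetFactor φ j / Dt (fun b => φ b 0) j
  have hlam : ContDiffOn ℝ ∞ lam (regularJets φ W) := hκ.div hDtφ hDt0
  -- These formulas result from inserting the affine expressions of `u'_t'` and `u'_x'x'x'x'` into
  -- the old equation; `jetFactor` cancels in the leading coefficient.
  let F' : Jet3 → ℝ := fun y =>
    F (g y) * (DxX φ (lift (g y)) ^ 4 / Dt (fun b => φ b 0) (lift (g y)))
  let G' : Jet3 → ℝ := fun y => newUt φ (lift (g y)) - F' y * newDeriv φ 4 (lift (g y))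
    + lam (lift (g y)) * G (g y)
  have hF' : ContDiffOn ℝ ∞ F' B := (hE.smooth_F.comp hgB hgΩ).mul
    (((hpull hX).pow 4).div (hpull hDtφ) fun y hy => hDt0 _ (hgr y hy))
  have hE' : IsEquation F' G' B :=
    ⟨hB.isOpen, hF', ((hpull hDt).sub (hF'.mul (hpull (h.contDiffOn_newDeriv 4)))).add
      ((hpull hlam).mul (hE.smooth_G.comp hgB hgΩ)), fun y hy => mul_ne_zero
      (hE.ne_zero _ (hgΩ y hy)) (div_ne_zero (pow_ne_zero _ (hgr y hy).2) (hDt0 _ (hgr y hy)))⟩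
  let Ω₁ : Set Jet3 := S ∩ jet3Map φ ⁻¹' B
  have hΩ₁o : IsOpen Ω₁ := hNs.continuousOn.isOpen_inter_preimage hS hB.isOpen
  have hΩ₁r : ∀ j, jet3 j ∈ Ω₁ → j ∈ regularJets φ W := by
    intro j hj
    have h1 := (hSU hj.1).2
    exact ⟨h1.1, by rw [← ((dependsUpTo_DxX φ).mono (by decide)).apply_lift j]; exact h1.2⟩
  have hlamj : ∀ j, lam (lift (jet3 j)) = lam j ∨ base j ∉ W := by
    intro j
    by_cases hj : base j ∈ W
    · left
      have hn : newDeriv φ 1 (lift (jet3 j)) = newDeriv φ 1 j := DependsUpTo.apply_lift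
        ((dependsUpTo_newDeriv φ 1 (by norm_num)).mono (by decide)) j
      have hj' : base (lift (jet3 j)) ∈ W := hj
      simp only [lam, jetFactor]
      rw [hn, h.Dt_time hj, h.Dt_time hj']
      rfl
    · exact Or.inr hj
  have hdef : ∀ j, jet3 j ∈ Ω₁ → defect F' G' (jetMap φ j) = lam j * defect F G j := by
    intro j hj
    have hr := hΩ₁r j hj
    have e1 := h.newDeriv_four hr
    have e2 := h.newUt_eq hr.1
    have e3 := (hlamj j).resolve_right (not_not.2 hr.1)
    have eg : g (jet3 (jetMap φ j)) = jet3 j := by rw [jet3_jetMap, newJet3_eq]; exact hgN _ hj.1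
    have eX := ((dependsUpTo_DxX φ).mono (by decide)).apply_lift j
    have eD : Dt (fun b => φ b 0) (lift (jet3 j)) = Dt (fun b => φ b 0) j := by
      have hr' : base (lift (jet3 j)) ∈ W := hr.1
      rw [h.Dt_time hr.1, h.Dt_time hr']; rfl
    have hX0 := hr.2
    have hD0 := hDt0 j hr
    have e7 : jetMap φ j 7 = newUt φ j := rfl
    have e6 : jetMap φ j 6 = newDeriv φ 4 j := rfl
    simp only [defect, F', G', e7, e6, eg, e3, eX, eD]
    rw [e1, e2]
    simp only [lam]
    field_simp
    ring
  have hlam0 : ∀ j ∈ regularJets φ W, lam j ≠ 0 := fun j hj =>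
    div_ne_zero (h.jetFactor_ne_zero hj) (hDt0 j hj)
  have himg : newJet3 φ '' (jet3 ⁻¹' Ω₁) = B := by
    ext y
    constructor
    · rintro ⟨j, hj, rfl⟩
      rw [newJet3_eq]; exact hj.2
    · intro hy
      refine ⟨lift (g y), ?_, (hgS y hy).2⟩
      rw [mem_preimage, jet3_lift]
      exact ⟨(hgS y hy).1, by rw [mem_preimage, (hgS y hy).2]; exact hy⟩
  refine ⟨Ω₁, fun z hz => (hSU hz.1).1, hΩ₁o, ⟨g y₁, (hgS y₁ hyB).1, ?_⟩, F', G', B, hE',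
    ⟨fun j hj => (hΩ₁r j hj).2, himg, ?_⟩, hB, fun y hy => (hBsub hy).2, ?_⟩
  · rw [mem_preimage, (hgS y₁ hyB).2]; exact hyB
  · intro j hj
    have hd := hdef j hj
    have hl := hlam0 j (hΩ₁r j hj)
    have e1 : (j 7 = F (jet3 j) * j 6 + G (jet3 j)) ↔ defect F G j = 0 := by
      rw [defect, sub_sub, sub_eq_zero]
    have e2 : (newUt φ j = F' (newJet3 φ j) * newU4 φ j + G' (newJet3 φ j)) ↔
        defect F' G' (jetMap φ j) = 0 := by
      rw [defect, sub_sub, sub_eq_zero, jet3_jetMap]; rfl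
    rw [e1, e2, hd, mul_eq_zero, or_iff_right hl]
  · intro V V' hV hsym hV' ht' hpush
    refine h.isSymmetry_push hE hE' hΩ₁o (fun z hz => hsub (hSU hz.1).1) hΩ₁r hlam hlam0 hdef ?_
      hV hsym hV' ht' hpush
    intro i hi
    obtain ⟨hzS', hzN⟩ := hgS _ hi
    have hzr : lift (g (jet3 i)) ∈ regularJets φ W := hgr _ hi
    have hzB : g (jet3 i) ∈ jet3Map φ ⁻¹' B := by rw [mem_preimage, hzN]; exact hi
    generalize g (jet3 i) = z at *
    obtain ⟨j, hjz, hj⟩ := h.exists_jetMap_eq hzr hzN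
    exact ⟨j, by rw [hjz]; exact ⟨hzS', hzB⟩, hj⟩

end TransformedEquation

/-! ### Lie brackets under transformations and changes of basis -/

section Brackets

variable {φ : Base → Base} {W : Set Base} {X Y X' Y' : Base → Base}

/-- Differentiating the two relatedness identities produces second derivatives of `φ`, which cancel
in the bracket by symmetry. -/
lemma lieBracket_push (hW : IsOpen W) (hφ : ContDiffOn ℝ ∞ φ W) {b : Base} (hb : b ∈ W)
    (hX : DifferentiableAt ℝ X b) (hY : DifferentiableAt ℝ Y b)
    (hX' : DifferentiableAt ℝ X' (φ b)) (hY' : DifferentiableAt ℝ Y' (φ b))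
    (pX : ∀ b ∈ W, fderiv ℝ φ b (X b) = X' (φ b)) (pY : ∀ b ∈ W, fderiv ℝ φ b (Y b) = Y' (φ b)) :
    fderiv ℝ φ b (VectorField.lieBracket ℝ X Y b) = VectorField.lieBracket ℝ X' Y' (φ b) := by
  have hs : IsSymmSndFDerivAt ℝ φ b :=
    (hφ.contDiffAt (hW.mem_nhds hb)).isSymmSndFDerivAt (by simp; exact WithTop.coe_le_coe.2 le_top)
  have dd := (hφ.fderiv_infty hW).differentiableAt_of_isOpen hW hb
  have dφ := hφ.differentiableAt_of_isOpen hW hb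
  have key : ∀ {Z Z' : Base → Base}, DifferentiableAt ℝ Z b → DifferentiableAt ℝ Z' (φ b) →
      (∀ b ∈ W, fderiv ℝ φ b (Z b) = Z' (φ b)) → ∀ v,
      fderiv ℝ φ b (fderiv ℝ Z b v) + fderiv ℝ (fderiv ℝ φ) b v (Z b) =
        fderiv ℝ Z' (φ b) (fderiv ℝ φ b v) := by
    intro Z Z' hZ hZ' pZ v
    have e : (fun b => fderiv ℝ φ b (Z b)) =ᶠ[𝓝 b] Z' ∘ φ := by
      filter_upwards [hW.mem_nhds hb] with c hc using pZ c hc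
    have h := congrArg (fun A : Base →L[ℝ] Base => A v) e.fderiv_eq
    rw [fderiv_clm_apply dd hZ, fderiv_comp b hZ' dφ] at h
    exact h
  have kX := key hX hX' pX (Y b)
  have kY := key hY hY' pY (X b)
  rw [pY b hb] at kX
  rw [pX b hb] at kY
  rw [VectorField.lieBracket, VectorField.lieBracket, map_sub, ← kX, ← kY, hs (X b) (Y b)]
  abel

lemma lieBracket_comb {b : Base} (hX : DifferentiableAt ℝ X b) (hY : DifferentiableAt ℝ Y b)
    (p q r s : ℝ) :
    VectorField.lieBracket ℝ (fun b => p • X b + q • Y b) (fun b => r • X b + s • Y b) b =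
      (p * s - q * r) • VectorField.lieBracket ℝ X Y b := by
  have e : ∀ p q : ℝ, fderiv ℝ (fun b => p • X b + q • Y b) b =
      p • fderiv ℝ X b + q • fderiv ℝ Y b := fun p q => by
    rw [fderiv_fun_add (hX.fun_const_smul p) (hY.fun_const_smul q), fderiv_fun_const_smul hX,
      fderiv_fun_const_smul hY]
  simp only [VectorField.lieBracket, e, add_apply, smul_apply, map_add, map_smul]
  module

end Brackets

/-! ### The canonical algebras -/

section Canonical

lemma contDiff_affineField (p p₀ q q₀ r s r₀ : ℝ) :
    ContDiff ℝ ∞ (affineField p p₀ q q₀ r s r₀) := by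
  refine contDiff_pi.2 fun k => ?_
  fin_cases k <;> simp only [affineField] <;> simp <;> fun_prop

lemma fderiv_affineField (p p₀ q q₀ r s r₀ : ℝ) (b v : Base) :
    fderiv ℝ (affineField p p₀ q q₀ r s r₀) b v = ![p * v 0, q * v 1, r * v 2 + s * v 1] := by
  refine fderiv_apply_eq_of_hasDerivAt
    ((contDiff_affineField p p₀ q q₀ r s r₀).differentiable (by simp) b) ?_
  have hl : ∀ k : Fin 3, HasDerivAt (fun s : ℝ => (b + s • v) k) (v k) 0 := fun k => by
    simpa using ((hasDerivAt_id (0 : ℝ)).mul_const (v k)).const_add (b k)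
  rw [hasDerivAt_pi]
  intro k
  fin_cases k
  · exact ((hl 0).const_mul p).add_const p₀
  · exact ((hl 1).const_mul q).add_const q₀
  · exact (((hl 2).const_mul r).add ((hl 1).const_mul s)).add_const r₀

lemma exists_canonical_eq_affineField (i : Fin 3 ⊕ Fin 4) (k : Fin 2) :
    ∃ p p₀ q q₀ r s r₀, canonical i k = affineField p p₀ q q₀ r s r₀ := by
  obtain ⟨a0, a1, b0, b1, c0, c1, d0, d1, e0, e1, f0, f1, g0, g1⟩ := canonical_eq_affineField
  rcases i with i | i <;> fin_cases i <;> fin_cases k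
  exacts [⟨_, _, _, _, _, _, _, a0⟩, ⟨_, _, _, _, _, _, _, a1⟩, ⟨_, _, _, _, _, _, _, b0⟩,
    ⟨_, _, _, _, _, _, _, b1⟩, ⟨_, _, _, _, _, _, _, c0⟩, ⟨_, _, _, _, _, _, _, c1⟩,
    ⟨_, _, _, _, _, _, _, d0⟩, ⟨_, _, _, _, _, _, _, d1⟩, ⟨_, _, _, _, _, _, _, e0⟩,
    ⟨_, _, _, _, _, _, _, e1⟩, ⟨_, _, _, _, _, _, _, f0⟩, ⟨_, _, _, _, _, _, _, f1⟩,
    ⟨_, _, _, _, _, _, _, g0⟩, ⟨_, _, _, _, _, _, _, g1⟩]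

lemma contDiff_canonical (i : Fin 3 ⊕ Fin 4) (k : Fin 2) : ContDiff ℝ ∞ (canonical i k) := by
  obtain ⟨p, p₀, q, q₀, r, s, r₀, e⟩ := exists_canonical_eq_affineField i k
  rw [e]; exact contDiff_affineField ..

lemma isTimeOnly_canonical (i : Fin 3 ⊕ Fin 4) (k : Fin 2) :
    IsTimeOnly (fun b => canonical i k b 0) univ := by
  intro b _
  have d := (contDiff_canonical i k).differentiable (by simp) b
  obtain ⟨p, p₀, q, q₀, r, s, r₀, e⟩ := exists_canonical_eq_affineField i k
  have h : ∀ v, fderiv ℝ (fun b => canonical i k b 0) b v = p * v 0 := by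
    intro v
    have := congrFun (fderiv_affineField p p₀ q q₀ r s r₀ b v) 0
    rw [← e, fderiv_pi (fun k => (differentiableAt_pi.1 d k))] at this
    exact this
  simp [h]

lemma lieBracket_affineField (p p₀ q q₀ r s r₀ p' p₀' q' q₀' r' s' r₀' : ℝ) (b : Base) :
    VectorField.lieBracket ℝ (affineField p p₀ q q₀ r s r₀)
      (affineField p' p₀' q' q₀' r' s' r₀') b =
    ![p' * p₀ - p * p₀', q' * q₀ - q * q₀',
      r' * (s * b 1 + r₀) + s' * (q * b 1 + q₀) - (r * (s' * b 1 + r₀') + s * (q' * b 1 + q₀'))] := by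
  rw [VectorField.lieBracket, fderiv_affineField, fderiv_affineField]
  ext k
  fin_cases k <;> simp [affineField] <;> ring

lemma lieBracket_canonical (i : Fin 3 ⊕ Fin 4) (b : Base) :
    VectorField.lieBracket ℝ (canonical i 0) (canonical i 1) b =
      Sum.elim (fun _ => 0) (fun _ => canonical i 1 b) i := by
  obtain ⟨a0, a1, b0, b1, c0, c1, d0, d1, e0, e1, f0, f1, g0, g1⟩ := canonical_eq_affineField
  rcases i with i | i
  · fin_cases i
    · change VectorField.lieBracket ℝ (canonical (.inl 0) 0) (canonical (.inl 0) 1) b = 0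
      rw [a0, a1, lieBracket_affineField]; ext k; fin_cases k <;> simp
    · change VectorField.lieBracket ℝ (canonical (.inl 1) 0) (canonical (.inl 1) 1) b = 0
      rw [b0, b1, lieBracket_affineField]; ext k; fin_cases k <;> simp
    · change VectorField.lieBracket ℝ (canonical (.inl 2) 0) (canonical (.inl 2) 1) b = 0
      rw [c0, c1, lieBracket_affineField]; ext k; fin_cases k <;> simp
  · fin_cases i
    · change VectorField.lieBracket ℝ (canonical (.inr 0) 0) (canonical (.inr 0) 1) b =
        canonical (.inr 0) 1 b
      rw [d0, d1, lieBracket_affineField]; ext k; fin_cases k <;> simp [affineField]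
    · change VectorField.lieBracket ℝ (canonical (.inr 1) 0) (canonical (.inr 1) 1) b =
        canonical (.inr 1) 1 b
      rw [e0, e1, lieBracket_affineField]; ext k; fin_cases k <;> simp [affineField]
    · change VectorField.lieBracket ℝ (canonical (.inr 2) 0) (canonical (.inr 2) 1) b =
        canonical (.inr 2) 1 b
      rw [f0, f1, lieBracket_affineField]; ext k; fin_cases k <;> simp [affineField]
    · change VectorField.lieBracket ℝ (canonical (.inr 3) 0) (canonical (.inr 3) 1) b =
        canonical (.inr 3) 1 b
      rw [g0, g1, lieBracket_affineField]; ext k; fin_cases k <;> simp [affineField]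

lemma exists_add_smul_mem {n : ℕ} {W : Set (Fin n → ℝ)} (hW : IsOpen W) {b : Fin n → ℝ}
    (hb : b ∈ W) (v : Fin n → ℝ) : ∃ ε > 0, b + (ε : ℝ) • v ∈ W := by
  have hline : ContinuousAt (fun s : ℝ => b + s • v) 0 := by fun_prop
  have hev : ∀ᶠ s : ℝ in 𝓝 0, b + s • v ∈ W :=
    hline.eventually (p := fun y => y ∈ W) (by simpa using hW.mem_nhds hb)
  obtain ⟨ε, hε, hball⟩ := Metric.eventually_nhds_iff.1 hev
  exact ⟨ε / 2, by positivity, hball (by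
    rw [Real.dist_0_eq_abs, abs_of_pos (by positivity)]; linarith)⟩

lemma canonical_indep (i : Fin 3 ⊕ Fin 4) {W : Set Base} (hW : IsOpen W) (hne : W.Nonempty)
    (c : Fin 2 → ℝ) (hc : ∀ b ∈ W, ∑ k, c k • canonical i k b = 0) : c = 0 := by
  obtain ⟨b, hb⟩ := hne
  -- Rows with a generator whose coefficients vary need two points: moving all coordinates by the
  -- same amount isolates the factor of that generator.
  obtain ⟨ε, hε, hb'⟩ := exists_add_smul_mem hW hb (fun _ => 1)
  have h1 := hc b hb
  have h2 := hc _ hb'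
  have h : c 0 = 0 ∧ c 1 = 0 := by
    have aux : ∀ x : ℝ, -(c 0 * x) + c 1 = 0 → c 0 * (-ε + -x) + c 1 = 0 → c 0 = 0 ∧ c 1 = 0 := by
      intro x h1 h2
      have h3 : c 0 * ε = 0 := by linarith
      have h4 := (mul_eq_zero.1 h3).resolve_right hε.ne'
      rw [h4] at h1
      exact ⟨h4, by linarith⟩
    have t1 := congrFun h1 0
    have t2 := congrFun h2 0
    have x1 := congrFun h1 1
    have x2 := congrFun h2 1
    have u1 := congrFun h1 2
    have u2 := congrFun h2 2
    rw [Fin.sum_univ_two] at t1 t2 x1 x2 u1 u2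
    rcases i with i | i <;> fin_cases i <;>
      simp only [canonical, Sum.elim_inl, Sum.elim_inr, Pi.add_apply, Pi.smul_apply, smul_eq_mul,
        Pi.zero_apply] at t1 t2 x1 x2 u1 u2 <;>
      simp at t1 t2 x1 x2 u1 u2
    · exact ⟨t1, x1⟩
    · exact ⟨x1, u1⟩
    · have h3 : c 1 * ε = 0 := by linarith
      have h4 := (mul_eq_zero.1 h3).resolve_right hε.ne'
      rw [h4] at u1
      exact ⟨by linarith, h4⟩
    · exact aux _ t1 t2
    · exact aux _ x1 x2
    · exact aux _ x1 x2
    · exact aux _ x1 x2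
  ext k
  fin_cases k
  exacts [h.1, h.2]

lemma isTwoDimLieAlgebra_canonical (i : Fin 3 ⊕ Fin 4) :
    IsTwoDimLieAlgebra univ (canonical i) := by
  refine ⟨isOpen_univ, fun k => (contDiff_canonical i k).contDiffOn, fun W _ hW hne c hc =>
    canonical_indep i hW hne c hc, ?_⟩
  rcases i with i | i
  · exact ⟨0, fun b _ => by rw [lieBracket_canonical]; simp⟩
  · exact ⟨![0, 1], fun b _ => by rw [lieBracket_canonical]; simp [Fin.sum_univ_two]⟩

lemma exists_equation_canonical (i : Fin 3 ⊕ Fin 4) :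
    ∃ (F G : Jet3 → ℝ) (Ω : Set Jet3), Ω.Nonempty ∧ IsEquation F G Ω ∧
      ∀ k, IsSymmetry F G Ω (canonical i k) := by
  have hc := isCoefficient_coeffF i
  -- The simplest equation of the row, with `f = 1` and `g = 0`.
  have hE : IsEquation (coeffF i) (fun _ => 0) (regular i) :=
    ⟨isOpen_regular i, hc.1, contDiffOn_const, hc.2.1⟩
  refine ⟨_, _, _, (dense_regular i).nonempty, hE,
    (isSymmetry_canonical_iff_hasTableForm i hE).2 fun B hB _ => ⟨fun z hz => (hB hz).2,
      fun _ => 1, fun _ => 0, contDiffOn_const, contDiffOn_const, fun z _ => by simp⟩⟩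

end Canonical

/-! ### Invariants that separate the seven algebras -/

section Inequivalence

/-- Whether all time components of the algebra vanish. -/
def timeFree : Fin 3 ⊕ Fin 4 → Bool :=
  Sum.elim ![false, true, true] ![false, false, true, true]

/-- Whether the orbits of the algebra have generic dimension one. -/
def rankOne : Fin 3 ⊕ Fin 4 → Bool := Sum.elim ![false, false, true] ![false, false, false, true]

/-- Whether the time component of the second generator vanishes. -/
def secondTimeFree : Fin 3 ⊕ Fin 4 → Bool :=
  Sum.elim ![true, true, true] ![false, true, true, true]

lemma timeFree_iff (i : Fin 3 ⊕ Fin 4) {b : Base} (hb : b 0 ≠ 0) :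
    (∀ k, canonical i k b 0 = 0) ↔ timeFree i = true := by
  rcases i with i | i <;> fin_cases i <;> simp [canonical, timeFree, Fin.forall_fin_two, hb]

lemma rankOne_iff (i : Fin 3 ⊕ Fin 4) (hi : timeFree i = true) {b : Base} (hb : b 2 ≠ 0) :
    (∃ c : Fin 2 → ℝ, c ≠ 0 ∧ ∑ k, c k • canonical i k b = 0) ↔ rankOne i = true := by
  have h0 : ∀ c : Fin 2 → ℝ, c ≠ 0 ↔ ¬ (c 0 = 0 ∧ c 1 = 0) := fun c => by
    rw [Ne, funext_iff, Fin.forall_fin_two]; rfl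
  have hv : ∀ v : Base, v = 0 ↔ v 0 = 0 ∧ v 1 = 0 ∧ v 2 = 0 := fun v => by
    rw [funext_iff, Fin.forall_fin_succ, Fin.forall_fin_two]; rfl
  simp only [h0, Fin.sum_univ_two, hv]
  rcases i with i | i <;> fin_cases i
  · simp [timeFree] at hi
  · simp [canonical, rankOne]
  · simp only [canonical, rankOne]
    simp
    exact ⟨![b 1, -1], by simp, by simp⟩
  · simp [timeFree] at hi
  · simp [timeFree] at hi
  · simp [canonical, rankOne, hb]
    intro c h1 h2 h3
    simp_all
  · simp only [canonical, rankOne]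
    simp
    exact ⟨![1, b 1], by simp, by simp⟩

lemma secondTimeFree_iff (i : Fin 3 ⊕ Fin 4) (hi : i.isLeft = false) (b : Base) :
    canonical i 1 b 0 = 0 ↔ secondTimeFree i = true := by
  rcases i with i | i
  · simp at hi
  · fin_cases i <;> simp [canonical, secondTimeFree]

lemma canonical_one_ne_zero (i : Fin 4) (b : Base) : canonical (.inr i) 1 b ≠ 0 := by
  intro h
  have h0 := congrFun h 0
  have h1 := congrFun h 1
  fin_cases i <;> simp [canonical] at h0 h1

/-- The canonical algebras are pairwise inequivalent on every open set. -/
theorem canonical_inequivalent {i j : Fin 3 ⊕ Fin 4} (hij : i ≠ j) :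
    ¬ ∃ (W : Set Base) (φ : Base → Base), W.Nonempty ∧ IsEquivalence φ W ∧
        CarriesAlgebra φ W (canonical i) (canonical j) := by
  rintro ⟨W, φ, hne, hφ, A, hA, hpush⟩
  -- The properties compared are generic: a time component may vanish at `t = 0`, and the rank may
  -- drop at `u = 0`. A point is needed that avoids both, together with its image.
  have hgen : Dense ({b : Base | b 0 ≠ 0} ∩ {b | b 2 ≠ 0}) :=
    (dense_ne_zero 0).inter_of_isOpen_left (dense_ne_zero 2)
      (isOpen_ne_fun (continuous_apply 0) continuous_const)
  have hgo : IsOpen ({b : Base | b 0 ≠ 0} ∩ {b | b 2 ≠ 0}) :=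
    (isOpen_ne_fun (continuous_apply 0) continuous_const).inter
      (isOpen_ne_fun (continuous_apply 2) continuous_const)
  have hW' := hφ.mono (W' := W ∩ ({b : Base | b 0 ≠ 0} ∩ {b | b 2 ≠ 0})) inter_subset_left
    (hφ.isOpen.inter hgo)
  have hne' := hgen.inter_open_nonempty W hφ.isOpen hne
  obtain ⟨_, ⟨b, ⟨hbW, hb0, hb2⟩, rfl⟩, hy0, hy2⟩ := hgen.inter_open_nonempty _
    (exists_smooth_inverse hW'.isOpen hW'.smooth hW'.injOn hW'.det_ne_zero).1 (hne'.image φ)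
  have hinj : ∀ v, fderiv ℝ φ b v = 0 ↔ v = 0 := fun v =>
    ⟨eq_zero_of_det_ne_zero (hφ.det_ne_zero b hbW), fun h => by rw [h, map_zero]⟩
  have hAinj : ∀ c : Fin 2 → ℝ, Matrix.vecMul c A = 0 → c = 0 := fun c hc =>
    Matrix.eq_zero_of_vecMul_eq_zero hA hc
  have hAinv : ∀ c' : Fin 2 → ℝ, ∃ c, Matrix.vecMul c A = c' := fun c' =>
    ⟨Matrix.vecMul c' A⁻¹, by
      rw [Matrix.vecMul_vecMul, Matrix.nonsing_inv_mul _ (isUnit_iff_ne_zero.2 hA),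
        Matrix.vecMul_one]⟩
  have htime : ∀ v, fderiv ℝ φ b v 0 = 0 ↔ v 0 = 0 := fun v => by
    rw [hφ.fderiv_apply hbW, hφ.isTimeOnly.apply hbW, mul_eq_zero,
      or_iff_left (hφ.fderiv_time hbW)]
  have hcomb : ∀ c : Fin 2 → ℝ, fderiv ℝ φ b (∑ k, c k • canonical i k b) =
      ∑ l, Matrix.vecMul c A l • canonical j l (φ b) := by
    intro c
    simp only [Fin.sum_univ_two, map_add, map_smul, hpush b hbW, Matrix.vecMul, dotProduct]
    module
  -- Brackets are multiplied by the determinant of the change of basis. Hence being Abelian is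
  -- preserved, and in the non-Abelian case the second generator, which spans the derived algebra,
  -- is carried to a nonzero multiple of the second generator.
  have hbr : fderiv ℝ φ b (VectorField.lieBracket ℝ (canonical i 0) (canonical i 1) b) =
      A.det • VectorField.lieBracket ℝ (canonical j 0) (canonical j 1) (φ b) := by
    have d := fun i k b => (contDiff_canonical i k).differentiable (by simp) b
    rw [lieBracket_push hφ.isOpen hφ.smooth hbW (d i 0 b) (d i 1 b)
      (X' := fun b => A 0 0 • canonical j 0 b + A 0 1 • canonical j 1 b)
      (Y' := fun b => A 1 0 • canonical j 0 b + A 1 1 • canonical j 1 b)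
      (((d j 0 _).fun_const_smul _).fun_add ((d j 1 _).fun_const_smul _))
      (((d j 0 _).fun_const_smul _).fun_add ((d j 1 _).fun_const_smul _))
      (fun b hb => by rw [hpush b hb, Fin.sum_univ_two])
      (fun b hb => by rw [hpush b hb, Fin.sum_univ_two]),
      lieBracket_comb (d j 0 _) (d j 1 _), Matrix.det_fin_two]
  rw [lieBracket_canonical, lieBracket_canonical] at hbr
  have h1 : i.isLeft = j.isLeft := by
    rcases i with i | i <;> rcases j with j | j
    · rfl
    · simp only [Sum.elim_inl, Sum.elim_inr, map_zero] at hbr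
      exact absurd (hbr.symm) (smul_ne_zero hA (canonical_one_ne_zero j _))
    · simp only [Sum.elim_inl, Sum.elim_inr, smul_zero] at hbr
      exact absurd ((hinj _).1 hbr) (canonical_one_ne_zero i _)
    · rfl
  have h2 : timeFree i = timeFree j := by
    rw [Bool.eq_iff_iff, ← timeFree_iff i hb0, ← timeFree_iff j hy0]
    constructor
    · intro h k
      obtain ⟨c, hc⟩ := hAinv (Pi.single k 1)
      have := hcomb c
      rw [hc] at this
      have e : ∑ l, (Pi.single k 1 : Fin 2 → ℝ) l • canonical j l (φ b) = canonical j k (φ b) := by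
        simp [Pi.single_apply, ite_smul]
      rw [← e, ← this, htime]
      simp [Finset.sum_apply, h]
    · intro h k
      rw [← htime, hpush b hbW]
      simp [Finset.sum_apply, h]
  have h3 : timeFree i = true → rankOne i = rankOne j := by
    intro hi
    rw [Bool.eq_iff_iff, ← rankOne_iff i hi hb2, ← rankOne_iff j (h2 ▸ hi) hy2]
    constructor
    · rintro ⟨c, hc0, hc⟩
      exact ⟨Matrix.vecMul c A, fun h => hc0 (hAinj c h), by rw [← hcomb, hc, map_zero]⟩
    · rintro ⟨c', hc0, hc⟩
      obtain ⟨c, rfl⟩ := hAinv c'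
      refine ⟨c, fun h => hc0 (by rw [h, Matrix.zero_vecMul]), ?_⟩
      rwa [← hcomb, hinj] at hc
  have h4 : i.isLeft = false → secondTimeFree i = secondTimeFree j := by
    intro hi
    rw [Bool.eq_iff_iff, ← secondTimeFree_iff i hi b, ← secondTimeFree_iff j (h1 ▸ hi) (φ b)]
    rcases i with i | i
    · simp at hi
    rcases j with j | j
    · simp at h1
    simp only [Sum.elim_inr] at hbr
    rw [← htime, hbr]
    simp [hA]
  -- A finite check that the four properties determine the row; the rank is compared only among
  -- algebras without time components.
  have hfin : ∀ i j : Fin 3 ⊕ Fin 4, i.isLeft = j.isLeft → timeFree i = timeFree j →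
      (timeFree i = true → rankOne i = rankOne j) →
      (i.isLeft = false → secondTimeFree i = secondTimeFree j) → i = j := by decide
  exact hij (hfin i j h1 h2 h3 h4)

end Inequivalence

/-! ### Linear combinations of symmetries and passage to the table -/

section Combination

/-- In the form with the derivative of the defect the criterion is linear in the field. Combinations
are needed because a transformation carries the given basis to the canonical one only up to a
matrix. -/
lemma IsSymmetry.smul_add {F G : Jet3 → ℝ} {Ω : Set Jet3} (hE : IsEquation F G Ω)
    {V₁ V₂ : Base → Base} (h₁ : ContDiffOn ℝ ∞ V₁ (base3 '' Ω)) (h₂ : ContDiffOn ℝ ∞ V₂ (base3 '' Ω))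
    (s₁ : IsSymmetry F G Ω V₁) (s₂ : IsSymmetry F G Ω V₂) (a c : ℝ) :
    IsSymmetry F G Ω fun b => a • V₁ b + c • V₂ b := by
  have hM : IsOpen (base3 '' Ω) := isOpenMap_base3 _ hE.isOpen
  have t₁ := s₁.isTimeOnly hE h₁
  have t₂ := s₂.isTimeOnly hE h₂
  have ht : IsTimeOnly (fun b => (a • V₁ b + c • V₂ b) 0) (base3 '' Ω) := by
    intro b hb
    have d₁ := (contDiffOn_component h₁ 0).differentiableAt_of_isOpen hM hb
    have d₂ := (contDiffOn_component h₂ 0).differentiableAt_of_isOpen hM hb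
    have e : fderiv ℝ (fun b => (a • V₁ b + c • V₂ b) 0) b =
        a • fderiv ℝ (fun b => V₁ b 0) b + c • fderiv ℝ (fun b => V₂ b 0) b := by
      simp only [Pi.add_apply, Pi.smul_apply]
      rw [fderiv_fun_add (d₁.fun_const_smul a) (d₂.fun_const_smul c), fderiv_fun_const_smul d₁,
        fderiv_fun_const_smul d₂]
    rw [e]
    simp [(t₁ b hb).1, (t₁ b hb).2, (t₂ b hb).1, (t₂ b hb).2]
  rw [isSymmetry_iff_fderiv_defect hE hM subset_rfl h₁ t₁] at s₁
  rw [isSymmetry_iff_fderiv_defect hE hM subset_rfl h₂ t₂] at s₂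
  rw [isSymmetry_iff_fderiv_defect hE hM subset_rfl ((h₁.const_smul a).add (h₂.const_smul c)) ht]
  intro j hj hj0
  rw [prolongation_smul_add hM h₁ h₂ a c ⟨_, hj, rfl⟩, map_add, map_smul, map_smul, s₁ j hj hj0,
    s₂ j hj hj0]
  simp

/-- An equation whose symmetry algebra is carried to a canonical one is carried to an equation in
the row of this algebra, near generic points. -/
theorem exists_tableForm {F G : Jet3 → ℝ} {Ω : Set Jet3} (hE : IsEquation F G Ω)
    {V : Fin 2 → Base → Base} (hV : ∀ k, ContDiffOn ℝ ∞ (V k) (base3 '' Ω))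
    (hsym : ∀ k, IsSymmetry F G Ω (V k)) {Ω₀ : Set Jet3} (hsub : Ω₀ ⊆ Ω) (hΩ₀ : IsOpen Ω₀)
    (hne : Ω₀.Nonempty) {φ : Base → Base} (hφ : IsEquivalence φ (base3 '' Ω₀))
    {i : Fin 3 ⊕ Fin 4} (hc : CarriesAlgebra φ (base3 '' Ω₀) V (canonical i)) :
    ∃ Ω₁ ⊆ Ω₀, IsOpen Ω₁ ∧ Ω₁.Nonempty ∧ IsEquivalence φ (base3 '' Ω₁) ∧
      CarriesAlgebra φ (base3 '' Ω₁) V (canonical i) ∧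
      ∃ (F' G' : Jet3 → ℝ) (Ω' : Set Jet3), IsEquation F' G' Ω' ∧
        CarriesEquation φ F G Ω₁ F' G' Ω' ∧ HasTableForm i F' G' Ω' := by
  obtain ⟨Ω₁, hΩ₁, ho, hne₁, F', G', Ω', hE', hcar, hbox, hreg, hpush⟩ :=
    hφ.exists_carriesEquation hE hsub hΩ₀ hne subset_rfl (isOpen_regular i) (dense_regular i)
  obtain ⟨A, hA, hAV⟩ := hc
  refine ⟨Ω₁, hΩ₁, ho, hne₁, hφ.mono (image_mono hΩ₁) (isOpenMap_base3 _ ho),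
    ⟨A, hA, fun b hb => hAV b (image_mono hΩ₁ hb)⟩, F', G', Ω', hE', hcar, ?_⟩
  refine (isSymmetry_canonical_iff_hasTableForm i hE').1 (fun l => ?_) Ω'
    (subset_inter subset_rfl hreg) hbox
  -- The combination with a row of the inverse matrix is carried exactly to the corresponding
  -- canonical generator.
  refine hpush (fun b => A⁻¹ l 0 • V 0 b + A⁻¹ l 1 • V 1 b) _
    (((hV 0).const_smul _).add ((hV 1).const_smul _))
    (IsSymmetry.smul_add hE (hV 0) (hV 1) (hsym 0) (hsym 1) _ _)
    (contDiff_canonical i l).contDiffOn (isTimeOnly_canonical i l) fun b hb => ?_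
  have hinv : A⁻¹ * A = 1 := Matrix.nonsing_inv_mul _ (isUnit_iff_ne_zero.2 hA)
  have e : ∀ m, A⁻¹ l 0 * A 0 m + A⁻¹ l 1 * A 1 m = (1 : Matrix (Fin 2) (Fin 2) ℝ) l m := fun m => by
    rw [← hinv, Matrix.mul_apply, Fin.sum_univ_two]
  have e0 := e 0
  have e1 := e 1
  rw [map_add, map_smul, map_smul, hAV b hb.1, hAV b hb.1, Fin.sum_univ_two, Fin.sum_univ_two]
  have : A⁻¹ l 0 • (A 0 0 • canonical i 0 (φ b) + A 0 1 • canonical i 1 (φ b)) +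
      A⁻¹ l 1 • (A 1 0 • canonical i 0 (φ b) + A 1 1 • canonical i 1 (φ b)) =
      (A⁻¹ l 0 * A 0 0 + A⁻¹ l 1 * A 1 0) • canonical i 0 (φ b)
        + (A⁻¹ l 0 * A 0 1 + A⁻¹ l 1 * A 1 1) • canonical i 1 (φ b) := by module
  rw [this, e0, e1]
  rcases (by fin_cases l <;> simp : l = 0 ∨ l = 1) with rfl | rfl <;> simp

end Combination

/-! ### Local construction and composition of equivalence transformations -/

section Equivalences

variable {φ ψ : Base → Base} {W W' : Set Base} {f : Base → ℝ}

lemma IsTimeOnly.eq_of_convex {B : Set Base} (hB : Convex ℝ B) (h : IsTimeOnly f B)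
    (hd : ∀ b ∈ B, DifferentiableAt ℝ f b) {b b' : Base} (hb : b ∈ B) (hb' : b' ∈ B)
    (h0 : b 0 = b' 0) : f b = f b' := by
  have e : b + (1 : ℝ) • (b' - b) = b' := by rw [one_smul]; abel
  have := apply_add_smul_eq hB (v := b' - b) hd (fun x hx => by rw [h.apply hx]; simp [h0]) hb
    (s := 1) (by rwa [e])
  rw [e] at this
  exact this.symm

/-- On a ball a component with vanishing `x`- and `u`-derivatives is a function of the time: its
value may be read off at the `x` and `u` of the centre, which stays in the ball of the supremum
norm. -/
lemma exists_isEquivalence {U : Set Base} (hU : IsOpen U) (hφ : ContDiffOn ℝ ∞ φ U)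
    (ht : IsTimeOnly (fun b => φ b 0) U) {p : Base} (hp : p ∈ U) (hdet : (fderiv ℝ φ p).det ≠ 0) :
    ∃ W ⊆ U, p ∈ W ∧ IsEquivalence φ W := by
  obtain ⟨W, hWU, hW, hpW, hinj, hdW⟩ := exists_injOn_nhd hU hφ hp hdet
  obtain ⟨ε, hε, hball⟩ := Metric.isOpen_iff.1 hW p hpW
  refine ⟨Metric.ball p ε, hball.trans hWU, Metric.mem_ball_self hε, Metric.isOpen_ball,
    hφ.mono (hball.trans hWU), hinj.mono hball, fun b hb => hdW b (hball hb),
    fun t => φ ![t, p 1, p 2] 0, fun b hb => ?_⟩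
  refine (ht.mono (hball.trans hWU)).eq_of_convex (convex_ball p ε) (fun b hb =>
    (contDiffOn_component hφ 0).differentiableAt_of_isOpen hU (hWU (hball hb))) hb ?_ rfl
  rw [Metric.mem_ball, dist_pi_lt_iff hε] at hb ⊢
  intro k
  fin_cases k
  · exact hb 0
  · simpa using hε
  · simpa using hε

lemma IsEquivalence.isOpen_image (h : IsEquivalence φ W) : IsOpen (φ '' W) :=
  (exists_smooth_inverse h.isOpen h.smooth h.injOn h.det_ne_zero).1

lemma IsEquivalence.comp (hψ : IsEquivalence ψ W') (hφ : IsEquivalence φ W) (hm : MapsTo φ W W') :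
    IsEquivalence (fun b => ψ (φ b)) W := by
  have hd : ∀ b ∈ W, fderiv ℝ (fun b => ψ (φ b)) b = (fderiv ℝ ψ (φ b)).comp (fderiv ℝ φ b) :=
    fun b hb => fderiv_comp b (hψ.smooth.differentiableAt_of_isOpen hψ.isOpen (hm hb))
      (hφ.smooth.differentiableAt_of_isOpen hφ.isOpen hb)
  refine ⟨hφ.isOpen, hψ.smooth.comp hφ.smooth hm, hψ.injOn.comp hφ.injOn hm, fun b hb => ?_, ?_⟩
  · refine det_ne_zero_of_forall fun v hv => ?_
    rw [hd b hb] at hv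
    exact eq_zero_of_det_ne_zero (hφ.det_ne_zero b hb)
      (eq_zero_of_det_ne_zero (hψ.det_ne_zero _ (hm hb)) hv)
  · obtain ⟨T, hT⟩ := hφ.time
    obtain ⟨T', hT'⟩ := hψ.time
    exact ⟨fun t => T' (T t), fun b hb => by rw [hT' _ (hm hb), hT b hb]⟩

lemma IsEquivalence.fderiv_comp_apply (hψ : IsEquivalence ψ W') (hφ : IsEquivalence φ W)
    (hm : MapsTo φ W W') {b : Base} (hb : b ∈ W) (v : Base) :
    fderiv ℝ (fun b => ψ (φ b)) b v = fderiv ℝ ψ (φ b) (fderiv ℝ φ b v) := by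
  have := fderiv_comp b (hψ.smooth.differentiableAt_of_isOpen hψ.isOpen (hm hb))
      (hφ.smooth.differentiableAt_of_isOpen hφ.isOpen hb)
  exact congrArg (fun A : Base →L[ℝ] Base => A v) this

/-- A function is a function of the time alone if its composition with a transformation is. -/
lemma IsEquivalence.isTimeOnly_image (h : IsEquivalence φ W)
    (hf : ∀ b ∈ W, DifferentiableAt ℝ f (φ b)) (ht : IsTimeOnly (fun b => f (φ b)) W) :
    IsTimeOnly f (φ '' W) := by
  rintro _ ⟨b, hb, rfl⟩
  have hsurj : Function.Surjective (fderiv ℝ φ b) := by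
    have hinj : Function.Injective (fderiv ℝ φ b : Base →ₗ[ℝ] Base) := by
      rw [injective_iff_map_eq_zero]
      exact fun v hv => eq_zero_of_det_ne_zero (h.det_ne_zero b hb) hv
    exact LinearMap.injective_iff_surjective.1 hinj
  have key : ∀ v : Base, v 0 = 0 → fderiv ℝ f (φ b) v = 0 := by
    intro v hv
    obtain ⟨w, rfl⟩ := hsurj v
    rw [h.fderiv_apply hb, h.isTimeOnly.apply hb] at hv
    have hw := (mul_eq_zero.1 hv).resolve_right (h.fderiv_time hb)
    have e := fderiv_comp b (hf b hb) (h.smooth.differentiableAt_of_isOpen h.isOpen hb)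
    have e' := congrArg (fun A : Base →L[ℝ] ℝ => A w) e
    have e2 := ht.apply hb w
    rw [hw, zero_mul] at e2
    exact e'.symm.trans e2
  exact ⟨key _ (by simp), key _ (by simp)⟩

lemma IsEquivalence.isTimeOnly_comp (h : IsEquivalence φ W)
    (hf : ∀ b ∈ W, DifferentiableAt ℝ f (φ b)) (ht : IsTimeOnly f (φ '' W)) :
    IsTimeOnly (fun b => f (φ b)) W := by
  intro b hb
  have e := fderiv_comp b (hf b hb) (h.smooth.differentiableAt_of_isOpen h.isOpen hb)
  have key : ∀ v : Base, v 0 = 0 → fderiv ℝ (fun b => f (φ b)) b v = 0 := by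
    intro v hv
    have e' := congrArg (fun A : Base →L[ℝ] ℝ => A v) e
    refine e'.trans ?_
    rw [ContinuousLinearMap.comp_apply, ht.apply (mem_image_of_mem φ hb), h.fderiv_apply hb,
      h.isTimeOnly.apply hb, hv, zero_mul, zero_mul]
  exact ⟨key _ (by simp), key _ (by simp)⟩

end Equivalences

/-! ### Pairs of fields and their reduction to canonical form -/

section Pairs

/-- `X` and `Y` are not proportional on any open set, even with coefficients depending on time. -/
def NotProportional (W : Set Base) (X Y : Base → Base) : Prop :=
  ∀ W' ⊆ W, IsOpen W' → W'.Nonempty → ∀ h k : Base → ℝ, ContDiffOn ℝ ∞ h W' → ContDiffOn ℝ ∞ k W' →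
    IsTimeOnly h W' → IsTimeOnly k W' → (∀ b ∈ W', h b • X b + k b • Y b = 0) →
      ∀ b ∈ W', h b = 0 ∧ k b = 0

/-- A basis of a two-dimensional algebra that may occur as a symmetry algebra, with
`[X, Y] = c Y`. -/
structure IsPair (W : Set Base) (X Y : Base → Base) (c : ℝ) : Prop where
  isOpen : IsOpen W
  nonempty : W.Nonempty
  smooth_fst : ContDiffOn ℝ ∞ X W
  smooth_snd : ContDiffOn ℝ ∞ Y W
  time_fst : IsTimeOnly (fun b => X b 0) W
  time_snd : IsTimeOnly (fun b => Y b 0) W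
  bracket : ∀ b ∈ W, VectorField.lieBracket ℝ X Y b = c • Y b
  notProportional : NotProportional W X Y

variable {φ : Base → Base} {W W' : Set Base} {X Y X' Y' : Base → Base} {c : ℝ}

lemma NotProportional.mono (h : NotProportional W X Y) (hW : W' ⊆ W) : NotProportional W' X Y :=
  fun W'' hW'' => h W'' (hW''.trans hW)

lemma IsPair.mono (h : IsPair W X Y c) (hW : W' ⊆ W) (ho : IsOpen W') (hne : W'.Nonempty) :
    IsPair W' X Y c :=
  ⟨ho, hne, h.smooth_fst.mono hW, h.smooth_snd.mono hW, h.time_fst.mono hW, h.time_snd.mono hW,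
    fun b hb => h.bracket b (hW hb), h.notProportional.mono hW⟩

lemma IsEquivalence.exists_push (h : IsEquivalence φ W) (hX : ContDiffOn ℝ ∞ X W) :
    ∃ X', ContDiffOn ℝ ∞ X' (φ '' W) ∧ ∀ b ∈ W, fderiv ℝ φ b (X b) = X' (φ b) := by
  obtain ⟨-, g, hg, hgφ⟩ := exists_smooth_inverse h.isOpen h.smooth h.injOn h.det_ne_zero
  have hm : MapsTo g (φ '' W) W := by
    rintro _ ⟨b, hb, rfl⟩
    rwa [hgφ b hb]
  refine ⟨fun y => fderiv ℝ φ (g y) (X (g y)), ?_, fun b hb => by simp only [hgφ b hb]⟩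
  exact ((h.smooth.fderiv_infty h.isOpen).comp hg hm).clm_apply (hX.comp hg hm)

/-- The new time component is `τ T_t`. Since `T_x` and `T_u` vanish identically, symmetry of second
derivatives shows that `T_t` depends on the time only. -/
lemma IsEquivalence.isTimeOnly_push (h : IsEquivalence φ W) (hX : ContDiffOn ℝ ∞ X W)
    (hX' : ContDiffOn ℝ ∞ X' (φ '' W)) (p : ∀ b ∈ W, fderiv ℝ φ b (X b) = X' (φ b))
    (ht : IsTimeOnly (fun b => X b 0) W) : IsTimeOnly (fun b => X' b 0) (φ '' W) := by
  refine h.isTimeOnly_image (fun b hb => (contDiffOn_component hX' 0).differentiableAt_of_isOpen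
    h.isOpen_image (mem_image_of_mem φ hb)) ?_
  intro b hb
  have h0 := contDiffOn_component h.smooth 0
  have dd := (h0.fderiv_infty h.isOpen).differentiableAt_of_isOpen h.isOpen hb
  have dX := (contDiffOn_component hX 0).differentiableAt_of_isOpen h.isOpen hb
  have hs : IsSymmSndFDerivAt ℝ (fun b => φ b 0) b :=
    (h0.contDiffAt (h.isOpen.mem_nhds hb)).isSymmSndFDerivAt
      (by simp; exact WithTop.coe_le_coe.2 le_top)
  have dD : DifferentiableAt ℝ (fun b => fderiv ℝ (fun b => φ b 0) b (Pi.single 0 1)) b :=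
    dd.clm_apply (differentiableAt_const _)
  have e : (fun b => X' (φ b) 0) =ᶠ[𝓝 b]
      fun b => X b 0 * fderiv ℝ (fun b => φ b 0) b (Pi.single 0 1) := by
    filter_upwards [h.isOpen.mem_nhds hb] with b hb
    rw [← p b hb, h.fderiv_apply hb, h.isTimeOnly.apply hb]
  have hsnd : ∀ v : Base, fderiv ℝ (fun b => fderiv ℝ (fun b => φ b 0) b v) b =
      (fderiv ℝ (fderiv ℝ fun b => φ b 0) b).flip v := fun v => by
    rw [fderiv_clm_apply dd (differentiableAt_const _)]; simp
  have hz : ∀ k : Fin 3, (∀ b ∈ W, fderiv ℝ (fun b => φ b 0) b (Pi.single k 1) = 0) →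
      fderiv ℝ (fun b => fderiv ℝ (fun b => φ b 0) b (Pi.single 0 1)) b (Pi.single k 1) = 0 := by
    intro k hk
    have e1 : (fun b => fderiv ℝ (fun b => φ b 0) b (Pi.single k 1)) =ᶠ[𝓝 b] fun _ => (0 : ℝ) := by
      filter_upwards [h.isOpen.mem_nhds hb] with b hb using hk b hb
    have e2 := congrArg (fun A : Base →L[ℝ] ℝ => A (Pi.single 0 1)) e1.fderiv_eq
    rw [hsnd] at e2 ⊢
    simp only [ContinuousLinearMap.flip_apply] at e2 ⊢
    rw [hs]
    simpa using e2
  rw [e.fderiv_eq, fderiv_fun_mul dX dD]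
  have t := h.isTimeOnly
  simp [(ht b hb).1, (ht b hb).2, hz 1 fun b hb => (t b hb).1, hz 2 fun b hb => (t b hb).2]

/-- `NotProportional` is preserved because composition with an equivalence transformation takes
functions of the new time to functions of the old time, so a relation between the images pulls back.
-/
lemma IsPair.push (h : IsPair W X Y c) (hφ : IsEquivalence φ W)
    (hX' : ContDiffOn ℝ ∞ X' (φ '' W)) (hY' : ContDiffOn ℝ ∞ Y' (φ '' W))
    (pX : ∀ b ∈ W, fderiv ℝ φ b (X b) = X' (φ b))
    (pY : ∀ b ∈ W, fderiv ℝ φ b (Y b) = Y' (φ b)) : IsPair (φ '' W) X' Y' c := by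
  have ho := hφ.isOpen_image
  refine ⟨ho, h.nonempty.image φ, hX', hY', hφ.isTimeOnly_push h.smooth_fst hX' pX h.time_fst,
    hφ.isTimeOnly_push h.smooth_snd hY' pY h.time_snd, ?_, ?_⟩
  · rintro _ ⟨b, hb, rfl⟩
    rw [← lieBracket_push hφ.isOpen hφ.smooth hb (h.smooth_fst.differentiableAt_of_isOpen h.isOpen hb)
      (h.smooth_snd.differentiableAt_of_isOpen h.isOpen hb)
      (hX'.differentiableAt_of_isOpen ho (mem_image_of_mem φ hb))
      (hY'.differentiableAt_of_isOpen ho (mem_image_of_mem φ hb)) pX pY, h.bracket b hb, map_smul,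
      pY b hb]
  · intro W' hW' hWo hne f k hf hk tf tk hfk
    have hpre : IsOpen (W ∩ φ ⁻¹' W') := hφ.smooth.continuousOn.isOpen_inter_preimage hφ.isOpen hWo
    have himg : φ '' (W ∩ φ ⁻¹' W') = W' := by
      rw [image_inter_preimage, inter_eq_right.2 hW']
    have hφ' := hφ.mono (W' := W ∩ φ ⁻¹' W') inter_subset_left hpre
    have d : ∀ {f : Base → ℝ}, ContDiffOn ℝ ∞ f W' → ∀ b ∈ W ∩ φ ⁻¹' W',
        DifferentiableAt ℝ f (φ b) := fun hf b hb => hf.differentiableAt_of_isOpen hWo hb.2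
    have hne' : (W ∩ φ ⁻¹' W').Nonempty := by
      rw [← image_nonempty (f := φ), himg]; exact hne
    have := h.notProportional (W ∩ φ ⁻¹' W') inter_subset_left hpre hne'
      (fun b => f (φ b)) (fun b => k (φ b)) (hf.comp hφ'.smooth fun b hb => hb.2)
      (hk.comp hφ'.smooth fun b hb => hb.2)
      (hφ'.isTimeOnly_comp (d hf) (by rwa [himg])) (hφ'.isTimeOnly_comp (d hk) (by rwa [himg]))
      (fun b hb => eq_zero_of_det_ne_zero (hφ.det_ne_zero b hb.1) (by
        rw [map_add, map_smul, map_smul, pX b hb.1, pY b hb.1]; exact hfk _ hb.2))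
    intro y hy
    rw [← himg] at hy
    obtain ⟨b, hb, rfl⟩ := hy
    exact this b hb

lemma IsTimeOnly.comb {f g : Base → ℝ} (hf : IsTimeOnly f W) (hg : IsTimeOnly g W)
    (df : ∀ b ∈ W, DifferentiableAt ℝ f b) (dg : ∀ b ∈ W, DifferentiableAt ℝ g b) (p q : ℝ) :
    IsTimeOnly (fun b => p * f b + q * g b) W := by
  intro b hb
  rw [fderiv_fun_add ((df b hb).const_mul p) ((dg b hb).const_mul q), fderiv_const_mul (df b hb),
    fderiv_const_mul (dg b hb)]
  simp [(hf b hb).1, (hf b hb).2, (hg b hb).1, (hg b hb).2]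

/-- A change of basis. -/
lemma NotProportional.comb {p q r s : ℝ} (h : NotProportional W X Y) (hdet : p * s - q * r ≠ 0) :
    NotProportional W (fun b => p • X b + q • Y b) (fun b => r • X b + s • Y b) := by
  intro W' hW' hWo hne f k hf hk tf tk hfk b hb
  have df : ∀ b ∈ W', DifferentiableAt ℝ f b := fun b hb => hf.differentiableAt_of_isOpen hWo hb
  have dk : ∀ b ∈ W', DifferentiableAt ℝ k b := fun b hb => hk.differentiableAt_of_isOpen hWo hb
  obtain ⟨h1, h2⟩ := h W' hW' hWo hne (fun b => p * f b + r * k b)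
    (fun b => q * f b + s * k b) ((contDiffOn_const.mul hf).add (contDiffOn_const.mul hk))
    ((contDiffOn_const.mul hf).add (contDiffOn_const.mul hk))
    (tf.comb tk df dk p r) (tf.comb tk df dk q s)
    (fun b hb => by rw [← hfk b hb]; module) b hb
  constructor
  · refine (mul_eq_zero.1 (?_ : (p * s - q * r) * f b = 0)).resolve_left hdet
    linear_combination s * h1 - r * h2
  · refine (mul_eq_zero.1 (?_ : (p * s - q * r) * k b = 0)).resolve_left hdet
    linear_combination p * h2 - q * h1

/-- A change of basis, from a basis with an arbitrary commutation relation to a pair. -/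
lemma NotProportional.isPair_comb {c p q r s : ℝ} (h : NotProportional W X Y) (hW : IsOpen W)
    (hne : W.Nonempty) (hX : ContDiffOn ℝ ∞ X W) (hY : ContDiffOn ℝ ∞ Y W)
    (tX : IsTimeOnly (fun b => X b 0) W) (tY : IsTimeOnly (fun b => Y b 0) W)
    (hdet : p * s - q * r ≠ 0) (hc : ∀ b ∈ W,
      (p * s - q * r) • VectorField.lieBracket ℝ X Y b = c • (r • X b + s • Y b)) :
    IsPair W (fun b => p • X b + q • Y b) (fun b => r • X b + s • Y b) c := by
  have dX0 : ∀ b ∈ W, DifferentiableAt ℝ (fun b => X b 0) b := fun b hb =>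
    (contDiffOn_component hX 0).differentiableAt_of_isOpen hW hb
  have dY0 : ∀ b ∈ W, DifferentiableAt ℝ (fun b => Y b 0) b := fun b hb =>
    (contDiffOn_component hY 0).differentiableAt_of_isOpen hW hb
  refine ⟨hW, hne, (hX.const_smul p).add (hY.const_smul q),
    (hX.const_smul r).add (hY.const_smul s), tX.comb tY dX0 dY0 p q, tX.comb tY dX0 dY0 r s,
    fun b hb => ?_, h.comb hdet⟩
  rw [lieBracket_comb (hX.differentiableAt_of_isOpen hW hb) (hY.differentiableAt_of_isOpen hW hb),
    hc b hb]

lemma IsPair.comb {c' p q r s : ℝ} (h : IsPair W X Y c) (hdet : p * s - q * r ≠ 0)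
    (hc : ∀ b ∈ W, (p * s - q * r) • c • Y b = c' • (r • X b + s • Y b)) :
    IsPair W (fun b => p • X b + q • Y b) (fun b => r • X b + s • Y b) c' :=
  h.notProportional.isPair_comb h.isOpen h.nonempty h.smooth_fst h.smooth_snd h.time_fst
    h.time_snd hdet fun b hb => by rw [h.bracket b hb, hc b hb]

/-- Somewhere in `W` the algebra can be carried to a canonical one. -/
def IsReducible (W : Set Base) (X Y : Base → Base) (abelian : Bool) : Prop :=
  ∃ i : Fin 3 ⊕ Fin 4, i.isLeft = abelian ∧ ∃ W' ⊆ W, W'.Nonempty ∧ ∃ φ, IsEquivalence φ W' ∧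
    CarriesAlgebra φ W' ![X, Y] (canonical i)

variable {a : Bool}

lemma IsReducible.mono (h : IsReducible W' X Y a) (hW : W' ⊆ W) : IsReducible W X Y a := by
  obtain ⟨i, hi, W₁, hW₁, h⟩ := h
  exact ⟨i, hi, W₁, hW₁.trans hW, h⟩

lemma IsReducible.of_push (hφ : IsEquivalence φ W)
    (pX : ∀ b ∈ W, fderiv ℝ φ b (X b) = X' (φ b))
    (pY : ∀ b ∈ W, fderiv ℝ φ b (Y b) = Y' (φ b)) (h : IsReducible (φ '' W) X' Y' a) :
    IsReducible W X Y a := by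
  obtain ⟨i, hi, W', hW', hne, ψ, hψ, A, hA, hAV⟩ := h
  have hpre : IsOpen (W ∩ φ ⁻¹' W') :=
    hφ.smooth.continuousOn.isOpen_inter_preimage hφ.isOpen hψ.isOpen
  have himg : φ '' (W ∩ φ ⁻¹' W') = W' := by rw [image_inter_preimage, inter_eq_right.2 hW']
  have hm : MapsTo φ (W ∩ φ ⁻¹' W') W' := fun b hb => hb.2
  have hφ' := hφ.mono (W' := W ∩ φ ⁻¹' W') inter_subset_left hpre
  refine ⟨i, hi, W ∩ φ ⁻¹' W', inter_subset_left, ?_, _, hψ.comp hφ' hm, A, hA, fun b hb k => ?_⟩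
  · rw [← image_nonempty (f := φ), himg]; exact hne
  · rw [hψ.fderiv_comp_apply hφ' hm hb, ← hAV _ hb.2 k]
    fin_cases k
    exacts [congrArg _ (pX b hb.1), congrArg _ (pY b hb.1)]

lemma IsReducible.of_comb {p q r s : ℝ} (hdet : p * s - q * r ≠ 0)
    (h : IsReducible W (fun b => p • X b + q • Y b) (fun b => r • X b + s • Y b) a) :
    IsReducible W X Y a := by
  obtain ⟨i, hi, W', hW', hne, ψ, hψ, A, hA, hAV⟩ := h
  have hP : (!![p, q; r, s]).det ≠ 0 := by rw [Matrix.det_fin_two_of]; exact hdet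
  refine ⟨i, hi, W', hW', hne, ψ, hψ, (!![p, q; r, s])⁻¹ * A, ?_, fun b hb k => ?_⟩
  · rw [Matrix.det_mul]
    exact mul_ne_zero (by rw [Matrix.det_nonsing_inv, Ring.inverse_eq_inv]; exact inv_ne_zero hP) hA
  · have h0 := hAV b hb 0
    have h1 := hAV b hb 1
    simp only [Matrix.cons_val_zero, Matrix.cons_val_one, map_add, map_smul,
      Fin.sum_univ_two] at h0 h1
    rw [Matrix.inv_def, Matrix.adjugate_fin_two_of, Matrix.det_fin_two_of, Ring.inverse_eq_inv]
    have key : ∀ x y z w : Base, p • x + q • y = z → r • x + s • y = w →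
        x = (p * s - q * r)⁻¹ • (s • z - q • w) ∧ y = (p * s - q * r)⁻¹ • (p • w - r • z) := by
      rintro x y _ _ rfl rfl
      constructor
      · rw [show s • (p • x + q • y) - q • (r • x + s • y) = (p * s - q * r) • x by module,
          smul_smul, inv_mul_cancel₀ hdet, one_smul]
      · rw [show p • (r • x + s • y) - r • (p • x + q • y) = (p * s - q * r) • y by module,
          smul_smul, inv_mul_cancel₀ hdet, one_smul]
    obtain ⟨kx, ky⟩ := key _ _ _ _ h0 h1
    have hk : k = 0 ∨ k = 1 := by fin_cases k <;> simp
    rcases hk with rfl | rfl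
    · simp only [Matrix.cons_val_zero, kx, Fin.sum_univ_two, Matrix.mul_apply, Matrix.smul_apply,
        Matrix.of_apply, Matrix.cons_val_one, smul_eq_mul, Matrix.cons_val', Matrix.cons_val_fin_one]
      module
    · simp only [Matrix.cons_val_zero, ky, Fin.sum_univ_two, Matrix.mul_apply, Matrix.smul_apply,
        Matrix.of_apply, Matrix.cons_val_one, smul_eq_mul, Matrix.cons_val', Matrix.cons_val_fin_one]
      module

lemma isReducible_of_canonical (i : Fin 3 ⊕ Fin 4) (hi : i.isLeft = a) (hne : W.Nonempty)
    (hφ : IsEquivalence φ W) (pX : ∀ b ∈ W, fderiv ℝ φ b (X b) = canonical i 0 (φ b))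
    (pY : ∀ b ∈ W, fderiv ℝ φ b (Y b) = canonical i 1 (φ b)) : IsReducible W X Y a := by
  refine ⟨i, hi, W, subset_rfl, hne, φ, hφ, 1, by simp, fun b hb k => ?_⟩
  have hk : k = 0 ∨ k = 1 := by fin_cases k <;> simp
  rcases hk with rfl | rfl
  · simpa using pX b hb
  · simpa using pY b hb

end Pairs

/-! ### Symmetries proportional with a time-dependent factor -/

section Proportionality

variable {V : Base → Base} {W : Set Base} {h : Base → ℝ}

lemma Dt_smul (hW : IsOpen W) (hV : ContDiffOn ℝ ∞ V W) (hh : ContDiffOn ℝ ∞ h W) {j : Jet}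
    (hj : base j ∈ W) (k : Fin 3) :
    Dt (fun b => (h b • V b) k) j = h (base j) * Dt (fun b => V b k) j + V (base j) k * Dt h j := by
  have dV := (contDiffOn_component hV k).differentiableAt_of_isOpen hW hj
  have dh := hh.differentiableAt_of_isOpen hW hj
  simp only [Dt, Pi.smul_apply, smul_eq_mul]
  rw [fderiv_fun_mul dh dV]; simp

/-- The prolongation of a multiple of a vector field by a function of the time. -/
lemma prolongation_smul (hW : IsOpen W) (hV : ContDiffOn ℝ ∞ V W) (hh : ContDiffOn ℝ ∞ h W)
    (ht : IsTimeOnly h W) {j : Jet} (hj : base j ∈ W) :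
    prolongation (fun b => h b • V b) j = h (base j) • prolongation V j +
      (fderiv ℝ h (base j) (Pi.single 0 1) *
        (V (base j) 2 - j 7 * V (base j) 0 - j 3 * V (base j) 1)) • Pi.single 7 1 := by
  have hO := isOpen_cylinder hW
  have hD : ∀ {f : Jet → ℝ}, ContDiffOn ℝ ∞ f {j | base j ∈ W} → ∀ j : Jet, base j ∈ W →
      Dx (fun i => h (base i) * f i) j = h (base j) * Dx f j := by
    intro f hf j hj
    have df := hf.differentiableAt_of_isOpen hO hj
    have dh := (contDiffOn_lift hh).differentiableAt_of_isOpen hO hj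
    have e := ht.Dx_eq_zero hW hh hj
    rw [Dx_eq] at e ⊢
    rw [fderiv_fun_mul dh df, add_apply, smul_apply, smul_apply, e, Dx_eq]
    simp
  have hr : ∀ m, EqOn (reducedEta (fun b => h b • V b) m)
      (fun j => h (base j) * reducedEta V m j) {j | base j ∈ W} := by
    intro m
    induction m with
    | zero => intro j _; simp [reducedEta]
    | succ m ih =>
      intro j hj
      have e1 := hD (contDiffOn_lift (contDiffOn_component hV 1)) j hj
      simp only [reducedEta]
      rw [Dx_congr hO ih hj, hD (contDiffOn_reducedEta hW hV m) j hj]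
      simp only [Pi.smul_apply, smul_eq_mul, e1]
      ring
  have hDt : Dt h j = fderiv ℝ h (base j) (Pi.single 0 1) := by
    rw [Dt, ht.apply hj]; simp
  have hT : etaT (fun b => h b • V b) j = h (base j) * etaT V j +
      fderiv ℝ h (base j) (Pi.single 0 1) *
        (V (base j) 2 - j 7 * V (base j) 0 - j 3 * V (base j) 1) := by
    simp only [etaT, Dt_smul hW hV hh hj, hDt]
    ring
  have hr' := fun m => hr m hj
  ext k
  rw [Pi.add_apply, Pi.smul_apply, Pi.smul_apply, smul_eq_mul, smul_eq_mul]
  have hs : ∀ k : Fin 11, k ≠ 7 → (Pi.single 7 1 : Jet) k = 0 := fun k hk => by simp [hk]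
  fin_cases k
  · rw [hs _ (by decide)]; simp [prolongation]
  · rw [hs _ (by decide)]; simp [prolongation]
  · rw [hs _ (by decide)]; simp [prolongation]
  · rw [hs _ (by decide), mul_zero, add_zero]; exact hr' 1
  · rw [hs _ (by decide), mul_zero, add_zero]; exact hr' 2
  · rw [hs _ (by decide), mul_zero, add_zero]; exact hr' 3
  · rw [hs _ (by decide), mul_zero, add_zero]; exact hr' 4
  · refine hT.trans ?_
    simp [prolongation]
  · rw [hs _ (by decide)]; simp [prolongation]
  · rw [hs _ (by decide)]; simp [prolongation]
  · rw [hs _ (by decide)]; simp [prolongation]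

lemma IsSymmetry.mono {F G : Jet3 → ℝ} {Ω Ω' : Set Jet3} (hs : IsSymmetry F G Ω V) (h : Ω' ⊆ Ω) :
    IsSymmetry F G Ω' V := fun j hj => hs j (h hj)

lemma IsEquation.mono {F G : Jet3 → ℝ} {Ω Ω' : Set Jet3} (hE : IsEquation F G Ω) (h : Ω' ⊆ Ω)
    (ho : IsOpen Ω') : IsEquation F G Ω' :=
  ⟨ho, hE.smooth_F.mono h, hE.smooth_G.mono h, fun z hz => hE.ne_zero z (h hz)⟩

/-- A symmetry that is a multiple of another one, with a factor depending on time, is a constant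
multiple of it where the latter does not vanish. -/
lemma IsSymmetry.fderiv_factor {F G : Jet3 → ℝ} {Ω : Set Jet3} (hE : IsEquation F G Ω)
    {V₁ V₂ : Base → Base} (h₁ : ContDiffOn ℝ ∞ V₁ (base3 '' Ω))
    (h₂ : ContDiffOn ℝ ∞ V₂ (base3 '' Ω)) (s₁ : IsSymmetry F G Ω V₁) (s₂ : IsSymmetry F G Ω V₂)
    (hh : ContDiffOn ℝ ∞ h (base3 '' Ω)) (ht : IsTimeOnly h (base3 '' Ω))
    (he : ∀ b ∈ base3 '' Ω, V₁ b = h b • V₂ b) {b : Base} (hb : b ∈ base3 '' Ω) :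
    fderiv ℝ h b (Pi.single 0 1) = 0 ∨ V₂ b = 0 := by
  have hM : IsOpen (base3 '' Ω) := isOpenMap_base3 _ hE.isOpen
  have t₁ := s₁.isTimeOnly hE h₁
  have t₂ := s₂.isTimeOnly hE h₂
  have hpro : ∀ j : Jet, base j ∈ base3 '' Ω → prolongation V₁ j =
      prolongation (fun b => h b • V₂ b) j := by
    have hO := isOpen_cylinder hM
    have hr : ∀ m, EqOn (reducedEta V₁ m) (reducedEta (fun b => h b • V₂ b) m)
        {j | base j ∈ base3 '' Ω} := by
      intro m
      induction m with
      | zero => intro j hj; simp [reducedEta, he _ hj]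
      | succ m ih =>
        intro j hj
        have hx := Dx_congr (f := fun i => V₁ (base i) 1)
          (g := fun i => (h (base i) • V₂ (base i)) 1) hO (fun i hi => congrFun (he _ hi) 1) hj
        simp only [reducedEta]
        rw [Dx_congr hO ih hj, hx]
    intro j hj
    have hb : ∀ k, V₁ (base j) k = (h (base j) • V₂ (base j)) k := fun k => congrFun (he _ hj) k
    have hDt : ∀ k, Dt (fun b => V₁ b k) j = Dt (fun b => (h b • V₂ b) k) j := by
      intro k
      have : (fun b => V₁ b k) =ᶠ[𝓝 (base j)] fun b => (h b • V₂ b) k := by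
        filter_upwards [hM.mem_nhds hj] with b hb using congrFun (he b hb) k
      rw [Dt, Dt, this.fderiv_eq]
    have hT : etaT V₁ j = etaT (fun b => h b • V₂ b) j := by simp only [etaT, hDt]
    simp only [prolongation, hT, hb, hr _ hj]
  rw [isSymmetry_iff_fderiv_defect hE hM subset_rfl h₁ t₁] at s₁
  rw [isSymmetry_iff_fderiv_defect hE hM subset_rfl h₂ t₂] at s₂
  by_cases hb0 : fderiv ℝ h b (Pi.single 0 1) = 0
  · exact Or.inl hb0
  right
  -- Subtracting `h` times the criterion for `V₂` from that for `V₁ = h V₂` leaves `h' (η - u_t τ -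
  -- u_x ξ) = 0`. Here `u_t` may take any value `q`: as `F ≠ 0`, the equation can be solved for
  -- `u_xxxx`.
  have key : ∀ z ∈ Ω, base3 z = b → ∀ q : ℝ, V₂ b 2 - q * V₂ b 0 - z 3 * V₂ b 1 = 0 := by
    rintro z hz rfl q
    obtain ⟨j, hjz, h6, h7⟩ : ∃ j : Jet, jet3 j = z ∧ j 6 = (q - G z) / F z ∧ j 7 = q :=
      ⟨![z 0, z 1, z 2, z 3, z 4, z 5, (q - G z) / F z, q, 0, 0, 0],
        by ext k; fin_cases k <;> rfl, rfl, rfl⟩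
    have hbj : base j = base3 z := by rw [← hjz]; rfl
    have hj3 : j 3 = z 3 := by rw [← hjz]; rfl
    have hjΩ : jet3 j ∈ Ω := by rw [hjz]; exact hz
    have hd : defect F G j = 0 := by
      have := hE.ne_zero z hz
      rw [defect, hjz, h6, h7]; field_simp; ring
    have hbW : base j ∈ base3 '' Ω := ⟨z, hz, hbj.symm⟩
    have k1 := s₁ j hjΩ hd
    have k2 := s₂ j hjΩ hd
    rw [hpro j hbW, prolongation_smul hM h₂ hh ht hbW, map_add, map_smul, map_smul, k2, smul_zero,
      zero_add, fderiv_defect hE hjΩ] at k1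
    have e7 : jet3 (Pi.single 7 1) = 0 := by ext k; fin_cases k <;> simp [jet3]
    rw [e7, hbj, h7, hj3] at k1
    simp at k1
    exact k1.resolve_left hb0
  obtain ⟨z, hz, hzb⟩ := hb
  obtain ⟨ε, hε, hz'⟩ := exists_add_smul_mem hE.isOpen hz (Pi.single 3 1)
  have hzb' : base3 (z + ε • Pi.single 3 1) = b := by
    rw [← hzb]; ext i; fin_cases i <;> simp [base3]
  -- Two values of `u_t` isolate `τ`, two values of `u_x` isolate `ξ`, and `η` is what remains.
  have k0 := key z hz hzb 0
  have k1 := key z hz hzb 1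
  have k2 := key _ hz' hzb' 0
  simp at k2
  have v0 : V₂ b 0 = 0 := by linarith
  have v1 : V₂ b 1 = 0 := by
    have : ε * V₂ b 1 = 0 := by linarith
    exact (mul_eq_zero.1 this).resolve_left hε.ne'
  have v2 : V₂ b 2 = 0 := by rw [v1] at k0; linarith
  ext k
  fin_cases k
  exacts [v0, v1, v2]

/-- Two symmetries that are proportional with a factor depending on time are linearly dependent on
some open set. -/
lemma exists_dependent {F G : Jet3 → ℝ} {Ω : Set Jet3} (hE : IsEquation F G Ω)
    {V₁ V₂ : Base → Base} (h₁ : ContDiffOn ℝ ∞ V₁ (base3 '' Ω))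
    (h₂ : ContDiffOn ℝ ∞ V₂ (base3 '' Ω)) (s₁ : IsSymmetry F G Ω V₁) (s₂ : IsSymmetry F G Ω V₂)
    (hWΩ : W ⊆ base3 '' Ω) (hW : IsOpen W) {p : Base} (hp : p ∈ W)
    (hh : ContDiffOn ℝ ∞ h W) (ht : IsTimeOnly h W) (he : ∀ b ∈ W, V₁ b = h b • V₂ b) :
    ∃ W' ⊆ W, IsOpen W' ∧ W'.Nonempty ∧ ∃ r s : ℝ, (r ≠ 0 ∨ s ≠ 0) ∧
      ∀ b ∈ W', r • V₁ b + s • V₂ b = 0 := by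
  have hΩ' : IsOpen (Ω ∩ base3 ⁻¹' W) := hE.isOpen.inter (hW.preimage contDiff_base3.continuous)
  have himg : base3 '' (Ω ∩ base3 ⁻¹' W) = W := by rw [image_inter_preimage, inter_eq_right.2 hWΩ]
  have key : ∀ b ∈ W, fderiv ℝ h b (Pi.single 0 1) = 0 ∨ V₂ b = 0 := by
    intro b hb
    rw [← himg] at hh ht he hb
    exact IsSymmetry.fderiv_factor (hE.mono inter_subset_left hΩ')
      (h₁.mono (image_mono inter_subset_left)) (h₂.mono (image_mono inter_subset_left))
      (s₁.mono inter_subset_left) (s₂.mono inter_subset_left) hh ht he hb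
  -- If the derivative of `h` vanishes identically, then `h` is constant on a ball. Otherwise `V₂`
  -- is zero on the open set where this derivative is nonzero. Both are linear dependences with
  -- constant coefficients.
  by_cases hz : ∀ b ∈ W, fderiv ℝ h b (Pi.single 0 1) = 0
  · obtain ⟨ε, hε, hball⟩ := Metric.isOpen_iff.1 hW p hp
    have hd : ∀ b ∈ Metric.ball p ε, fderiv ℝ h b = 0 := fun b hb => by
      ext v; rw [ht.apply (hball hb), hz b (hball hb)]; simp
    have hconst : ∀ b ∈ Metric.ball p ε, h b = h p := by
      intro b hb
      have e : p + (1 : ℝ) • (b - p) = b := by rw [one_smul]; abel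
      have := apply_add_smul_eq (convex_ball p ε) (v := b - p) (s := 1) (f := h)
        (fun x hx => hh.differentiableAt_of_isOpen hW (hball hx)) (fun x hx => by rw [hd x hx]; rfl)
        (Metric.mem_ball_self hε) (by rwa [e])
      rwa [e] at this
    refine ⟨Metric.ball p ε, hball, Metric.isOpen_ball, ⟨p, Metric.mem_ball_self hε⟩, 1, -h p,
      Or.inl one_ne_zero, fun b hb => ?_⟩
    rw [he b (hball hb), hconst b hb]
    module
  · push Not at hz
    obtain ⟨b₀, hb₀, hb0⟩ := hz
    have hc : ContinuousOn (fun b => fderiv ℝ h b (Pi.single 0 1)) W :=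
      ((hh.fderiv_infty hW).clm_apply contDiffOn_const).continuousOn
    refine ⟨W ∩ (fun b => fderiv ℝ h b (Pi.single 0 1)) ⁻¹' {0}ᶜ, inter_subset_left,
      hc.isOpen_inter_preimage hW isOpen_compl_singleton, ⟨b₀, hb₀, hb0⟩, 0, 1,
      Or.inr one_ne_zero, fun b hb => ?_⟩
    rw [(key b hb.1).resolve_left hb.2]
    simp

lemma IsTimeOnly.neg_div {f g : Base → ℝ} (hW : IsOpen W) (hf : ContDiffOn ℝ ∞ f W)
    (hg : ContDiffOn ℝ ∞ g W) (tf : IsTimeOnly f W) (tg : IsTimeOnly g W) (h0 : ∀ b ∈ W, g b ≠ 0) :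
    IsTimeOnly (fun b => -f b / g b) W := by
  intro b hb
  have dg := hg.differentiableAt_of_isOpen hW hb
  have dq : DifferentiableAt ℝ (fun b => -f b / g b) b :=
    ContDiffOn.differentiableAt_of_isOpen (hf.neg.div hg h0) hW hb
  have e : f =ᶠ[𝓝 b] fun b : Base => -((-f b / g b) * g b) := by
    filter_upwards [hW.mem_nhds hb] with b hb
    rw [div_mul_cancel₀ _ (h0 b hb), neg_neg]
  have e' := e.fderiv_eq (𝕜 := ℝ)
  rw [fderiv_fun_neg, fderiv_fun_mul dq dg] at e'
  have key : ∀ v : Base, fderiv ℝ f b v = 0 → fderiv ℝ g b v = 0 →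
      fderiv ℝ (fun b => -f b / g b) b v = 0 := by
    intro v hv hv'
    rw [e'] at hv
    simp only [neg_apply, add_apply, smul_apply, hv', smul_eq_mul, mul_zero, zero_add,
      neg_eq_zero] at hv
    exact (mul_eq_zero.1 hv).resolve_left (h0 b hb)
  exact ⟨key _ (tf b hb).1 (tg b hb).1, key _ (tf b hb).2 (tg b hb).2⟩

/-- The basis of a two-dimensional symmetry algebra. -/
lemma notProportional_of_isSymmetry {F G : Jet3 → ℝ} {Ω : Set Jet3} (hE : IsEquation F G Ω)
    {V : Fin 2 → Base → Base} (hL : IsTwoDimLieAlgebra (base3 '' Ω) V)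
    (hs : ∀ k, IsSymmetry F G Ω (V k)) : NotProportional (base3 '' Ω) (V 0) (V 1) := by
  intro W hW hWo _ h k hh hk th tk hhk b hb
  -- Where one coefficient is nonzero, dividing by it expresses one field as a multiple of the
  -- other, with a factor depending on time only.
  have main : ∀ {f g : Base → ℝ} {V₁ V₂ : Base → Base}, ContDiffOn ℝ ∞ f W → ContDiffOn ℝ ∞ g W →
      IsTimeOnly f W → IsTimeOnly g W → ContDiffOn ℝ ∞ V₁ (base3 '' Ω) →
      ContDiffOn ℝ ∞ V₂ (base3 '' Ω) → IsSymmetry F G Ω V₁ → IsSymmetry F G Ω V₂ →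
      (∀ b ∈ W, f b • V₁ b + g b • V₂ b = 0) → g b ≠ 0 →
      ∃ W' ⊆ W, IsOpen W' ∧ W'.Nonempty ∧ ∃ r s : ℝ, (r ≠ 0 ∨ s ≠ 0) ∧
        ∀ b ∈ W', r • V₂ b + s • V₁ b = 0 := by
    intro f g V₁ V₂ hf hg tf tg h₁ h₂ s₁ s₂ hfg hg0
    have hWg : IsOpen (W ∩ g ⁻¹' {0}ᶜ) :=
      hg.continuousOn.isOpen_inter_preimage hWo isOpen_compl_singleton
    have hsub : W ∩ g ⁻¹' {0}ᶜ ⊆ W := inter_subset_left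
    obtain ⟨W', hW', h⟩ := exists_dependent (h := fun b => -f b / g b) hE h₂ h₁ s₂ s₁
      (hsub.trans hW) hWg ⟨hb, hg0⟩
      ((hf.mono hsub).neg.div (hg.mono hsub) fun b hb => hb.2)
      (IsTimeOnly.neg_div hWg (hf.mono hsub) (hg.mono hsub) (tf.mono hsub) (tg.mono hsub)
        fun b hb => hb.2) (fun b hb => by
          have h1 := hfg b hb.1
          have h2 : g b ≠ 0 := hb.2
          have h3 : g b • V₂ b = (-f b) • V₁ b := by
            rw [neg_smul]; exact eq_neg_of_add_eq_zero_right h1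
          rw [div_eq_inv_mul, mul_smul, ← h3, smul_smul, inv_mul_cancel₀ h2, one_smul])
    exact ⟨W', hW'.trans hsub, h⟩
  by_contra hcon
  have hcon' : k b ≠ 0 ∨ h b ≠ 0 := by tauto
  have fin : ∀ (W' : Set Base) (_ : W' ⊆ W) (_ : IsOpen W') (_ : W'.Nonempty) (r s : ℝ),
      (r ≠ 0 ∨ s ≠ 0) → (∀ b ∈ W', r • V 0 b + s • V 1 b = 0) → False := by
    intro W' hW' ho hne r s hrs h0
    have := hL.indep W' (hW'.trans hW) ho hne ![r, s] (fun b hb => by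
      rw [Fin.sum_univ_two]; exact h0 b hb)
    have e0 := congrFun this 0
    have e1 := congrFun this 1
    simp at e0 e1
    tauto
  rcases hcon' with h0 | h0
  · obtain ⟨W', hW', ho, hne, r, s, hrs, hz⟩ :=
      main hh hk th tk (hL.smooth 0) (hL.smooth 1) (hs 0) (hs 1) hhk h0
    exact fin W' hW' ho hne s r hrs.symm fun b hb => by rw [add_comm]; exact hz b hb
  · obtain ⟨W', hW', ho, hne, r, s, hrs, hz⟩ :=
      main hk hh tk th (hL.smooth 1) (hL.smooth 0) (hs 1) (hs 0)
        (fun b hb => by rw [add_comm]; exact hhk b hb) h0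
    exact fin W' hW' ho hne r s hrs hz

end Proportionality

/-! ### Straightening of fields by equivalence transformations -/

section Straightening

variable {W : Set Base} {X Y : Base → Base} {a : Bool}

lemma fderiv_eq_sum (f : Base → ℝ) (b v : Base) :
    fderiv ℝ f b v = v 0 * fderiv ℝ f b (Pi.single 0 1) + v 1 * fderiv ℝ f b (Pi.single 1 1) +
      v 2 * fderiv ℝ f b (Pi.single 2 1) := by
  have : v = v 0 • Pi.single 0 1 + v 1 • Pi.single 1 1 + v 2 • Pi.single 2 1 := by
    ext k; fin_cases k <;> simp
  conv_lhs => rw [this]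
  simp only [map_add, map_smul, smul_eq_mul]

/-- A transformation given by its components. -/
lemma exists_isEquivalence_of_components {U : Set Base} (hU : IsOpen U) {f : Fin 3 → Base → ℝ}
    (hf : ∀ k, ContDiffOn ℝ ∞ (f k) U) (ht : IsTimeOnly (f 0) U) {p : Base} (hp : p ∈ U)
    (hker : ∀ v, (∀ k, fderiv ℝ (f k) p v = 0) → v = 0) :
    ∃ W ⊆ U, p ∈ W ∧ IsEquivalence (fun b k => f k b) W ∧
      ∀ b ∈ W, ∀ v k, fderiv ℝ (fun b k => f k b) b v k = fderiv ℝ (f k) b v := by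
  have hd : ∀ b ∈ U, ∀ v k, fderiv ℝ (fun b k => f k b) b v k = fderiv ℝ (f k) b v := by
    intro b hb v k
    rw [fderiv_pi fun k => (hf k).differentiableAt_of_isOpen hU hb]; rfl
  obtain ⟨W, hWU, hpW, hW⟩ := exists_isEquivalence (φ := fun b k => f k b) hU (contDiffOn_pi.2 hf)
    ht hp (det_ne_zero_of_forall fun v hv => hker v fun k => by rw [← hd p hp, hv]; rfl)
  exact ⟨W, hWU, hpW, hW, fun b hb => hd b (hWU hb)⟩

/-- Nondegeneracy is needed at one point only, since reducibility allows the neighbourhood to be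
shrunk. -/
lemma isReducible_of_components (i : Fin 3 ⊕ Fin 4) (hi : i.isLeft = a) {U : Set Base}
    (hU : IsOpen U) {f : Fin 3 → Base → ℝ}
    (hf : ∀ k, ContDiffOn ℝ ∞ (f k) U) (ht : IsTimeOnly (f 0) U) {p : Base} (hp : p ∈ U)
    (hker : ∀ v, (∀ k, fderiv ℝ (f k) p v = 0) → v = 0)
    (pX : ∀ b ∈ U, ∀ k, fderiv ℝ (f k) b (X b) = canonical i 0 (fun k => f k b) k)
    (pY : ∀ b ∈ U, ∀ k, fderiv ℝ (f k) b (Y b) = canonical i 1 (fun k => f k b) k) :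
    IsReducible U X Y a := by
  obtain ⟨W, hWU, hpW, hW, hd⟩ := exists_isEquivalence_of_components hU hf ht hp hker
  refine (isReducible_of_canonical i hi ⟨p, hpW⟩ hW (fun b hb => ?_) fun b hb => ?_).mono hWU
  · ext k; rw [hd b hb, pX b (hWU hb)]
  · ext k; rw [hd b hb, pY b (hWU hb)]

lemma isTimeOnly_time (U : Set Base) : IsTimeOnly (fun b => b 0) U := fun b _ => by
  simp [fderiv_coord]

lemma contDiff_coord (k : Fin 3) : ContDiff ℝ ∞ fun b : Base => b k := by fun_prop

/-- A vector field with nonvanishing time component, which depends on the time only, can be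
straightened to `∂_t`. -/
lemma exists_time_straightening (hW : IsOpen W) (hX : ContDiffOn ℝ ∞ X W)
    (ht : IsTimeOnly (fun b => X b 0) W) {p : Base} (hp : p ∈ W) (hp0 : X p 0 ≠ 0) :
    ∃ W' ⊆ W, p ∈ W' ∧ ∃ φ, IsEquivalence φ W' ∧ ∀ b ∈ W', fderiv ℝ φ b (X b) = Pi.single 0 1 := by
  have h0 := contDiffOn_component hX 0
  have hU : IsOpen (W ∩ (fun b => X b 0) ⁻¹' {0}ᶜ) :=
    h0.continuousOn.isOpen_inter_preimage hW isOpen_compl_singleton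
  have hUW : W ∩ (fun b => X b 0) ⁻¹' {0}ᶜ ⊆ W := inter_subset_left
  set U := W ∩ (fun b => X b 0) ⁻¹' {0}ᶜ
  have hU0 : ∀ b ∈ U, X b 0 ≠ 0 := fun b hb => hb.2
  have hq : ContDiffOn ℝ ∞ (fun b => -(-1) / X b 0) U :=
    contDiffOn_const.div (h0.mono hUW) hU0
  have tq : IsTimeOnly (fun b => -(-1) / X b 0) U :=
    IsTimeOnly.neg_div hU contDiffOn_const (h0.mono hUW) (fun b _ => by simp) (ht.mono hUW) hU0
  -- The time component of a flow box may depend on `x` and `u`. It is replaced by a primitive of `1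
  -- / τ`, which is a function of `t` with the same derivative 1 along the field; the other two
  -- components are kept.
  obtain ⟨U₁, hU₁, hU₁o, hpU₁, T, hT, hT0, hT'⟩ := exists_partial_primitive hU hq ⟨hp, hp0⟩ 0
  obtain ⟨U₂, hU₂, hU₂o, hpU₂, φ, hφ, -, hφd, hφX, -⟩ := exists_flowBox hU₁o
    (hX.mono (hU₁.trans hUW)) hpU₁ hp0
  have tT : IsTimeOnly T U₂ := fun b hb => ⟨hT' 1 (by decide) (fun b hb => (tq b hb).1) b (hU₂ hb),
    hT' 2 (by decide) (fun b hb => (tq b hb).2) b (hU₂ hb)⟩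
  have hTX : ∀ b ∈ U₂, fderiv ℝ T b (X b) = 1 := fun b hb => by
    rw [tT.apply hb, hT0 b (hU₂ hb)]
    have := hU0 b (hU₁ (hU₂ hb))
    field_simp
  have hφk : ∀ b ∈ U₂, ∀ v k, fderiv ℝ φ b v k = fderiv ℝ (fun b => φ b k) b v := fun b hb v k => by
    have d := hφ.differentiableAt_of_isOpen hU₂o hb
    rw [fderiv_pi (fun k => (differentiableAt_pi.1 d k))]; rfl
  have hf : ∀ k, ContDiffOn ℝ ∞ (![T, fun b => φ b 1, fun b => φ b 2] k) U₂ := by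
    intro k
    fin_cases k
    exacts [hT.contDiffOn, contDiffOn_component hφ 1, contDiffOn_component hφ 2]
  obtain ⟨W', hW', hpW', hE, hd⟩ := exists_isEquivalence_of_components hU₂o hf tT hpU₂ (by
    intro v hv
    have v0 : fderiv ℝ T p v = 0 := hv 0
    have v1 : fderiv ℝ (fun b => φ b 1) p v = 0 := hv 1
    have v2 : fderiv ℝ (fun b => φ b 2) p v = 0 := hv 2
    have e : fderiv ℝ φ p (v - fderiv ℝ φ p v 0 • X p) = 0 := by
      rw [map_sub, map_smul, hφX p hpU₂]
      ext k
      fin_cases k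
      · simp
      · simp [hφk p hpU₂, v1]
      · simp [hφk p hpU₂, v2]
    have e' := sub_eq_zero.1 (eq_zero_of_det_ne_zero (hφd p hpU₂) e)
    rw [e', map_smul, hTX p hpU₂, smul_eq_mul, mul_one] at v0
    rw [e', v0, zero_smul])
  refine ⟨W', hW'.trans (hU₂.trans (hU₁.trans hUW)), hpW', _, hE, fun b hb => ?_⟩
  have hb' := hW' hb
  ext k
  rw [hd b hb]
  fin_cases k
  · simpa using hTX b hb'
  · simpa [hφX b hb'] using (hφk b hb' (X b) 1).symm
  · simpa [hφX b hb'] using (hφk b hb' (X b) 2).symm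

/-- A vector field without time component can be straightened to `∂_x`. -/
lemma exists_straightening (hW : IsOpen W) (hX : ContDiffOn ℝ ∞ X W)
    (h0 : ∀ b ∈ W, X b 0 = 0) {p : Base} (hp : p ∈ W) (hp0 : X p ≠ 0) :
    ∃ W' ⊆ W, p ∈ W' ∧ ∃ φ, IsEquivalence φ W' ∧ (∀ b ∈ W', φ b 0 = b 0) ∧
      ∀ b ∈ W', fderiv ℝ φ b (X b) = Pi.single 1 1 := by
  -- The flow box is taken in a space coordinate that the field moves. The time is kept because the
  -- field does not move it, and the space coordinates are then ordered so that the straightened one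
  -- is `x`.
  obtain ⟨k, l, hkl, hk0⟩ : ∃ k l : Fin 3, (k = 1 ∧ l = 2 ∨ k = 2 ∧ l = 1) ∧ X p k ≠ 0 := by
    by_contra! hcon
    refine hp0 (funext fun k => ?_)
    fin_cases k
    exacts [h0 p hp, hcon 1 2 (by simp), hcon 2 1 (by simp)]
  have hk : k ≠ 0 := by rcases hkl with ⟨rfl, -⟩ | ⟨rfl, -⟩ <;> decide
  obtain ⟨U, hUW, hU, hpU, φ, hφ, -, hφd, hφX, hφ0⟩ := exists_flowBox hW hX hp hk0
  have hφ0' : ∀ b ∈ U, φ b 0 = b 0 := hφ0 0 hk.symm h0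
  have hφk : ∀ b ∈ U, ∀ v k, fderiv ℝ φ b v k = fderiv ℝ (fun b => φ b k) b v := fun b hb v k => by
    have d := hφ.differentiableAt_of_isOpen hU hb
    rw [fderiv_pi (fun k => (differentiableAt_pi.1 d k))]; rfl
  have hφt : ∀ b ∈ U, fderiv ℝ (fun b => φ b 0) b = fderiv ℝ (fun b : Base => b 0) b := by
    intro b hb
    refine Filter.EventuallyEq.fderiv_eq ?_
    filter_upwards [hU.mem_nhds hb] with b hb using hφ0' b hb
  have hf : ∀ m, ContDiffOn ℝ ∞ (![fun b => b 0, fun b => φ b k, fun b => φ b l] m) U := by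
    intro m
    fin_cases m
    exacts [(contDiff_coord 0).contDiffOn, contDiffOn_component hφ k, contDiffOn_component hφ l]
  obtain ⟨W', hW', hpW', hE, hd⟩ := exists_isEquivalence_of_components hU hf
    (isTimeOnly_time U) hpU (by
    intro v hv
    have v0 : fderiv ℝ (fun b : Base => b 0) p v = 0 := hv 0
    have v1 : fderiv ℝ (fun b => φ b k) p v = 0 := hv 1
    have v2 : fderiv ℝ (fun b => φ b l) p v = 0 := hv 2
    rw [← hφt p hpU] at v0
    refine eq_zero_of_det_ne_zero (hφd p hpU) (funext fun m => ?_)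
    rw [hφk p hpU]
    rcases hkl with ⟨rfl, rfl⟩ | ⟨rfl, rfl⟩ <;> fin_cases m <;> assumption)
  refine ⟨W', hW'.trans hUW, hpW', _, hE, fun b hb => rfl, fun b hb => ?_⟩
  have hb' := hW' hb
  have hl : l ≠ k := by rcases hkl with ⟨rfl, rfl⟩ | ⟨rfl, rfl⟩ <;> decide
  have e := fun m => hφk b hb' (X b) m
  rw [hφX b hb'] at e
  ext m
  rw [hd b hb]
  fin_cases m
  · simpa [fderiv_coord] using h0 b (hUW hb')
  · simpa using (e k).symm
  · simpa [hl] using (e l).symm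

/-- A vector field without time component that does not depend on time can be straightened to
`∂_x` by a transformation that does not depend on time. -/
lemma exists_autonomous_straightening (hW : IsOpen W) (hX : ContDiffOn ℝ ∞ X W)
    (h0 : ∀ b ∈ W, X b 0 = 0) (hXt : ∀ b ∈ W, fderiv ℝ X b (Pi.single 0 1) = 0) {p : Base}
    (hp : p ∈ W) (hp0 : X p ≠ 0) :
    ∃ W' ⊆ W, p ∈ W' ∧ ∃ φ, IsEquivalence φ W' ∧ (∀ b ∈ W', φ b 0 = b 0) ∧
      (∀ b ∈ W', fderiv ℝ φ b (Pi.single 0 1) = Pi.single 0 1) ∧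
      ∀ b ∈ W', fderiv ℝ φ b (X b) = Pi.single 1 1 := by
  obtain ⟨ε, hε, hball⟩ := Metric.isOpen_iff.1 hW p hp
  -- Freezing the time at that of `p` reduces the problem to a planar flow box. On a ball the field
  -- agrees with its frozen version, and the planar map together with the identity in time leaves
  -- `∂_t` unchanged.
  let s : (Fin 2 → ℝ) → Base := fun y => ![p 0, y 0, y 1]
  let π : Base → (Fin 2 → ℝ) := fun b => ![b 1, b 2]
  have hs : ContDiff ℝ ∞ s := by
    refine contDiff_pi.2 fun k => ?_
    fin_cases k <;> simp [s] <;> fun_prop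
  have hπ : ContDiff ℝ ∞ π := by
    refine contDiff_pi.2 fun k => ?_
    fin_cases k <;> simp [π] <;> fun_prop
  have hπs : ∀ b v : Base, ∀ r : ℝ, π (b + r • v) = π b + r • π v := by
    intro b v r; ext k; fin_cases k <;> simp [π]
  have hsB : ∀ b ∈ Metric.ball p ε, s (π b) ∈ Metric.ball p ε := by
    intro b hb
    rw [Metric.mem_ball, dist_pi_lt_iff hε] at hb ⊢
    intro k
    fin_cases k
    · simpa [s] using hε
    · exact hb 1
    · exact hb 2
  have hXs : ∀ b ∈ Metric.ball p ε, X (s (π b)) = X b := by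
    intro b hb
    have e : b + (p 0 - b 0) • Pi.single 0 1 = s (π b) := by
      ext k; fin_cases k <;> simp [s, π]
    rw [← e]
    exact apply_add_smul_eq (convex_ball p ε) (fun x hx =>
      hX.differentiableAt_of_isOpen hW (hball hx)) (fun x hx => hXt x (hball hx)) hb
      (by rw [e]; exact hsB b hb)
  let w : (Fin 2 → ℝ) → (Fin 2 → ℝ) := fun y => π (X (s y))
  have hD : IsOpen (s ⁻¹' Metric.ball p ε) := Metric.isOpen_ball.preimage hs.continuous
  have hw : ContDiffOn ℝ ∞ w (s ⁻¹' Metric.ball p ε) :=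
    hπ.comp_contDiffOn ((hX.mono hball).comp hs.contDiffOn fun _ h => h)
  have hpB : p ∈ Metric.ball p ε := Metric.mem_ball_self hε
  have hpD : π p ∈ s ⁻¹' Metric.ball p ε := hsB p hpB
  have hwπ : ∀ b ∈ Metric.ball p ε, w (π b) = π (X b) := fun b hb => by
    simp only [w, hXs b hb]
  obtain ⟨k, l, hkl, hk0⟩ : ∃ k l : Fin 2, (k = 0 ∧ l = 1 ∨ k = 1 ∧ l = 0) ∧ w (π p) k ≠ 0 := by
    by_contra! hcon
    rw [hwπ p hpB] at hcon
    refine hp0 (funext fun k => ?_)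
    fin_cases k
    exacts [h0 p hp, hcon 0 1 (by simp), hcon 1 0 (by simp)]
  have hlk : l ≠ k := by rcases hkl with ⟨rfl, rfl⟩ | ⟨rfl, rfl⟩ <;> decide
  obtain ⟨D, hDs, hDo, hpD', ψ, hψ, -, hψd, hψw, -⟩ := exists_flowBox hD hw hpD hk0
  have hU : IsOpen (Metric.ball p ε ∩ π ⁻¹' D) :=
    Metric.isOpen_ball.inter (hDo.preimage hπ.continuous)
  set U := Metric.ball p ε ∩ π ⁻¹' D
  have hψk : ∀ m, ContDiffOn ℝ ∞ (fun b => ψ (π b) m) U := fun m =>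
    (contDiffOn_component hψ m).comp hπ.contDiffOn fun b hb => hb.2
  have hψd' : ∀ b ∈ U, ∀ v m, fderiv ℝ (fun b => ψ (π b) m) b v = fderiv ℝ ψ (π b) (π v) m := by
    intro b hb v m
    refine fderiv_apply_eq_of_hasDerivAt ((hψk m).differentiableAt_of_isOpen hU hb) ?_
    simp only [hπs]
    have d := hψ.differentiableAt_of_isOpen hDo hb.2
    have h2 := d.hasFDerivAt.hasLineDerivAt (π v)
    exact (hasDerivAt_pi.1 h2) m
  have hf : ∀ m, ContDiffOn ℝ ∞ (![fun b => b 0, fun b => ψ (π b) k, fun b => ψ (π b) l] m) U := by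
    intro m
    fin_cases m
    exacts [(contDiff_coord 0).contDiffOn, hψk k, hψk l]
  have hpU : p ∈ U := ⟨hpB, hpD'⟩
  obtain ⟨W', hW', hpW', hE, hd⟩ := exists_isEquivalence_of_components hU hf
    (isTimeOnly_time U) hpU (by
    intro v hv
    have v0 : fderiv ℝ (fun b : Base => b 0) p v = 0 := hv 0
    have v1 : fderiv ℝ (fun b => ψ (π b) k) p v = 0 := hv 1
    have v2 : fderiv ℝ (fun b => ψ (π b) l) p v = 0 := hv 2
    rw [fderiv_coord] at v0
    rw [hψd' p hpU] at v1 v2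
    have hv' : π v = 0 := by
      refine eq_zero_of_det_ne_zero (hψd _ hpD') (funext fun m => ?_)
      rcases hkl with ⟨rfl, rfl⟩ | ⟨rfl, rfl⟩ <;> fin_cases m <;> assumption
    ext m
    fin_cases m
    exacts [v0, congrFun hv' 0, congrFun hv' 1])
  refine ⟨W', (hW'.trans inter_subset_left).trans hball, hpW', _, hE, fun b hb => rfl,
    fun b hb => ?_, fun b hb => ?_⟩
  · have hb' := hW' hb
    have hπ0 : π (Pi.single 0 1) = 0 := by ext m; fin_cases m <;> simp [π]
    ext m
    rw [hd b hb]
    fin_cases m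
    · simp [fderiv_coord]
    · simp [hψd' b hb', hπ0]
    · simp [hψd' b hb', hπ0]
  · have hb' := hW' hb
    have e : fderiv ℝ ψ (π b) (π (X b)) = Pi.single k 1 := by
      rw [← hwπ b hb'.1]; exact hψw _ hb'.2
    ext m
    rw [hd b hb]
    fin_cases m
    · simpa [fderiv_coord] using h0 b (hball hb'.1)
    · simp [hψd' b hb', e]
    · simp [hψd' b hb', e, hlk]

end Straightening

/-! ### Classification of pairs -/

section Classification

variable {W : Set Base} {X Y : Base → Base} {c : ℝ}

lemma isTimeOnly_const (r : ℝ) (W : Set Base) : IsTimeOnly (fun _ => r) W := fun b _ => by simp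

lemma IsPair.exists_ne_zero (h : IsPair W X Y c) {f g : Base → ℝ} (hf : ContDiffOn ℝ ∞ f W)
    (hg : ContDiffOn ℝ ∞ g W) (tf : IsTimeOnly f W) (tg : IsTimeOnly g W)
    (h0 : ∀ b ∈ W, f b ≠ 0 ∨ g b ≠ 0) : ∃ p ∈ W, f p • X p + g p • Y p ≠ 0 := by
  by_contra! hcon
  obtain ⟨b, hb⟩ := h.nonempty
  have := h.notProportional W subset_rfl h.isOpen h.nonempty f g hf hg tf tg hcon b hb
  have := h0 b hb
  tauto

lemma IsPair.exists_fst_ne_zero (h : IsPair W X Y c) : ∃ p ∈ W, X p ≠ 0 := by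
  obtain ⟨p, hp, hp0⟩ := h.exists_ne_zero (f := fun _ => 1) (g := fun _ => 0) contDiffOn_const
    contDiffOn_const (isTimeOnly_const 1 W) (isTimeOnly_const 0 W) fun _ _ => by simp
  exact ⟨p, hp, by simpa using hp0⟩

lemma IsPair.exists_snd_ne_zero (h : IsPair W X Y c) : ∃ p ∈ W, Y p ≠ 0 := by
  obtain ⟨p, hp, hp0⟩ := h.exists_ne_zero (f := fun _ => 0) (g := fun _ => 1) contDiffOn_const
    contDiffOn_const (isTimeOnly_const 0 W) (isTimeOnly_const 1 W) fun _ _ => by simp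
  exact ⟨p, hp, by simpa using hp0⟩

lemma fderiv_component_apply {b : Base} (hX : DifferentiableAt ℝ X b) (v : Base) (k : Fin 3) :
    fderiv ℝ (fun b => X b k) b v = fderiv ℝ X b v k := by
  rw [fderiv_pi (fun k => (differentiableAt_pi.1 hX k))]; rfl

lemma eq_of_fderiv_eq_zero {f : Base → ℝ} {B : Set Base} (hB : Convex ℝ B)
    (hd : ∀ b ∈ B, DifferentiableAt ℝ f b) (h : ∀ b ∈ B, fderiv ℝ f b = 0) {b b' : Base}
    (hb : b ∈ B) (hb' : b' ∈ B) : f b = f b' := by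
  have e : b' + (1 : ℝ) • (b - b') = b := by rw [one_smul]; abel
  have := apply_add_smul_eq hB (v := b - b') (s := 1) hd (fun x hx => by rw [h x hx]; rfl)
    hb' (by rwa [e])
  rwa [e] at this

lemma IsTimeOnly.fderiv_eq_zero {f : Base → ℝ} (ht : IsTimeOnly f W) {b : Base} (hb : b ∈ W)
    (h0 : fderiv ℝ f b (Pi.single 0 1) = 0) : fderiv ℝ f b = 0 := by
  ext v; rw [ht.apply hb, h0, mul_zero]; rfl

lemma lieBracket_const_left (e : Base) (b : Base) :
    VectorField.lieBracket ℝ (fun _ => e) Y b = fderiv ℝ Y b e := by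
  simp [VectorField.lieBracket]

lemma lieBracket_const_right (e : Base) (b : Base) :
    VectorField.lieBracket ℝ X (fun _ => e) b = -fderiv ℝ X b e := by
  simp [VectorField.lieBracket]

/-- A ball inside an open set. -/
lemma IsPair.exists_ball (h : IsPair W X Y c) {p : Base} (hp : p ∈ W) :
    ∃ ε > 0, Metric.ball p ε ⊆ W ∧ IsPair (Metric.ball p ε) X Y c := by
  obtain ⟨ε, hε, hball⟩ := Metric.isOpen_iff.1 h.isOpen p hp
  exact ⟨ε, hε, hball, h.mono hball Metric.isOpen_ball ⟨p, Metric.mem_ball_self hε⟩⟩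

/-- The commutation relation makes `Y` independent of `t`, so its time component is a constant on a
ball and can be removed by subtracting a multiple of `∂_t`. An autonomous straightening of the
remainder leaves `∂_t` in place. -/
lemma IsPair.isReducible_time_translation (h : IsPair W (fun _ => Pi.single 0 1) Y 0) :
    IsReducible W (fun _ => Pi.single 0 1) Y true := by
  obtain ⟨q, hq⟩ := h.nonempty
  obtain ⟨ε, hε, hball, hB⟩ := h.exists_ball hq
  have dY : ∀ b ∈ Metric.ball q ε, DifferentiableAt ℝ Y b := fun b hb =>
    hB.smooth_snd.differentiableAt_of_isOpen hB.isOpen hb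
  have hYt : ∀ b ∈ Metric.ball q ε, fderiv ℝ Y b (Pi.single 0 1) = 0 := fun b hb => by
    have := hB.bracket b hb
    rwa [lieBracket_const_left, zero_smul] at this
  have hY0 : ∀ b ∈ Metric.ball q ε, Y b 0 = Y q 0 := fun b hb =>
    eq_of_fderiv_eq_zero (f := fun b => Y b 0) (convex_ball q ε)
      (fun b hb => differentiableAt_pi.1 (dY b hb) 0)
      (fun b hb => hB.time_snd.fderiv_eq_zero hb (by
        rw [fderiv_component_apply (dY b hb), hYt b hb]; rfl)) hb (Metric.mem_ball_self hε)
  have hP := hB.comb (p := 1) (q := 0) (r := -Y q 0) (s := 1) (c' := 0) (by simp) (by simp)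
  refine IsReducible.mono (W' := Metric.ball q ε) (IsReducible.of_comb (p := 1) (q := 0)
    (r := -Y q 0) (s := 1) (by simp) ?_) hball
  obtain ⟨p, hp, hp0⟩ := hP.exists_snd_ne_zero
  obtain ⟨W', hW', hpW', φ, hφ, -, hφt, hφY⟩ := exists_autonomous_straightening hP.isOpen
    hP.smooth_snd (fun b hb => by simp [hY0 b hb]) (fun b hb => by
      have := hP.bracket b hb
      simp only [one_smul, zero_smul, add_zero] at this
      rw [lieBracket_const_left] at this
      simpa only [one_smul] using this) hp hp0
  refine (isReducible_of_canonical (.inl 0) rfl ⟨p, hpW'⟩ hφ (fun b hb => ?_)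
    fun b hb => ?_).mono hW'
  · simp only [one_smul, zero_smul, add_zero]
    rw [hφt b hb]
    ext k; fin_cases k <;> simp [canonical]
  · refine (hφY b hb).trans ?_
    ext k; fin_cases k <;> simp [canonical]

/-- After the first field has been straightened to a constant one, it remains to treat the
push-forward of the second. -/
lemma IsPair.isReducible_of_push {a : Bool} {φ : Base → Base} {W' : Set Base}
    (h : IsPair W X Y c) (hW' : W' ⊆ W) (hne : W'.Nonempty) (hφ : IsEquivalence φ W') {e : Base}
    (he : ∀ b ∈ W', fderiv ℝ φ b (X b) = e)
    (H : ∀ Y', IsPair (φ '' W') (fun _ => e) Y' c →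
      (∀ b ∈ W', fderiv ℝ φ b (Y b) = Y' (φ b)) → IsReducible (φ '' W') (fun _ => e) Y' a) :
    IsReducible W X Y a := by
  have h' := h.mono hW' hφ.isOpen hne
  obtain ⟨Y', hY', pY⟩ := hφ.exists_push h'.smooth_snd
  exact (IsReducible.of_push hφ he pY (H Y' (h'.push hφ contDiffOn_const hY' he pY) pY)).mono hW'

lemma IsPair.isReducible_of_push_snd {a : Bool} {φ : Base → Base} {W' : Set Base}
    (h : IsPair W X Y c) (hW' : W' ⊆ W) (hne : W'.Nonempty) (hφ : IsEquivalence φ W') {e : Base}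
    (he : ∀ b ∈ W', fderiv ℝ φ b (Y b) = e)
    (H : ∀ X', IsPair (φ '' W') X' (fun _ => e) c →
      (∀ b ∈ W', fderiv ℝ φ b (X b) = X' (φ b)) → IsReducible (φ '' W') X' (fun _ => e) a) :
    IsReducible W X Y a := by
  have h' := h.mono hW' hφ.isOpen hne
  obtain ⟨X', hX', pX⟩ := hφ.exists_push h'.smooth_fst
  exact (IsReducible.of_push hφ pX he (H X' (h'.push hφ hX' contDiffOn_const pX he) pX)).mono hW'

lemma IsPair.isReducible_abelian_time (h : IsPair W X Y 0) {p : Base} (hp : p ∈ W)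
    (hp0 : X p 0 ≠ 0) : IsReducible W X Y true := by
  obtain ⟨W', hW', hpW', φ, hφ, he⟩ :=
    exists_time_straightening h.isOpen h.smooth_fst h.time_fst hp hp0
  exact h.isReducible_of_push hW' ⟨p, hpW'⟩ hφ he fun Y' hP _ => hP.isReducible_time_translation

/-- The relation gives `∂_t X = -∂_t`. After subtraction of a multiple of `∂_t`, the time component
of `X` is `-t`, and `X + t ∂_t` is an autonomous field without time component. Straightening it to
`∂_x` and taking `exp (-x)` as the new `x` gives the scaling. -/
lemma IsPair.isReducible_scaling_time (h : IsPair W X (fun _ => Pi.single 0 1) 1) :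
    IsReducible W X (fun _ => Pi.single 0 1) false := by
  obtain ⟨q, hq⟩ := h.nonempty
  obtain ⟨ε, hε, hball, hB⟩ := h.exists_ball hq
  have dX : ∀ b ∈ Metric.ball q ε, DifferentiableAt ℝ X b := fun b hb =>
    hB.smooth_fst.differentiableAt_of_isOpen hB.isOpen hb
  have hXt : ∀ b ∈ Metric.ball q ε, fderiv ℝ X b (Pi.single 0 1) = -Pi.single 0 1 := fun b hb => by
    have := hB.bracket b hb
    rw [lieBracket_const_right, one_smul] at this
    exact neg_eq_iff_eq_neg.1 this
  have hX0 : ∀ b ∈ Metric.ball q ε, X b 0 + b 0 = X q 0 + q 0 := fun b hb => by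
    have d0 : ∀ b ∈ Metric.ball q ε, DifferentiableAt ℝ (fun b => X b 0) b := fun b hb =>
      differentiableAt_pi.1 (dX b hb) 0
    refine eq_of_fderiv_eq_zero (f := fun b => X b 0 + b 0) (convex_ball q ε)
      (fun b hb => (d0 b hb).add (by fun_prop))
      (fun b hb => ?_) hb (Metric.mem_ball_self hε)
    ext v
    rw [fderiv_fun_add (d0 b hb) (by fun_prop), add_apply, fderiv_coord, hB.time_fst.apply hb,
      fderiv_component_apply (dX b hb), hXt b hb]
    simp
  set k := X q 0 + q 0 with hk
  have hP := hB.comb (p := 1) (q := -k) (r := 0) (s := 1) (c' := 1) (by simp) (by simp)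
  refine IsReducible.mono (W' := Metric.ball q ε) (IsReducible.of_comb (p := 1) (q := -k)
    (r := 0) (s := 1) (by simp) ?_) hball
  set X₁ : Base → Base := fun b => (1 : ℝ) • X b + -k • Pi.single 0 1 with hX₁
  have hY₁ : (fun b => (0 : ℝ) • X b + (1 : ℝ) • (Pi.single 0 1 : Base)) =
      fun _ => Pi.single 0 1 := by funext b; simp
  rw [hY₁] at hP ⊢
  have hX₁0 : ∀ b ∈ Metric.ball q ε, X₁ b 0 = -b 0 := fun b hb => by
    simp [hX₁, ← hX0 b hb]
  -- If `X + t ∂_t` vanished identically, then `X` would be the multiple of `∂_t` by the function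
  -- `-t` of the time.
  obtain ⟨p, hp, hp0⟩ := hP.exists_ne_zero (f := fun _ => 1) (g := fun b => b 0) contDiffOn_const
    (contDiff_coord 0).contDiffOn (isTimeOnly_const 1 _) (isTimeOnly_time _) fun _ _ => by simp
  have hZ : ContDiffOn ℝ ∞ (fun b => (1 : ℝ) • X₁ b + b 0 • (Pi.single 0 1 : Base))
      (Metric.ball q ε) :=
    (hP.smooth_fst.const_smul 1).add ((contDiff_coord 0).contDiffOn.smul contDiffOn_const)
  obtain ⟨W', hW', hpW', φ, hφ, hφ0, hφt, hφZ⟩ := exists_autonomous_straightening hP.isOpen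
    hZ (fun b hb => by simp [hX₁0 b hb]) (fun b hb => by
      have d₁ := hP.smooth_fst.differentiableAt_of_isOpen hP.isOpen hb
      have := hP.bracket b hb
      rw [lieBracket_const_right, one_smul] at this
      have dc : DifferentiableAt ℝ (fun b : Base => b 0 • (Pi.single 0 1 : Base)) b := by fun_prop
      rw [fderiv_fun_add (d₁.fun_const_smul 1) dc, fderiv_fun_const_smul d₁,
        fderiv_smul_const (by fun_prop), add_apply, smul_apply, one_smul,
        ContinuousLinearMap.smulRight_apply, fderiv_coord, neg_eq_iff_eq_neg.1 this]
      simp) hp hp0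
  have hφX : ∀ b ∈ W', fderiv ℝ φ b (X₁ b) = Pi.single 1 1 - b 0 • Pi.single 0 1 := by
    intro b hb
    have := hφZ b hb
    rw [map_add, map_smul, map_smul, hφt b hb, one_smul] at this
    exact eq_sub_of_add_eq this
  have hd : ∀ k, ∀ b ∈ W', DifferentiableAt ℝ (fun b => φ b k) b := fun k b hb =>
    (contDiffOn_component hφ.smooth k).differentiableAt_of_isOpen hφ.isOpen hb
  have hf1 : ∀ b ∈ W', ∀ v, fderiv ℝ (fun b => Real.exp (-φ b 1)) b v =
      -(Real.exp (-φ b 1) * fderiv ℝ φ b v 1) := by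
    intro b hb v
    rw [fderiv_exp (hd 1 b hb).fun_neg, fderiv_fun_neg, smul_apply, neg_apply, hφ.fderiv_apply hb]
    simp
  have hf : ∀ k, ContDiffOn ℝ ∞
      (![fun b => φ b 0, fun b => Real.exp (-φ b 1), fun b => φ b 2] k) W' := by
    intro k
    fin_cases k
    exacts [contDiffOn_component hφ.smooth 0, (contDiffOn_component hφ.smooth 1).neg.exp,
      contDiffOn_component hφ.smooth 2]
  refine (isReducible_of_components (.inr 0) rfl hφ.isOpen hf hφ.isTimeOnly hpW' ?_ ?_ ?_).mono hW'
  · intro v hv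
    refine hφ.eq_zero hpW' fun k => ?_
    have e1 : fderiv ℝ (fun b => Real.exp (-φ b 1)) p v = 0 := hv 1
    rw [hf1 p hpW', neg_eq_zero, mul_eq_zero, or_iff_right (Real.exp_ne_zero _),
      hφ.fderiv_apply hpW'] at e1
    fin_cases k
    exacts [hv 0, e1, hv 2]
  · intro b hb k
    have e := hφX b hb
    fin_cases k
    · change fderiv ℝ (fun b => φ b 0) b (X₁ b) = -φ b 0
      rw [← hφ.fderiv_apply hb, e, hφ0 b hb]; simp
    · change fderiv ℝ (fun b => Real.exp (-φ b 1)) b (X₁ b) = -Real.exp (-φ b 1)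
      rw [hf1 b hb, e]; simp
    · change fderiv ℝ (fun b => φ b 2) b (X₁ b) = 0
      rw [← hφ.fderiv_apply hb, e]; simp
  · intro b hb k
    have e := hφt b hb
    fin_cases k
    · change fderiv ℝ (fun b => φ b 0) b (Pi.single 0 1) = 1
      rw [← hφ.fderiv_apply hb, e]; simp
    · change fderiv ℝ (fun b => Real.exp (-φ b 1)) b (Pi.single 0 1) = 0
      rw [hf1 b hb, e]; simp
    · change fderiv ℝ (fun b => φ b 2) b (Pi.single 0 1) = 0
      rw [← hφ.fderiv_apply hb, e]; simp

/-- The relation `∂_t Y = Y` makes `exp (-t) Y` autonomous; straightened, it gives `Y = exp (t)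
∂_x`. The variables `exp (-t)` and `x exp (-t)` then turn `∂_t` into the scaling and `Y` into the
translation in `x`. -/
lemma IsPair.isReducible_expanding (h : IsPair W (fun _ => Pi.single 0 1) Y 1)
    (hY0 : ∀ b ∈ W, Y b 0 = 0) : IsReducible W (fun _ => Pi.single 0 1) Y false := by
  obtain ⟨p, hp, hp0⟩ := h.exists_snd_ne_zero
  have hexp : ContDiff ℝ ∞ fun b : Base => Real.exp (-b 0) := by fun_prop
  have he : ∀ b v : Base, fderiv ℝ (fun b : Base => Real.exp (-b 0)) b v =
      -(Real.exp (-b 0) * v 0) := by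
    intro b v
    rw [fderiv_exp (by fun_prop), fderiv_fun_neg, smul_apply, neg_apply, fderiv_coord]
    simp
  obtain ⟨W', hW', hpW', φ, hφ, hφ0, hφt, hφZ⟩ := exists_autonomous_straightening h.isOpen
    (X := fun b => Real.exp (-b 0) • Y b) (hexp.contDiffOn.smul h.smooth_snd)
    (fun b hb => by simp [hY0 b hb]) (fun b hb => by
      have dY := h.smooth_snd.differentiableAt_of_isOpen h.isOpen hb
      have := h.bracket b hb
      rw [lieBracket_const_left, one_smul] at this
      rw [fderiv_fun_smul (hexp.differentiable (by simp) b) dY, add_apply, smul_apply, this,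
        ContinuousLinearMap.smulRight_apply, he]
      simp) hp (smul_ne_zero (Real.exp_ne_zero _) hp0)
  have hφY : ∀ b ∈ W', fderiv ℝ φ b (Y b) = Real.exp (φ b 0) • Pi.single 1 1 := by
    intro b hb
    have := hφZ b hb
    rw [map_smul] at this
    rw [← this, hφ0 b hb, smul_smul, ← Real.exp_add]
    simp
  have hd : ∀ k, ∀ b ∈ W', DifferentiableAt ℝ (fun b => φ b k) b := fun k b hb =>
    (contDiffOn_component hφ.smooth k).differentiableAt_of_isOpen hφ.isOpen hb
  have s0 : ContDiffOn ℝ ∞ (fun b => Real.exp (-φ b 0)) W' :=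
    (contDiffOn_component hφ.smooth 0).neg.exp
  have hf0 : ∀ b ∈ W', ∀ v, fderiv ℝ (fun b => Real.exp (-φ b 0)) b v =
      -(Real.exp (-φ b 0) * fderiv ℝ φ b v 0) := by
    intro b hb v
    rw [fderiv_exp (hd 0 b hb).fun_neg, fderiv_fun_neg, smul_apply, neg_apply, hφ.fderiv_apply hb]
    simp
  have hf1 : ∀ b ∈ W', ∀ v, fderiv ℝ (fun b => φ b 1 * Real.exp (-φ b 0)) b v =
      Real.exp (-φ b 0) * (fderiv ℝ φ b v 1 - φ b 1 * fderiv ℝ φ b v 0) := by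
    intro b hb v
    rw [fderiv_fun_mul (hd 1 b hb) (s0.differentiableAt_of_isOpen hφ.isOpen hb), add_apply,
      smul_apply, smul_apply, hf0 b hb, ← hφ.fderiv_apply hb, smul_eq_mul, smul_eq_mul]
    ring
  have hf : ∀ k, ContDiffOn ℝ ∞
      (![fun b => Real.exp (-φ b 0), fun b => φ b 1 * Real.exp (-φ b 0), fun b => φ b 2] k) W' := by
    intro k
    fin_cases k
    exacts [s0, (contDiffOn_component hφ.smooth 1).mul s0, contDiffOn_component hφ.smooth 2]
  refine (isReducible_of_components (.inr 1) rfl hφ.isOpen hf ?_ hpW' ?_ ?_ ?_).mono hW'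
  · intro b hb
    have t : ∀ v, fderiv ℝ φ b v 0 = v 0 * fderiv ℝ (fun b => φ b 0) b (Pi.single 0 1) := fun v => by
      rw [hφ.fderiv_apply hb, hφ.isTimeOnly.apply hb]
    exact ⟨(hf0 b hb _).trans (by rw [t]; simp), (hf0 b hb _).trans (by rw [t]; simp)⟩
  · intro v hv
    have e0 : fderiv ℝ (fun b => Real.exp (-φ b 0)) p v = 0 := hv 0
    have e1 : fderiv ℝ (fun b => φ b 1 * Real.exp (-φ b 0)) p v = 0 := hv 1
    rw [hf0 p hpW', neg_eq_zero, mul_eq_zero, or_iff_right (Real.exp_ne_zero _)] at e0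
    rw [hf1 p hpW', mul_eq_zero, or_iff_right (Real.exp_ne_zero _), e0, mul_zero, sub_zero] at e1
    rw [hφ.fderiv_apply hpW'] at e0 e1
    refine hφ.eq_zero hpW' fun k => ?_
    fin_cases k
    exacts [e0, e1, hv 2]
  · intro b hb k
    have e := hφt b hb
    fin_cases k
    · change fderiv ℝ (fun b => Real.exp (-φ b 0)) b (Pi.single 0 1) = -Real.exp (-φ b 0)
      rw [hf0 b hb, e]; simp
    · change fderiv ℝ (fun b => φ b 1 * Real.exp (-φ b 0)) b (Pi.single 0 1) =
        -(φ b 1 * Real.exp (-φ b 0))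
      rw [hf1 b hb, e]; simp; ring
    · change fderiv ℝ (fun b => φ b 2) b (Pi.single 0 1) = 0
      rw [← hφ.fderiv_apply hb, e]; simp
  · intro b hb k
    have e := hφY b hb
    fin_cases k
    · change fderiv ℝ (fun b => Real.exp (-φ b 0)) b (Y b) = 0
      rw [hf0 b hb, e]; simp
    · change fderiv ℝ (fun b => φ b 1 * Real.exp (-φ b 0)) b (Y b) = 1
      rw [hf1 b hb, e]; simp [← Real.exp_add]
    · change fderiv ℝ (fun b => φ b 2) b (Y b) = 0
      rw [← hφ.fderiv_apply hb, e]; simp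

/-- Here `Y = ξ(t,u) ∂_x + η(t,u) ∂_u`. If `η` is nonzero somewhere, two quadratures in `u` give
`⟨∂_x, ∂_u⟩`. Otherwise `Y = ξ ∂_x`, and taking `ξ` as the new `x` and `x` as the new `u` gives
`⟨∂_u, x ∂_u⟩`. -/
lemma IsPair.isReducible_abelian_translation (h : IsPair W (fun _ => Pi.single 1 1) Y 0)
    (hY0 : ∀ b ∈ W, Y b 0 = 0) : IsReducible W (fun _ => Pi.single 1 1) Y true := by
  have dY : ∀ b ∈ W, DifferentiableAt ℝ Y b := fun b hb =>
    h.smooth_snd.differentiableAt_of_isOpen h.isOpen hb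
  have hc := fun k => contDiffOn_component h.smooth_snd k
  have hYx : ∀ k, ∀ b ∈ W, fderiv ℝ (fun b => Y b k) b (Pi.single 1 1) = 0 := fun k b hb => by
    have := h.bracket b hb
    rw [lieBracket_const_left, zero_smul] at this
    rw [fderiv_component_apply (dY b hb), this]; rfl
  by_cases hη : ∃ p ∈ W, Y p 2 ≠ 0
  · obtain ⟨p, hp, hp0⟩ := hη
    have hU : IsOpen (W ∩ (fun b => Y b 2) ⁻¹' {0}ᶜ) :=
      (hc 2).continuousOn.isOpen_inter_preimage h.isOpen isOpen_compl_singleton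
    have hUW : W ∩ (fun b => Y b 2) ⁻¹' {0}ᶜ ⊆ W := inter_subset_left
    set U := W ∩ (fun b => Y b 2) ⁻¹' {0}ᶜ
    have hU0 : ∀ b ∈ U, Y b 2 ≠ 0 := fun b hb => hb.2
    have hquot : ∀ f : Base → ℝ, ContDiffOn ℝ ∞ f W →
        (∀ b ∈ W, fderiv ℝ f b (Pi.single 1 1) = 0) → ContDiffOn ℝ ∞ (fun b => f b / Y b 2) U ∧
        ∀ b ∈ U, fderiv ℝ (fun b => f b / Y b 2) b (Pi.single 1 1) = 0 := by
      intro f hf hfx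
      have hs : ContDiffOn ℝ ∞ (fun b => f b / Y b 2) U := (hf.mono hUW).div ((hc 2).mono hUW) hU0
      refine ⟨hs, fun b hb => ?_⟩
      have dq := hs.differentiableAt_of_isOpen hU hb
      have d2 := ((hc 2).mono hUW).differentiableAt_of_isOpen hU hb
      have e : f =ᶠ[𝓝 b] fun b => f b / Y b 2 * Y b 2 := by
        filter_upwards [hU.mem_nhds hb] with b hb
        rw [div_mul_cancel₀ _ (hU0 b hb)]
      have e' := hfx b (hUW hb)
      rw [e.fderiv_eq (𝕜 := ℝ), fderiv_fun_mul dq d2, add_apply, smul_apply, smul_apply,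
        hYx 2 b (hUW hb), smul_zero, zero_add, smul_eq_mul] at e'
      exact (mul_eq_zero.1 e').resolve_left (hU0 b hb)
    obtain ⟨hq, hqx⟩ := hquot (fun _ => 1) contDiffOn_const fun _ _ => by simp
    obtain ⟨hr, hrx⟩ := hquot (fun b => Y b 1) (hc 1) (hYx 1)
    -- With `Q_u = 1 / η` and `R_u = ξ / η`, both independent of `x`, the new variables `x - R` and
    -- `Q` satisfy `Y (x - R) = 0` and `Y Q = 1`.
    obtain ⟨U₁, hU₁, hU₁o, hpU₁, Q, hQ, hQu, hQx⟩ := exists_partial_primitive hU hq ⟨hp, hp0⟩ 2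
    obtain ⟨U₂, hU₂, hU₂o, hpU₂, R, hR, hRu, hRx⟩ :=
      exists_partial_primitive hU₁o (hr.mono hU₁) hpU₁ 2
    have hQx' : ∀ b ∈ U₂, fderiv ℝ Q b (Pi.single 1 1) = 0 := fun b hb =>
      hQx 1 (by decide) hqx b (hU₂ hb)
    have hRx' : ∀ b ∈ U₂, fderiv ℝ R b (Pi.single 1 1) = 0 := fun b hb =>
      hRx 1 (by decide) (fun b hb => hrx b (hU₁ hb)) b hb
    have dR : ∀ b, DifferentiableAt ℝ R b := fun b => hR.differentiable (by simp) b
    have hUW₂ : U₂ ⊆ W := hU₂.trans (hU₁.trans hUW)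
    have hQv : ∀ b ∈ U₂, ∀ v : Base, v 0 = 0 → fderiv ℝ Q b v = v 2 / Y b 2 := by
      intro b hb v hv
      rw [fderiv_eq_sum, hv, hQx' b hb, hQu b (hU₂ hb)]; ring
    have hRv : ∀ b ∈ U₂, ∀ v : Base, v 0 = 0 → fderiv ℝ R b v = v 2 * (Y b 1 / Y b 2) := by
      intro b hb v hv
      rw [fderiv_eq_sum, hv, hRx' b hb, hRu b hb]; ring
    have hfR : ∀ b v : Base, fderiv ℝ (fun b => b 1 - R b) b v = v 1 - fderiv ℝ R b v := by
      intro b v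
      rw [fderiv_fun_sub (by fun_prop) (dR b), sub_apply, fderiv_coord]
    have hf : ∀ k, ContDiffOn ℝ ∞ (![fun b => b 0, fun b => b 1 - R b, Q] k) U₂ := by
      intro k
      fin_cases k
      exacts [(contDiff_coord 0).contDiffOn, ((contDiff_coord 1).sub hR).contDiffOn, hQ.contDiffOn]
    have hY2 : ∀ b ∈ U₂, Y b 2 ≠ 0 := fun b hb => hU0 b (hU₁ (hU₂ hb))
    refine (isReducible_of_components (.inl 1) rfl hU₂o hf (isTimeOnly_time _) hpU₂ ?_ ?_ ?_).mono
      hUW₂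
    · intro v hv
      have e0 : fderiv ℝ (fun b : Base => b 0) p v = 0 := hv 0
      have e1 : fderiv ℝ (fun b => b 1 - R b) p v = 0 := hv 1
      have e2 : fderiv ℝ Q p v = 0 := hv 2
      rw [fderiv_coord] at e0
      rw [hQv p hpU₂ v e0, div_eq_zero_iff, or_iff_left hp0] at e2
      rw [hfR, hRv p hpU₂ v e0, e2, zero_mul, sub_zero] at e1
      ext k
      fin_cases k
      exacts [e0, e1, e2]
    · intro b hb k
      fin_cases k
      · change fderiv ℝ (fun b : Base => b 0) b (Pi.single 1 1) = 0
        rw [fderiv_coord]; simp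
      · change fderiv ℝ (fun b => b 1 - R b) b (Pi.single 1 1) = 1
        rw [hfR, hRx' b hb]; simp
      · exact hQx' b hb
    · intro b hb k
      have h2 := hY2 b hb
      have h0 := hY0 b (hUW₂ hb)
      fin_cases k
      · change fderiv ℝ (fun b : Base => b 0) b (Y b) = 0
        rw [fderiv_coord, h0]
      · change fderiv ℝ (fun b => b 1 - R b) b (Y b) = 0
        rw [hfR, hRv b hb _ h0]; field_simp; ring
      · change fderiv ℝ Q b (Y b) = 1
        rw [hQv b hb _ h0]; field_simp
  · push Not at hη
    -- If `ξ_u` vanished identically, `Y` would be the multiple of `∂_x` by a function of the time.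
    obtain ⟨p, hp, hp0⟩ : ∃ p ∈ W, fderiv ℝ (fun b => Y b 1) p (Pi.single 2 1) ≠ 0 := by
      by_contra! hcon
      obtain ⟨p, hp, hp0⟩ := h.exists_ne_zero (f := fun b => Y b 1) (g := fun _ => -1) (hc 1)
        contDiffOn_const (fun b hb => ⟨hYx 1 b hb, hcon b hb⟩) (isTimeOnly_const _ _)
        fun _ _ => by simp
      refine hp0 (funext fun k => ?_)
      fin_cases k
      · simp [hY0 p hp]
      · simp
      · simp [hη p hp]
    have hf : ∀ k, ContDiffOn ℝ ∞ (![fun b => b 0, fun b => Y b 1, fun b => b 1] k) W := by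
      intro k
      fin_cases k
      exacts [(contDiff_coord 0).contDiffOn, hc 1, (contDiff_coord 1).contDiffOn]
    refine isReducible_of_components (.inl 2) rfl h.isOpen hf (isTimeOnly_time _) hp ?_ ?_ ?_
    · intro v hv
      have e0 : fderiv ℝ (fun b : Base => b 0) p v = 0 := hv 0
      have e1 : fderiv ℝ (fun b => Y b 1) p v = 0 := hv 1
      have e2 : fderiv ℝ (fun b : Base => b 1) p v = 0 := hv 2
      rw [fderiv_coord] at e0 e2
      rw [fderiv_eq_sum, e0, e2, zero_mul, zero_mul, add_zero, zero_add, mul_eq_zero,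
        or_iff_left hp0] at e1
      ext k
      fin_cases k
      exacts [e0, e2, e1]
    · intro b hb k
      fin_cases k
      · change fderiv ℝ (fun b : Base => b 0) b (Pi.single 1 1) = 0
        rw [fderiv_coord]; simp
      · exact hYx 1 b hb
      · change fderiv ℝ (fun b : Base => b 1) b (Pi.single 1 1) = 1
        rw [fderiv_coord]; simp
    · intro b hb k
      fin_cases k
      · change fderiv ℝ (fun b : Base => b 0) b (Y b) = 0
        rw [fderiv_coord, hY0 b hb]
      · change fderiv ℝ (fun b => Y b 1) b (Y b) = 0
        rw [fderiv_eq_sum, hY0 b hb, hη b hb, hYx 1 b hb]; ring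
      · change fderiv ℝ (fun b : Base => b 1) b (Y b) = Y b 1
        rw [fderiv_coord]

/-- Here `ξ + x` and `η` do not depend on `x`. Where `η` is nonzero, quadratures in `u` lead to the
scaling of both space variables. If `η` vanishes identically, `-ξ` itself serves as the new `x`. -/
lemma IsPair.isReducible_nonabelian_translation (h : IsPair W X (fun _ => Pi.single 1 1) 1)
    (hX0 : ∀ b ∈ W, X b 0 = 0) : IsReducible W X (fun _ => Pi.single 1 1) false := by
  have dX : ∀ b ∈ W, DifferentiableAt ℝ X b := fun b hb =>
    h.smooth_fst.differentiableAt_of_isOpen h.isOpen hb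
  have hc := fun k => contDiffOn_component h.smooth_fst k
  have hXx : ∀ k, ∀ b ∈ W, fderiv ℝ (fun b => X b k) b (Pi.single 1 1) =
      -(Pi.single 1 1 : Base) k := fun k b hb => by
    have := h.bracket b hb
    rw [lieBracket_const_right, one_smul] at this
    rw [fderiv_component_apply (dX b hb), neg_eq_iff_eq_neg.1 this]; rfl
  have hX1 : ∀ b ∈ W, fderiv ℝ (fun b => X b 1) b (Pi.single 1 1) = -1 := fun b hb => by
    rw [hXx 1 b hb]; simp
  have hX2 : ∀ b ∈ W, fderiv ℝ (fun b => X b 2) b (Pi.single 1 1) = 0 := fun b hb => by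
    rw [hXx 2 b hb]; simp
  by_cases hη : ∃ p ∈ W, X p 2 ≠ 0
  · obtain ⟨p, hp, hp0⟩ := hη
    have hU : IsOpen (W ∩ (fun b => X b 2) ⁻¹' {0}ᶜ) :=
      (hc 2).continuousOn.isOpen_inter_preimage h.isOpen isOpen_compl_singleton
    have hUW : W ∩ (fun b => X b 2) ⁻¹' {0}ᶜ ⊆ W := inter_subset_left
    set U := W ∩ (fun b => X b 2) ⁻¹' {0}ᶜ
    have hU0 : ∀ b ∈ U, X b 2 ≠ 0 := fun b hb => hb.2
    have hquot : ∀ {O : Set Base} {f : Base → ℝ}, IsOpen O → O ⊆ U → ContDiffOn ℝ ∞ f O →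
        (∀ b ∈ O, fderiv ℝ f b (Pi.single 1 1) = 0) → ContDiffOn ℝ ∞ (fun b => f b / X b 2) O ∧
        ∀ b ∈ O, fderiv ℝ (fun b => f b / X b 2) b (Pi.single 1 1) = 0 := by
      intro O f hO hOU hf hfx
      have hs : ContDiffOn ℝ ∞ (fun b => f b / X b 2) O :=
        hf.div ((hc 2).mono (hOU.trans hUW)) fun b hb => hU0 b (hOU hb)
      refine ⟨hs, fun b hb => ?_⟩
      have dq := hs.differentiableAt_of_isOpen hO hb
      have d2 := ((hc 2).mono (hOU.trans hUW)).differentiableAt_of_isOpen hO hb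
      have e : f =ᶠ[𝓝 b] fun b => f b / X b 2 * X b 2 := by
        filter_upwards [hO.mem_nhds hb] with b hb
        rw [div_mul_cancel₀ _ (hU0 b (hOU hb))]
      have e' := hfx b hb
      rw [e.fderiv_eq (𝕜 := ℝ), fderiv_fun_mul dq d2, add_apply, smul_apply, smul_apply,
        hX2 b (hUW (hOU hb)), smul_zero, zero_add, smul_eq_mul] at e'
      exact (mul_eq_zero.1 e').resolve_left (hU0 b (hOU hb))
    obtain ⟨hq, hqx⟩ := hquot (f := fun _ => 1) hU subset_rfl contDiffOn_const fun _ _ => by simp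
    -- With `Q_u = 1 / η`, the variable `exp (-Q)` has eigenvalue `-1` under `X`.
    obtain ⟨U₁, hU₁, hU₁o, hpU₁, Q, hQ, hQu, hQx⟩ := exists_partial_primitive hU hq ⟨hp, hp0⟩ 2
    have hQx' : ∀ b ∈ U₁, fderiv ℝ Q b (Pi.single 1 1) = 0 := hQx 1 (by decide) hqx
    have dQ : ∀ b, DifferentiableAt ℝ Q b := fun b => hQ.differentiable (by simp) b
    have hUW₁ : U₁ ⊆ W := hU₁.trans hUW
    have hfx : ∀ b ∈ U₁,
        fderiv ℝ (fun b => -((X b 1 + b 1) * Real.exp (Q b))) b (Pi.single 1 1) = 0 := by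
      intro b hb
      have d1 : DifferentiableAt ℝ (fun b => X b 1) b :=
        (hc 1).differentiableAt_of_isOpen h.isOpen (hUW₁ hb)
      have d1' : DifferentiableAt ℝ (fun b => X b 1 + b 1) b := d1.fun_add (by fun_prop)
      rw [fderiv_fun_neg, fderiv_fun_mul d1' (dQ b).exp, fderiv_exp (dQ b),
        fderiv_fun_add d1 (by fun_prop)]
      simp only [neg_apply, add_apply, smul_apply, smul_eq_mul, hQx' b hb, hX1 b (hUW₁ hb),
        fderiv_coord]
      simp
    -- The new `x` is sought as `x + exp (-Q) R`. Its having eigenvalue `-1` under `X` amounts to `η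
    -- R_u = -(ξ + x) exp Q`, whose right side does not depend on `x`.
    obtain ⟨hr, hrx⟩ := hquot (f := fun b => -((X b 1 + b 1) * Real.exp (Q b))) hU₁o hU₁
      ((((hc 1).mono hUW₁).add (contDiff_coord 1).contDiffOn).mul hQ.exp.contDiffOn).neg hfx
    obtain ⟨U₂, hU₂, hU₂o, hpU₂, R, hR, hRu, hRx⟩ := exists_partial_primitive hU₁o hr hpU₁ 2
    have hRx' : ∀ b ∈ U₂, fderiv ℝ R b (Pi.single 1 1) = 0 := hRx 1 (by decide) hrx
    have dR : ∀ b, DifferentiableAt ℝ R b := fun b => hR.differentiable (by simp) b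
    have hUW₂ : U₂ ⊆ W := hU₂.trans hUW₁
    have hQv : ∀ b ∈ U₂, ∀ v : Base, v 0 = 0 → fderiv ℝ Q b v = v 2 / X b 2 := by
      intro b hb v hv
      rw [fderiv_eq_sum, hv, hQx' b (hU₂ hb), hQu b (hU₂ hb)]; ring
    have hRv : ∀ b ∈ U₂, ∀ v : Base, v 0 = 0 → fderiv ℝ R b v =
        v 2 * (-((X b 1 + b 1) * Real.exp (Q b)) / X b 2) := by
      intro b hb v hv
      rw [fderiv_eq_sum, hv, hRx' b hb, hRu b hb]; ring
    have dE : ∀ b, DifferentiableAt ℝ (fun b => Real.exp (-Q b)) b := fun b => (dQ b).fun_neg.exp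
    have hfE : ∀ b v : Base, fderiv ℝ (fun b => Real.exp (-Q b)) b v =
        -(Real.exp (-Q b) * fderiv ℝ Q b v) := by
      intro b v
      rw [fderiv_exp (dQ b).fun_neg, fderiv_fun_neg, smul_apply, neg_apply]; simp
    have hfR : ∀ b v : Base, fderiv ℝ (fun b => b 1 + Real.exp (-Q b) * R b) b v =
        v 1 + Real.exp (-Q b) * (fderiv ℝ R b v - R b * fderiv ℝ Q b v) := by
      intro b v
      rw [fderiv_fun_add (by fun_prop) ((dE b).fun_mul (dR b)), add_apply, fderiv_coord,
        fderiv_fun_mul (dE b) (dR b), add_apply, smul_apply, smul_apply, hfE, smul_eq_mul,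
        smul_eq_mul]
      ring
    have hEs : ContDiff ℝ ∞ fun b => Real.exp (-Q b) := hQ.neg.exp
    have hf : ∀ k, ContDiffOn ℝ ∞
        (![fun b => b 0, fun b => b 1 + Real.exp (-Q b) * R b, fun b => Real.exp (-Q b)] k) U₂ := by
      intro k
      fin_cases k
      exacts [(contDiff_coord 0).contDiffOn, ((contDiff_coord 1).add (hEs.mul hR)).contDiffOn,
        hEs.contDiffOn]
    have hX2' : ∀ b ∈ U₂, X b 2 ≠ 0 := fun b hb => hU0 b (hU₁ (hU₂ hb))
    refine (isReducible_of_components (.inr 2) rfl hU₂o hf (isTimeOnly_time _) hpU₂ ?_ ?_ ?_).mono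
      hUW₂
    · intro v hv
      have e0 : fderiv ℝ (fun b : Base => b 0) p v = 0 := hv 0
      have e1 : fderiv ℝ (fun b => b 1 + Real.exp (-Q b) * R b) p v = 0 := hv 1
      have e2 : fderiv ℝ (fun b => Real.exp (-Q b)) p v = 0 := hv 2
      rw [fderiv_coord] at e0
      rw [hfE, neg_eq_zero, mul_eq_zero, or_iff_right (Real.exp_ne_zero _)] at e2
      have e3 := e2
      rw [hQv p hpU₂ v e0, div_eq_zero_iff, or_iff_left hp0] at e3
      rw [hfR, hRv p hpU₂ v e0, e2, e3, zero_mul, mul_zero, sub_zero, mul_zero, add_zero] at e1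
      ext k
      fin_cases k
      exacts [e0, e1, e3]
    · intro b hb k
      have h2 := hX2' b hb
      have h0 := hX0 b (hUW₂ hb)
      have hE : Real.exp (-Q b) * Real.exp (Q b) = 1 := by rw [← Real.exp_add]; simp
      have hQX : fderiv ℝ Q b (X b) = 1 := by rw [hQv b hb _ h0, div_self h2]
      have hRX : fderiv ℝ R b (X b) = -((X b 1 + b 1) * Real.exp (Q b)) := by
        rw [hRv b hb _ h0, mul_div_cancel₀ _ h2]
      fin_cases k
      · change fderiv ℝ (fun b : Base => b 0) b (X b) = 0
        rw [fderiv_coord, h0]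
      · change fderiv ℝ (fun b => b 1 + Real.exp (-Q b) * R b) b (X b) =
          -(b 1 + Real.exp (-Q b) * R b)
        rw [hfR, hQX, hRX]
        linear_combination -(X b 1 + b 1) * hE
      · change fderiv ℝ (fun b => Real.exp (-Q b)) b (X b) = -Real.exp (-Q b)
        rw [hfE, hQX, mul_one]
    · intro b hb k
      fin_cases k
      · change fderiv ℝ (fun b : Base => b 0) b (Pi.single 1 1) = 0
        rw [fderiv_coord]; simp
      · change fderiv ℝ (fun b => b 1 + Real.exp (-Q b) * R b) b (Pi.single 1 1) = 1
        rw [hfR, hRx' b hb, hQx' b (hU₂ hb)]; simp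
      · change fderiv ℝ (fun b => Real.exp (-Q b)) b (Pi.single 1 1) = 0
        rw [hfE, hQx' b (hU₂ hb)]; simp
  · push Not at hη
    obtain ⟨p, hp⟩ := h.nonempty
    have d1 : ∀ b ∈ W, DifferentiableAt ℝ (fun b => X b 1) b := fun b hb =>
      (hc 1).differentiableAt_of_isOpen h.isOpen hb
    have hf : ∀ k, ContDiffOn ℝ ∞ (![fun b => b 0, fun b => -X b 1, fun b => b 2] k) W := by
      intro k
      fin_cases k
      exacts [(contDiff_coord 0).contDiffOn, (hc 1).neg, (contDiff_coord 2).contDiffOn]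
    have hv1 : ∀ b ∈ W, ∀ v : Base, v 0 = 0 → v 2 = 0 →
        fderiv ℝ (fun b => -X b 1) b v = v 1 := by
      intro b hb v h0 h2
      rw [fderiv_fun_neg, neg_apply, fderiv_eq_sum, h0, h2, hX1 b hb]; ring
    refine isReducible_of_components (.inr 3) rfl h.isOpen hf (isTimeOnly_time _) hp ?_ ?_ ?_
    · intro v hv
      have e0 : fderiv ℝ (fun b : Base => b 0) p v = 0 := hv 0
      have e1 : fderiv ℝ (fun b => -X b 1) p v = 0 := hv 1
      have e2 : fderiv ℝ (fun b : Base => b 2) p v = 0 := hv 2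
      rw [fderiv_coord] at e0 e2
      rw [hv1 p hp v e0 e2] at e1
      ext k
      fin_cases k
      exacts [e0, e1, e2]
    · intro b hb k
      fin_cases k
      · change fderiv ℝ (fun b : Base => b 0) b (X b) = 0
        rw [fderiv_coord, hX0 b hb]
      · change fderiv ℝ (fun b => -X b 1) b (X b) = -(-X b 1)
        rw [hv1 b hb _ (hX0 b hb) (hη b hb), neg_neg]
      · change fderiv ℝ (fun b : Base => b 2) b (X b) = 0
        rw [fderiv_coord, hη b hb]
    · intro b hb k
      fin_cases k
      · change fderiv ℝ (fun b : Base => b 0) b (Pi.single 1 1) = 0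
        rw [fderiv_coord]; simp
      · change fderiv ℝ (fun b => -X b 1) b (Pi.single 1 1) = 1
        rw [hv1 b hb _ (by simp) (by simp)]; simp
      · change fderiv ℝ (fun b : Base => b 2) b (Pi.single 1 1) = 0
        rw [fderiv_coord]; simp

/-- The time component of the push-forward of a field without time component vanishes. -/
lemma IsEquivalence.push_time_eq_zero {φ : Base → Base} (hφ : IsEquivalence φ W)
    {X X' : Base → Base} (pX : ∀ b ∈ W, fderiv ℝ φ b (X b) = X' (φ b))
    (h0 : ∀ b ∈ W, X b 0 = 0) : ∀ b ∈ φ '' W, X' b 0 = 0 := by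
  rintro _ ⟨b, hb, rfl⟩
  rw [← pX b hb, hφ.fderiv_apply hb, hφ.isTimeOnly.apply hb, h0 b hb, zero_mul]

theorem IsPair.isReducible_abelian (h : IsPair W X Y 0) : IsReducible W X Y true := by
  by_cases hX : ∃ p ∈ W, X p 0 ≠ 0
  · obtain ⟨p, hp, hp0⟩ := hX
    exact h.isReducible_abelian_time hp hp0
  by_cases hY : ∃ p ∈ W, Y p 0 ≠ 0
  · obtain ⟨p, hp, hp0⟩ := hY
    refine IsReducible.of_comb (p := 0) (q := 1) (r := 1) (s := 0) (by simp) ?_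
    exact (h.comb (p := 0) (q := 1) (r := 1) (s := 0) (c' := 0) (by simp)
      (by simp)).isReducible_abelian_time hp (by simpa using hp0)
  push Not at hX hY
  obtain ⟨p, hp, hp0⟩ := h.exists_fst_ne_zero
  obtain ⟨W', hW', hpW', φ, hφ, -, he⟩ := exists_straightening h.isOpen h.smooth_fst hX hp hp0
  exact h.isReducible_of_push hW' ⟨p, hpW'⟩ hφ he fun Y' hP pY =>
    hP.isReducible_abelian_translation (hφ.push_time_eq_zero pY fun b hb => hY b (hW' hb))

theorem IsPair.isReducible_nonabelian (h : IsPair W X Y 1) : IsReducible W X Y false := by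
  by_cases hY : ∃ p ∈ W, Y p 0 ≠ 0
  · obtain ⟨p, hp, hp0⟩ := hY
    obtain ⟨W', hW', hpW', φ, hφ, he⟩ :=
      exists_time_straightening h.isOpen h.smooth_snd h.time_snd hp hp0
    exact h.isReducible_of_push_snd hW' ⟨p, hpW'⟩ hφ he fun X' hP _ => hP.isReducible_scaling_time
  by_cases hX : ∃ p ∈ W, X p 0 ≠ 0
  · push Not at hY
    obtain ⟨p, hp, hp0⟩ := hX
    obtain ⟨W', hW', hpW', φ, hφ, he⟩ :=
      exists_time_straightening h.isOpen h.smooth_fst h.time_fst hp hp0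
    exact h.isReducible_of_push hW' ⟨p, hpW'⟩ hφ he fun Y' hP pY =>
      hP.isReducible_expanding (hφ.push_time_eq_zero pY fun b hb => hY b (hW' hb))
  push Not at hX hY
  obtain ⟨p, hp, hp0⟩ := h.exists_snd_ne_zero
  obtain ⟨W', hW', hpW', φ, hφ, -, he⟩ := exists_straightening h.isOpen h.smooth_snd hY hp hp0
  exact h.isReducible_of_push_snd hW' ⟨p, hpW'⟩ hφ he fun X' hP pX =>
    hP.isReducible_nonabelian_translation (hφ.push_time_eq_zero pX fun b hb => hX b (hW' hb))

end Classification

/-! ### Reduction of symmetry algebras and of their equations -/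

section Reduction

variable {F G : Jet3 → ℝ} {Ω Ω₀ : Set Jet3} {V : Fin 2 → Base → Base}

/-- The symmetry conditions enter through the time components and `NotProportional` alone; the
closure relation then provides a basis with bracket `0` or `Y`. -/
lemma exists_isReducible (hE : IsEquation F G Ω) (hL : IsTwoDimLieAlgebra (base3 '' Ω) V)
    (hsym : ∀ k, IsSymmetry F G Ω (V k)) (hsub : Ω₀ ⊆ Ω) (hΩ₀ : IsOpen Ω₀) (hne : Ω₀.Nonempty) :
    ∃ a : Bool, (a = true ↔ IsAbelianOn (base3 '' Ω) V) ∧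
      IsReducible (base3 '' Ω₀) (V 0) (V 1) a := by
  have hW : base3 '' Ω₀ ⊆ base3 '' Ω := image_mono hsub
  have hsm := fun k => (hL.smooth k).mono hW
  have ht : ∀ k, IsTimeOnly (fun b => V k b 0) (base3 '' Ω₀) := fun k =>
    ((hsym k).isTimeOnly hE (hL.smooth k)).mono hW
  have hN : NotProportional (base3 '' Ω₀) (V 0) (V 1) :=
    (notProportional_of_isSymmetry hE hL hsym).mono hW
  have hWo : IsOpen (base3 '' Ω₀) := isOpenMap_base3 _ hΩ₀
  obtain ⟨c, hc⟩ := hL.closed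
  by_cases h0 : c = 0
  · have hA : IsAbelianOn (base3 '' Ω) V := fun b hb => by simp [hc b hb, h0]
    exact ⟨true, by simp [hA], IsPair.isReducible_abelian ⟨hWo, hne.image _, hsm 0, hsm 1, ht 0,
      ht 1, fun b hb => by rw [hA b (hW hb), zero_smul], hN⟩⟩
  · have hA : ¬ IsAbelianOn (base3 '' Ω) V := fun hA =>
      h0 (hL.indep _ subset_rfl hL.isOpen ((hne.mono hsub).image _) c fun b hb => by
        rw [← hc b hb, hA b hb])
    have hd : c 0 ^ 2 + c 1 ^ 2 ≠ 0 := fun h => h0 <| by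
      have h1 : c 0 = 0 := by nlinarith [sq_nonneg (c 0), sq_nonneg (c 1)]
      have h2 : c 1 = 0 := by nlinarith [sq_nonneg (c 0), sq_nonneg (c 1)]
      ext k
      fin_cases k
      exacts [h1, h2]
    -- The second new basis field is the bracket `c 0 V 0 + c 1 V 1`. The first is `(c 1 V 0 - c 0 V
    -- 1) / (c 0 ^ 2 + c 1 ^ 2)`, chosen so that the change of basis has determinant 1 and the
    -- bracket is therefore unchanged.
    have hdet : c 1 / (c 0 ^ 2 + c 1 ^ 2) * c 1 - -c 0 / (c 0 ^ 2 + c 1 ^ 2) * c 0 = 1 := by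
      field_simp
      ring
    have hdet' := hdet.trans_ne one_ne_zero
    refine ⟨false, by simp [hA], IsReducible.of_comb hdet' (IsPair.isReducible_nonabelian
      (hN.isPair_comb hWo (hne.image _) (hsm 0) (hsm 1) (ht 0) (ht 1) hdet' fun b hb => ?_))⟩
    rw [hdet, hc b (hW hb), Fin.sum_univ_two]

lemma exists_reduction (hE : IsEquation F G Ω) (hL : IsTwoDimLieAlgebra (base3 '' Ω) V)
    (hsym : ∀ k, IsSymmetry F G Ω (V k)) (hsub : Ω₀ ⊆ Ω) (hΩ₀ : IsOpen Ω₀) (hne : Ω₀.Nonempty) :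
    ∃ Ω₁ ⊆ Ω₀, IsOpen Ω₁ ∧ Ω₁.Nonempty ∧
      ∃ i : Fin 3 ⊕ Fin 4, (i.isLeft = true ↔ IsAbelianOn (base3 '' Ω) V) ∧
      ∃ φ : Base → Base, IsEquivalence φ (base3 '' Ω₁) ∧
        CarriesAlgebra φ (base3 '' Ω₁) V (canonical i) ∧
      ∃ (F' G' : Jet3 → ℝ) (Ω' : Set Jet3), IsEquation F' G' Ω' ∧
        CarriesEquation φ F G Ω₁ F' G' Ω' ∧ HasTableForm i F' G' Ω' := by
  obtain ⟨a, ha, i, rfl, W', hW', ⟨b, hb⟩, φ, hφ, hφV⟩ :=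
    exists_isReducible hE hL hsym hsub hΩ₀ hne
  have hV : ![V 0, V 1] = V := by
    ext k
    fin_cases k <;> rfl
  rw [hV] at hφV
  have hWeq : base3 '' (Ω₀ ∩ base3 ⁻¹' W') = W' := by
    rw [image_inter_preimage, inter_eq_right.2 hW']
  have hbase : Continuous base3 := by
    unfold base3
    fun_prop
  obtain ⟨z, hz, rfl⟩ := hW' hb
  obtain ⟨Ω₁, hΩ₁, ho, hne₁, hφ₁, hc₁, hex⟩ := exists_tableForm hE hL.smooth hsym
    (inter_subset_left.trans hsub) (hΩ₀.inter (hφ.isOpen.preimage hbase)) ⟨z, hz, hb⟩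
    (by rwa [hWeq]) (by rwa [hWeq])
  exact ⟨Ω₁, hΩ₁.trans inter_subset_left, ho, hne₁, i, ha, φ, hφ₁, hc₁, hex⟩

end Reduction

end EvolutionSymmetry

theorem mainTheorem3 :
    -- the seven algebras, with their commutation relations, are admitted by the class
    (∀ i : Fin 3 ⊕ Fin 4,
      IsTwoDimLieAlgebra Set.univ (canonical i) ∧
      (∀ b, VectorField.lieBracket ℝ (canonical i 0) (canonical i 1) b =
        Sum.elim (fun _ => 0) (fun _ => canonical i 1 b) i) ∧
      ∃ (F G : Jet3 → ℝ) (Ω : Set Jet3), Ω.Nonempty ∧ IsEquation F G Ω ∧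
        ∀ k, IsSymmetry F G Ω (canonical i k)) ∧
    -- they are pairwise inequivalent, on whatever open sets
    (∀ i j : Fin 3 ⊕ Fin 4, i ≠ j →
      ¬ ∃ (W : Set Base) (φ : Base → Base), W.Nonempty ∧ IsEquivalence φ W ∧
        CarriesAlgebra φ W (canonical i) (canonical j)) ∧
    -- every two-dimensional symmetry algebra is locally, near generic points, equivalent to one of
    -- them, and the equation becomes one of the corresponding row of the table
    (∀ (F G : Jet3 → ℝ) (Ω : Set Jet3) (V : Fin 2 → Base → Base),
      IsEquation F G Ω → IsTwoDimLieAlgebra (base3 '' Ω) V → (∀ k, IsSymmetry F G Ω (V k)) →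
      ∀ Ω₀ ⊆ Ω, IsOpen Ω₀ → Ω₀.Nonempty →
        ∃ Ω₁ ⊆ Ω₀, IsOpen Ω₁ ∧ Ω₁.Nonempty ∧
        ∃ i : Fin 3 ⊕ Fin 4, (i.isLeft = true ↔ IsAbelianOn (base3 '' Ω) V) ∧
        ∃ φ : Base → Base, IsEquivalence φ (base3 '' Ω₁) ∧
          CarriesAlgebra φ (base3 '' Ω₁) V (canonical i) ∧
        ∃ (F' G' : Jet3 → ℝ) (Ω' : Set Jet3), IsEquation F' G' Ω' ∧
          CarriesEquation φ F G Ω₁ F' G' Ω' ∧ HasTableForm i F' G' Ω') ∧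
    -- the equations that admit a given one of the seven algebras are those of its row
    (∀ (i : Fin 3 ⊕ Fin 4) (F G : Jet3 → ℝ) (Ω : Set Jet3), IsEquation F G Ω →
      ((∀ k, IsSymmetry F G Ω (canonical i k)) ↔
        ∀ B ⊆ Ω ∩ regular i, IsOpenBox B → HasTableForm i F G B)) :=
  ⟨fun i => ⟨isTwoDimLieAlgebra_canonical i, lieBracket_canonical i, exists_equation_canonical i⟩,
    fun _ _ => canonical_inequivalent,
    fun _ _ _ _ hE hL hsym _ hsub hΩ₀ hne => exists_reduction hE hL hsym hsub hΩ₀ hne,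
    fun i _ _ _ hE => isSymmetry_canonical_iff_hasTableForm i hE⟩
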